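/- Let $\Phi$ be a (finite, reduced, crystallographic) irreducible root system with Weyl group $W$, length function $\ell$, positive roots $\Phi^+$ and simple roots $\alpha_1,\dots,\alpha_r$; let $s_{\alpha,k}(x)=s_\alpha(x)+k\alpha$, let $H_{\alpha,k}=\{x:\langle x,\alpha^\vee\rangle=k\}$, let $A_\circ=\{x: 0<\langle x,\alpha^\vee\rangle<1 \text{ for all } \alpha\in\Phi^+\}$, and let $\theta^\vee$ be the highest coroot. The affine Weyl group $W_{\rm aff}$ is generated by $s_0=s_{\alpha_0,-1}$, where $\alpha_0=-\theta$, and $s_i=s_{\alpha_i,0}$, $1\le i\le r$; write $\bar s_i=s_{\alpha_i}$ for the linear part. For $u,w\in W$ write $w\lessdot u$ if $u=ws_\beta$ with $\beta\in\Phi^+$ and $\ell(u)=\ell(w)+1$. *$\lambda$-chains and admissible subsets.* Let $\lambda$ be a dominant integral weight and let $v_{-\lambda}\in W_{\rm aff}$ be given by $v_{-\lambda}(A_\circ)=A_\circ-\lambda$. A $\lambda$-chain is a sequence of positive roots $\Gamma=(\beta_1,\dots,\beta_n)$ with $\beta_j=\bar s_{i_1}\cdots\bar s_{i_{j-1}}(\alpha_{i_j})$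 for some reduced decomposition $v_{-\lambda}=s_{i_1}\cdots s_{i_n}$. Put $l_i^\emptyset=\#\{j<i:\beta_j=\beta_i\}$, $r_i=s_{\beta_i}$, $\hat r_i=s_{\beta_i,-l_i^\emptyset}$. For $J=\{j_1<\dots<j_s\}\subseteq\{1,\dots,n\}$ let $w(J)=r_{j_1}\cdots r_{j_s}$ and $\mu(J)=-\hat r_{j_1}\cdots\hat r_{j_s}(-\lambda)$. Let $\mathcal A(\Gamma)$ be the set of all $J$ (called admissible) with $1\lessdot r_{j_1}\lessdot r_{j_1}r_{j_2}\lessdot\cdots\lessdot r_{j_1}\cdots r_{j_s}$. The same definitions are used for any other sequence of positive roots, with the given $\lambda$. *Root operators.* Fix a simple root $\alpha_p$ and $J\subseteq\{1,\dots,n\}$. For each $i$, let $j_1<\dots<j_k$ be the elements of $J$ less than $i$, let $\gamma_i=r_{j_1}\cdots r_{j_k}(\beta_i)$, and let $l_i$ be the integer with $\hat r_{j_1}\cdots\hat r_{j_k}(H_{\beta_i,-l_i^\emptyset})=H_{-|\gamma_i|,l_i}$, where $|\gamma|$ is the positive one of $\pm\gamma$. Let $I(J,p)=\{i:\gamma_i=\pm\alpha_p\}$,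 $l_\infty^p=\langle\mu(J),\alpha_p^\vee\rangle$, and $M(J,p)=\max(\{l_i: i\in I(J,p)\}\cup\{l^p_\infty\})$. Then $F_p(J)$ is defined if and only if $M(J,p)>0$; in this case $F_p(J)=(J\setminus\{m\})\cup\{k\}$, where $m=\min\{i\in I(J,p): l_i=M(J,p)\}$ ($m=\infty$ if this set is empty) and $k$ is the predecessor of $m$ in $I(J,p)\cup\{\infty\}$. *Yang–Baxter moves.* Let $\Gamma$ be a $\lambda$-chain in which $q$ consecutive entries $\beta_{t+1},\dots,\beta_{t+q}$ are, without repetition, the positive roots of a rank two root system $\overline\Phi\subseteq\Phi$, and let $\Gamma'$ be obtained from $\Gamma$ by reversing this segment. Put $\alpha=\beta_{t+1}$, $\beta=\beta_{t+q}$, and let $\overline W$ be the subgroup of $W$ generated by the reflections in the roots of $\overline\Phi$. Write $u\in W$ as $u=\lfloor u\rfloor\bar u$, where $\lfloor u\rfloor$ is the minimal length representative of $u\overline W$ and $\bar u\in\overline W$, and let $\bar\ell$ be the length on $\overline W$ with respect to the generators $s_\alpha,s_\beta$. For $J\in\mathcal A(\Gamma)$ let $u=w(J\cap\{1,\dots,t\})$,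 $w=w(J\cap\{1,\dots,t+q\})$, $a=\bar\ell(\bar u)$, $b=\bar\ell(\bar w)$. Then $Y(J)$ is obtained from $J$ by replacing the part $\{i: t+i\in J,\ 1\le i\le q\}$ of $J$ in the segment by its image under the involution $Y_{q,a,b}$, which is given by $\emptyset\leftrightarrow\emptyset$ if $a=b$; $\{1\}\leftrightarrow\{q\}$ if $0\le a=b-1\le q-1$; $\{q-a\}\leftrightarrow\{a+1\}$ if $0<a=b-1<q-1$; $\{1,a+2,a+3,\dots,b\}\leftrightarrow\{a+1,\dots,b-1,q\}$ if $0\le a<a+2\le b<q$; $\{1,a+2,\dots,b-1,q\}\leftrightarrow\{a+1,\dots,b\}$ if $0<a<a+2\le b\le q$; $\{1,\dots,q\}\leftrightarrow\{1,\dots,q\}$ if $a=0$, $b=q$. **Theorem.** The map $Y$ sends $\mathcal A(\Gamma)$ to $\mathcal A(\Gamma')$ and commutes with the root operators: for every $J\in\mathcal A(\Gamma)$ and every simple root $\alpha_p$, the operator $F_p$ is defined on $J$ if and only if it is defined on $Y(J)$ (with respect to $\Gamma'$), and in that case $F_p(J)\in\mathcal A(\Gamma)$ and $Y(F_p(J))=F_p(Y(J))$.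 -/

import Mathlib

noncomputable section

/-- The length of `g` with respect to a set `S`: the least number of factors in an expression of
`g` as a product of elements of `S`. (It is only used for groups generated by the involutions
in `S`.) -/
def wordLength {G : Type*} [Group G] (S : Set G) (g : G) : ℕ :=
  sInf {k | ∃ l : List G, l.length = k ∧ (∀ x ∈ l, x ∈ S) ∧ l.prod = g}

namespace AlcoveModel

open RootPairing

section Weyl

variable {ι M N : Type*} [AddCommGroup M] [Module ℝ M] [AddCommGroup N] [Module ℝ N]
  {P : RootPairing ι ℝ M N}

/-- The reflection `s_α` as an element of the Weyl group. -/
def refl (P : RootPairing ι ℝ M N) (α : ι) : P.weylGroup := weylGroup.ofIdx P α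

/-- The length `ℓ` on the Weyl group, with respect to the simple reflections. -/
def length (b : P.Base) (w : P.weylGroup) : ℕ :=
  wordLength (refl P '' (b.support : Set ι)) w

/-- `u` covers `w` in the Bruhat order: `w = u s_β` with `β` a positive root and
`ℓ(u) = ℓ(w) + 1`. -/
def Covers (b : P.Base) (u w : P.weylGroup) : Prop :=
  ∃ β, b.IsPos β ∧ w = u * refl P β ∧ length b u = length b w + 1

/-- Dominant (integral) weights. -/
def IsDominantWeight (b : P.Base) (lam : M) : Prop :=
  (∀ α, ∃ z : ℤ, P.coroot' α lam = z) ∧ ∀ α, b.IsPos α → 0 ≤ P.coroot' α lam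

end Weyl

section Affine

variable {ι M N : Type*} [AddCommGroup M] [Module ℝ M] [AddCommGroup N] [Module ℝ N]
  {P : RootPairing ι ℝ M N}

/-- The affine hyperplane `H_{α,k} = {x | ⟨x, α^∨⟩ = k}`. -/
def hyperplane (P : RootPairing ι ℝ M N) (α : ι) (k : ℤ) : Set M :=
  {x | P.coroot' α x = k}

/-- The affine reflection `s_{α,k} : x ↦ s_α(x) + k α`. -/
def affRefl (P : RootPairing ι ℝ M N) (α : ι) (k : ℤ) : M ≃ᵃ[ℝ] M :=
  (P.reflection α).toAffineEquiv.trans (AffineEquiv.constVAdd ℝ M ((k : ℝ) • P.root α))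

/-- The fundamental alcove. -/
def fundAlcove (b : P.Base) : Set M :=
  {x | ∀ α, b.IsPos α → 0 < P.coroot' α x ∧ P.coroot' α x < 1}

/-- `θ^∨` is the highest coroot, i.e. the coroot of maximal height. -/
def IsHighestCoroot (b : P.Base) (θ : ι) : Prop :=
  ∀ α, b.flip.height α ≤ b.flip.height θ

/-- The roots `α_0 = -θ` (for `none`) and `α_1, …, α_r` (the simple roots). -/
def affSimpleRoot (b : P.Base) (θ : ι) : Option b.support → ι
  | none => P.reflectionPerm θ θ
  | some i => i

/-- The generators `s_0 = s_{α_0,-1}` and `s_i = s_{α_i,0}` of the affine Weyl group. -/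
def affGen (b : P.Base) (θ : ι) : Option b.support → (M ≃ᵃ[ℝ] M)
  | none => affRefl P (affSimpleRoot b θ none) (-1)
  | some i => affRefl P i 0

/-- `Γ = (β_1, …, β_n)` is a `λ`-chain of roots: it is a sequence of positive roots arising from a
reduced decomposition `v_{-λ} = s_{i_1} ⋯ s_{i_n}` in the affine Weyl group, where
`v_{-λ}(A_∘) = A_∘ - λ`, through `β_j = s̄_{i_1} ⋯ s̄_{i_{j-1}}(α_{i_j})`. The linear parts `s̄_i`
act here on the index set of the roots. -/
def IsLambdaChain (b : P.Base) (lam : M) {n : ℕ} (Γ : Fin n → ι) : Prop :=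
  ∃ θ, IsHighestCoroot b θ ∧ ∃ word : Fin n → Option b.support,
    let v : M ≃ᵃ[ℝ] M := (List.ofFn fun j => affGen b θ (word j)).prod
    v '' fundAlcove b = (fun x => x - lam) '' fundAlcove b ∧
    wordLength (Set.range (affGen b θ)) v = n ∧
    ∀ j, b.IsPos (Γ j) ∧
      Γ j = (((List.ofFn fun i =>
        (P.reflectionPerm (affSimpleRoot b θ (word i)) : Equiv.Perm ι)).take j).prod)
          (affSimpleRoot b θ (word j))

open scoped Classical in
/-- The integer `l` with `H_{γ,m} = H_{-|γ|,l}`. -/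
def levelOf (b : P.Base) (h : ι × ℤ) : ℤ := if b.IsPos h.1 then -h.2 else h.2

open scoped Classical in
lemma hyperplane_eq_levelOf (b : P.Base) (h : ι × ℤ) :
    hyperplane P h.1 h.2 = {x | (if b.IsPos h.1 then -P.coroot' h.1 x else P.coroot' h.1 x)
      = levelOf b h} := by
  ext x
  by_cases hb : b.IsPos h.1
  · simp [hyperplane, levelOf, hb]
  · simp [hyperplane, levelOf, hb]

end Affine

section Admissible

variable {ι M N : Type*} [AddCommGroup M] [Module ℝ M] [AddCommGroup N] [Module ℝ N]
  {P : RootPairing ι ℝ M N} {n : ℕ}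

/-- `w(J) = r_{j_1} ⋯ r_{j_s}` for `J = {j_1 < ⋯ < j_s}`, where `r_j = s_{β_j}`. -/
def weylElt (P : RootPairing ι ℝ M N) (Γ : Fin n → ι) (J : Finset (Fin n)) : P.weylGroup :=
  ((J.sort (· ≤ ·)).map fun j => refl P (Γ j)).prod

/-- `J ∈ 𝒜(Γ)`: we have `1 ⋖ r_{j_1} ⋖ r_{j_1} r_{j_2} ⋖ ⋯ ⋖ r_{j_1} ⋯ r_{j_s}`. -/
def IsAdmissible (b : P.Base) (Γ : Fin n → ι) (J : Finset (Fin n)) : Prop :=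
  ∀ j ∈ J, Covers b (weylElt P Γ (J.filter (· ≤ j))) (weylElt P Γ (J.filter (· < j)))

open scoped Classical in
/-- `l_i^∅`, the number of earlier occurrences of `β_i` in `Γ`. -/
def initLevel (Γ : Fin n → ι) (i : Fin n) : ℕ :=
  (Finset.univ.filter fun j => j < i ∧ Γ j = Γ i).card

/-- The reflection `r̂_i = s_{β_i, -l_i^∅}` in the `i`th wall of the alcove path of `Γ`. -/
def affReflAt (P : RootPairing ι ℝ M N) (Γ : Fin n → ι) (i : Fin n) : M ≃ᵃ[ℝ] M :=
  affRefl P (Γ i) (-(initLevel Γ i : ℤ))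

/-- The weight `μ(J) = -r̂_{j_1} ⋯ r̂_{j_s}(-λ)`. -/
def weight (P : RootPairing ι ℝ M N) (lam : M) (Γ : Fin n → ι) (J : Finset (Fin n)) : M :=
  -(((J.sort (· ≤ ·)).map (affReflAt P Γ)).prod (-lam))

end Admissible

section Folding

variable {ι M N : Type*} [AddCommGroup M] [Module ℝ M] [AddCommGroup N] [Module ℝ N]
  {P : RootPairing ι ℝ M N} [P.IsCrystallographic] {n : ℕ}

/-- The image of the hyperplane `H_{β,m}`, encoded as the pair `(β, m)`, under the reflection
`s_{α,k}`, where `a = (α, k)`: the root becomes `s_α(β)`. -/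
def reflHyp (P : RootPairing ι ℝ M N) [P.IsCrystallographic] (a h : ι × ℤ) : ι × ℤ :=
  (P.reflectionPerm a.1 h.1, h.2 - a.2 * P.pairingIn ℤ a.1 h.1)

lemma affRefl_image_hyperplane (a h : ι × ℤ) :
    affRefl P a.1 a.2 '' hyperplane P h.1 h.2 =
      hyperplane P (reflHyp P a h).1 (reflHyp P a h).2 := by
  have hpair : ∀ j, P.coroot' j (P.root a.1) = (P.pairingIn ℤ a.1 j : ℝ) := fun j => by
    rw [P.root_coroot'_eq_pairing, ← P.algebraMap_pairingIn ℤ]; rfl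
  have hap : ∀ x, affRefl P a.1 a.2 x = P.reflection a.1 x + (a.2 : ℝ) • P.root a.1 := fun x => by
    simp [affRefl, add_comm]
  have key : ∀ x, P.coroot' (P.reflectionPerm a.1 h.1) (affRefl P a.1 a.2 x) =
      P.coroot' h.1 x - a.2 * P.pairingIn ℤ a.1 h.1 := fun x => by
    rw [hap, ← P.coroot'_reflection, map_add, map_smul, map_add, map_smul]
    simp only [P.reflection_apply_self, P.reflection_same, map_neg, hpair, smul_eq_mul]
    ring
  ext y
  obtain ⟨x, rfl⟩ := (affRefl P a.1 a.2).surjective y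
  rw [(affRefl P a.1 a.2).injective.mem_set_image]
  simp only [hyperplane, reflHyp, Set.mem_ofPred_eq, key]
  push_cast
  constructor <;> intro h' <;> linarith

/-- A folded gallery together with its chain of roots: for each `i` the pair `(γ_i, m_i)` such that
the face `F_i` lies in `H_{γ_i, m_i}`. For `Γ` itself, `γ_i = β_i` and `F_i ⊂ H_{β_i, -l_i^∅}`. -/
def initFolding (Γ : Fin n → ι) (i : Fin n) : ι × ℤ := (Γ i, -(initLevel Γ i : ℤ))

/-- The folding operator `φ_i`: it reflects everything after position `i` in the hyperplane
containing `F_i`. -/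
def foldAt (P : RootPairing ι ℝ M N) [P.IsCrystallographic] (i : Fin n) (g : Fin n → ι × ℤ) :
    Fin n → ι × ℤ :=
  fun j => if i < j then reflHyp P (g i) (g j) else g j

/-- `φ_{j_1} ⋯ φ_{j_s}` applied to the unfolded gallery, for `J = {j_1 < ⋯ < j_s}`. -/
def folding (P : RootPairing ι ℝ M N) [P.IsCrystallographic] (Γ : Fin n → ι)
    (J : Finset (Fin n)) : Fin n → ι × ℤ :=
  (J.sort (· ≤ ·)).foldr (foldAt P) (initFolding Γ)

/-- `l_i`, defined by `F_i ⊂ H_{-|γ_i|, l_i}`. -/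
def level (b : P.Base) (Γ : Fin n → ι) (J : Finset (Fin n)) (i : Fin n) : ℤ :=
  levelOf b (folding P Γ J i)

open scoped Classical in
/-- `I(J,p) = {i | γ_i = ±α_p}`. -/
def posSet (P : RootPairing ι ℝ M N) [P.IsCrystallographic] (p : ι) (Γ : Fin n → ι)
    (J : Finset (Fin n)) : Finset (Fin n) :=
  Finset.univ.filter fun i =>
    P.root (folding P Γ J i).1 = P.root p ∨ P.root (folding P Γ J i).1 = -P.root p

/-- `l_∞^p = ⟨μ(J), α_p^∨⟩`. -/
def levelInf (P : RootPairing ι ℝ M N) (lam : M) (p : ι) (Γ : Fin n → ι)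
    (J : Finset (Fin n)) : ℝ :=
  P.coroot' p (weight P lam Γ J)

open scoped Classical in
/-- `M(J,p)`, the maximum of `l_∞^p` and of the `l_i` with `i ∈ I(J,p)`. -/
def maxLevel (b : P.Base) (lam : M) (p : ι) (Γ : Fin n → ι) (J : Finset (Fin n)) : ℝ :=
  (insert (levelInf P lam p Γ J)
    ((posSet P p Γ J).image fun i : Fin n => (level b Γ J i : ℝ))).max' (Finset.insert_nonempty _ _)

open scoped Classical in
/-- `m_F(J,p)`; the value `⊤` stands for `∞`. -/
def mF (b : P.Base) (lam : M) (p : ι) (Γ : Fin n → ι) (J : Finset (Fin n)) : WithTop (Fin n) :=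
  ((posSet P p Γ J).filter fun i : Fin n => (level b Γ J i : ℝ) = maxLevel b lam p Γ J).min

open scoped Classical in
/-- `k_F(J,p)`, the predecessor of `m_F(J,p)` in `I(J,p) ∪ {∞}` (`⊥` if there were none). -/
def kF (b : P.Base) (lam : M) (p : ι) (Γ : Fin n → ι) (J : Finset (Fin n)) : WithBot (Fin n) :=
  ((posSet P p Γ J).filter fun i : Fin n => (i : WithTop (Fin n)) < mF b lam p Γ J).max

open scoped Classical in
/-- The root operator `F_p`: it is defined on `J` if and only if `M(J,p) > 0`, and then
`F_p(J) = (J ∖ {m}) ∪ {k}`. The value `none` means undefined. -/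
def rootF (b : P.Base) (lam : M) (p : ι) (Γ : Fin n → ι) (J : Finset (Fin n)) :
    Option (Finset (Fin n)) :=
  if 0 < maxLevel b lam p Γ J then
    some ((J.filter fun i : Fin n => (i : WithTop (Fin n)) ≠ mF b lam p Γ J) ∪
      Finset.univ.filter fun i : Fin n => (i : WithBot (Fin n)) = kF b lam p Γ J)
  else none

end Folding

section YangBaxter

variable {ι M N : Type*} [AddCommGroup M] [Module ℝ M] [AddCommGroup N] [Module ℝ N]
  {P : RootPairing ι ℝ M N} {n : ℕ}

/-- The position `i` belongs to the segment of length `q` that starts after the first `t`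
positions. Its members, counted from `1`, are the elements `1 < ⋯ < q` of the index set. -/
def InSeg (t q : ℕ) (i : Fin n) : Prop := t ≤ (i : ℕ) ∧ (i : ℕ) < t + q

/-- The roots in the segment are the positive roots (without repetition) of a rank two root
system `Φ̄ ⊆ Φ`, i.e. together with their negatives they are closed under their reflections and
span a plane. -/
structure IsDihedralSegment (P : RootPairing ι ℝ M N) (Γ : Fin n → ι) (t q : ℕ) : Prop where
  le : t + q ≤ n
  inj : ∀ i j, InSeg t q i → InSeg t q j → Γ i = Γ j → i = j
  closed : ∀ i j, InSeg t q i → InSeg t q j → ∃ k, InSeg t q k ∧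
    (P.reflection (Γ i) (P.root (Γ j)) = P.root (Γ k) ∨
      P.reflection (Γ i) (P.root (Γ j)) = -P.root (Γ k))
  rank_two : Module.finrank ℝ
    (Submodule.span ℝ ((fun i => P.root (Γ i)) '' {i | InSeg t q i})) = 2

open scoped Classical in
/-- `Γ'`, obtained from `Γ` by reversing the segment. -/
def reverseSeg (Γ : Fin n → ι) (t q : ℕ) : Fin n → ι := fun i =>
  if h : InSeg t q i ∧ t + q ≤ n then
    Γ ⟨t + (t + q - 1 - i), by unfold InSeg at h; omega⟩
  else Γ i

/-- The dihedral reflection subgroup `W̄` generated by the reflections of the segment. -/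
def segSubgroup (P : RootPairing ι ℝ M N) (Γ : Fin n → ι) (t q : ℕ) : Subgroup P.weylGroup :=
  Subgroup.closure ((fun i => refl P (Γ i)) '' {i | InSeg t q i})

/-- The reflections `s_α`, `s_β` in the first and the last root of the segment; these roots are
the simple roots `α`, `β` of `Φ̄`. -/
def segGens (P : RootPairing ι ℝ M N) (Γ : Fin n → ι) (t q : ℕ) : Set P.weylGroup :=
  (fun i => refl P (Γ i)) '' {i | (i : ℕ) = t ∨ (i : ℕ) + 1 = t + q}

lemma exists_minRep (b : P.Base) (H : Subgroup P.weylGroup) (u : P.weylGroup) :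
    ∃ x : P.weylGroup, x⁻¹ * u ∈ H ∧ ∀ y : P.weylGroup, y⁻¹ * u ∈ H → length b x ≤ length b y := by
  obtain ⟨x, hx, hmin⟩ := exists_minimalFor_of_wellFoundedLT
    (fun x : P.weylGroup => x⁻¹ * u ∈ H) (length b) ⟨u, by simp [H.one_mem]⟩
  exact ⟨x, hx, fun y hy => (le_total (length b x) (length b y)).elim id (hmin hy)⟩

/-- `⌊u⌋`, the representative of minimal length of the left coset `u H`. -/
def minRep (b : P.Base) (H : Subgroup P.weylGroup) (u : P.weylGroup) : P.weylGroup :=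
  (exists_minRep b H u).choose

/-- `ℓ(ū)`, where `u = ⌊u⌋ ū` with `ū ∈ W̄`, and the length is taken in the Coxeter group `W̄` with
generators `s_α`, `s_β`. -/
def barLength (b : P.Base) (Γ : Fin n → ι) (t q : ℕ) (u : P.weylGroup) : ℕ :=
  wordLength (segGens P Γ t q) ((minRep b (segSubgroup P Γ t q) u)⁻¹ * u)

/-- The involution `Y_{q,a,b}`; the cases in order are 1.1, 1.2, 2.1, 2.2 (each in both
directions), and the cases 0 and 3, in which it fixes `∅` and `[q]`. -/
def ybInvolution (q a b : ℕ) (K : Finset ℕ) : Finset ℕ :=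
  if a + 1 = b ∧ b ≤ q ∧ K = {1} then {q}
  else if a + 1 = b ∧ b ≤ q ∧ K = {q} then {1}
  else if 0 < a ∧ a + 1 = b ∧ b < q ∧ K = {q - a} then {a + 1}
  else if 0 < a ∧ a + 1 = b ∧ b < q ∧ K = {a + 1} then {q - a}
  else if a + 2 ≤ b ∧ b < q ∧ K = {1} ∪ Finset.Icc (a + 2) b then
    Finset.Icc (a + 1) (b - 1) ∪ {q}
  else if a + 2 ≤ b ∧ b < q ∧ K = Finset.Icc (a + 1) (b - 1) ∪ {q} then
    {1} ∪ Finset.Icc (a + 2) b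
  else if 0 < a ∧ a + 2 ≤ b ∧ b ≤ q ∧ K = {1} ∪ Finset.Icc (a + 2) (b - 1) ∪ {q} then
    Finset.Icc (a + 1) b
  else if 0 < a ∧ a + 2 ≤ b ∧ b ≤ q ∧ K = Finset.Icc (a + 1) b then
    {1} ∪ Finset.Icc (a + 2) (b - 1) ∪ {q}
  else K

open scoped Classical in
/-- The Yang–Baxter move `Y(J) = J̄ ∪ Y_{q,a,b}(J ∖ J̄)`, where `J̄` is the part of `J` outside of
the segment, `a = ℓ(ū)` and `b = ℓ(w̄)`, `u` is `w(·)` of the part of `J` before the segment, and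
`w` is `w(·)` of the part of `J` before the end of the segment. -/
def ybMove (b : P.Base) (Γ : Fin n → ι) (t q : ℕ) (J : Finset (Fin n)) : Finset (Fin n) :=
  let u := weylElt P Γ (J.filter fun i : Fin n => (i : ℕ) < t)
  let w := weylElt P Γ (J.filter fun i : Fin n => (i : ℕ) < t + q)
  let K : Finset ℕ := (J.filter (InSeg t q)).image fun i : Fin n => (i : ℕ) - t + 1
  let K' := ybInvolution q (barLength b Γ t q u) (barLength b Γ t q w) K
  (J.filter fun i : Fin n => ¬ InSeg t q i) ∪
    Finset.univ.filter fun i : Fin n => InSeg t q i ∧ (i : ℕ) - t + 1 ∈ K'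

end YangBaxter

end AlcoveModel

end

set_option linter.unusedSectionVars false
set_option linter.unusedSimpArgs false

/-! ### Weyl group: action on roots, inversions, length, Bruhat covers. -/

noncomputable section

namespace AlcoveModel

open RootPairing

variable {ι M N : Type*} [AddCommGroup M] [Module ℝ M] [AddCommGroup N] [Module ℝ N]
  {P : RootPairing ι ℝ M N}

/-! Read Γ as an alcove path from A_∘ to A_∘ − λ and fold it at the positions in J. For a simple
root α_p, two functions of the time i record the folded path: the height `ht`, which says between
which consecutive hyperplanes orthogonal to α_p the i-th folded alcove lies, and the sign of the
root w_i⁻¹α_p (`rootAt`). The height changes only where a wall orthogonal to α_p is crossed without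
folding. By the lifting property of Bruhat covers (`eq_of_cover`), the sign of an admissible path
passes from plus to minus only at a fold with w_i⁻¹α_p = β_i. Hence M(J,p), when positive, is the
maximal height; k is the step that first reaches it, and m is the fold after which the path is first
at that height with negative sign (`IsWalk.exists_isTurn`, `rootF_eq_some`). So the operator F_p is
read off from heights and signs alone (`IsTurn.lt_iff`, `IsTurn.fold_lt_iff`); it multiplies w_i on
the left by s_p for k < i ≤ m and fixes all other w_i (`IsTurn.weylAt_moveFold`).

The hyperplanes crossed in the segment meet in a face of codimension two: their levels are
compatible with the reflections of the rank two system (`IsAlcovePath.offset_reflect`). This forces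
the segment to list the positive roots in the cyclic order of a dihedral group
(`IsReflectingCycle.isDihedral`), and the reversed segment goes round the same face on the other
side, so that Γ' is again an alcove path (`IsAlcovePath.reverseSeg`). Inside the segment a folded
path either meets no hyperplane orthogonal to α_p or takes only two adjacent heights. Therefore a
maximal height reached inside, with or without a negative sign, is also reached at an end of the
segment (`IsWalk.exists_end`, `IsWalk.exists_neg_end`).

An element of a coset uW̄ is encoded by an arc c: it makes positive exactly the roots with labels
c+1, …, c+q, and its length in W̄ is |c|. Increasing chains in the coset become integer sequences of
six explicit shapes, determined by their ends (`IsArcPath.isChainUpTo`, `IsChain.unique`). Reversing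
the labels negates arcs, and Y_{q,a,b} turns the chain from c to d into the chain from −c to −d for
the reversed order (`IsChain.ybInvolution`). Since ℓ − |c| cannot decrease along such chains, covers
in W by reflections of W̄ are the same as covers in the coset.

Thus J and Y(J) give the same w_i and the same heights outside the interior of the segment
(`IsReplacement`), so their turns correspond and F_p preserves the relation. Both F_p(Y(J)) and
Y(F_p(J)) are admissible replacements of F_p(J), and they agree because an admissible chain in the
segment is determined by its ends (`IsReplacement.eq_ybMove`). -/

/-- The index of the negative of a root. -/
def opp (P : RootPairing ι ℝ M N) (i : ι) : ι := P.reflectionPerm i i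

lemma root_opp (i : ι) : P.root (opp P i) = -P.root i := by
  simp [opp, root_reflectionPerm]

lemma coroot_opp (i : ι) : P.coroot (opp P i) = -P.coroot i := by
  simp [opp, coroot_reflectionPerm]

@[simp] lemma opp_opp (i : ι) : opp P (opp P i) = i := by
  apply P.root.injective; simp [root_opp]

lemma opp_injective : Function.Injective (opp P) := fun i j h => by
  rw [← opp_opp (P := P) i, h, opp_opp]

lemma opp_eq_iff {i j : ι} : opp P i = j ↔ i = opp P j :=
  ⟨fun h => by rw [← h, opp_opp], fun h => by rw [h, opp_opp]⟩

/-- The action of the Weyl group on the roots. -/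
def act (P : RootPairing ι ℝ M N) : P.weylGroup →* Equiv.Perm ι := P.weylGroupToPerm

lemma act_refl (a : ι) : act P (refl P a) = P.reflectionPerm a := by
  simp [act, refl, weylGroup.ofIdx]

lemma act_refl_apply (a i : ι) : act P (refl P a) i = P.reflectionPerm a i := by
  rw [act_refl]

lemma refl_induction {p : P.weylGroup → Prop} (one : p 1)
    (mul : ∀ a w, p w → p (refl P a * w)) (w : P.weylGroup) : p w := by
  have key : ∀ g (hg : g ∈ P.weylGroup), ∀ w, p w → p (⟨g, hg⟩ * w) := by
    intro g hg
    induction hg using weylGroup.induction with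
    | mem i => exact mul i
    | one => intro w hw; exact (one_mul w).symm ▸ hw
    | mul x y hx hy h1 h2 =>
      intro w hw
      have := h1 _ (h2 w hw)
      rwa [← mul_assoc] at this
  simpa using key w.1 w.2 1 one

lemma pairing_act (w : P.weylGroup) (i j : ι) :
    P.pairing (act P w i) (act P w j) = P.pairing i j := by
  induction w using refl_induction with
  | one => simp
  | mul a w ih => 
    rw [map_mul, Equiv.Perm.mul_apply, Equiv.Perm.mul_apply, act_refl, pairing_reflectionPerm,
      P.reflectionPerm_self, ih]

lemma pairingIn_act [P.IsCrystallographic] (w : P.weylGroup) (i j : ι) :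
    P.pairingIn ℤ (act P w i) (act P w j) = P.pairingIn ℤ i j := by
  apply FaithfulSMul.algebraMap_injective ℤ ℝ
  simp only [algebraMap_pairingIn, pairing_act]

lemma root_act (w : P.weylGroup) (i : ι) : P.root (act P w i) = w • P.root i :=
  (weylGroup_apply_root P w i).symm

lemma smul_smul_weyl (w : P.weylGroup) (r : ℝ) (x : M) : w • r • x = r • w • x :=
  smul_comm (w : P.Aut) r x

lemma root_reflectionPerm_eq (a i : ι) :
    P.root (P.reflectionPerm a i) = P.root i - P.pairing i a • P.root a := by
  rw [root_reflectionPerm, reflection_apply_root]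

lemma root_act_reflectionPerm (w : P.weylGroup) (a i : ι) :
    P.root (act P w (P.reflectionPerm a i)) =
      P.root (act P w i) - P.pairing i a • P.root (act P w a) := by
  rw [root_act, root_reflectionPerm_eq, smul_sub, smul_smul_weyl, ← root_act, ← root_act]

lemma act_opp (w : P.weylGroup) (i : ι) : act P w (opp P i) = opp P (act P w i) := by
  apply P.root.injective
  rw [opp, root_act_reflectionPerm, root_opp, pairing_same]
  module

lemma reflectionPerm_opp (a i : ι) : P.reflectionPerm a (opp P i) = opp P (P.reflectionPerm a i) := by
  rw [← act_refl, act_opp]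

lemma reflectionPerm_opp_left (a : ι) : P.reflectionPerm (opp P a) = P.reflectionPerm a := by
  ext i
  apply P.root.injective
  rw [root_reflectionPerm_eq, root_reflectionPerm_eq, root_opp, opp,
    pairing_reflectionPerm_self_right]
  module

lemma act_reflectionPerm (w : P.weylGroup) (a i : ι) :
    act P w (P.reflectionPerm a i) = P.reflectionPerm (act P w a) (act P w i) := by
  apply P.root.injective
  rw [root_act_reflectionPerm, root_reflectionPerm_eq, pairing_act]

/-- The product of the reflections in a list of roots. -/
def wordProd (P : RootPairing ι ℝ M N) (l : List ι) : P.weylGroup := (l.map (refl P)).prod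

@[simp] lemma wordProd_nil : wordProd P [] = 1 := rfl

@[simp] lemma wordProd_cons (a : ι) (l : List ι) :
    wordProd P (a :: l) = refl P a * wordProd P l := by simp [wordProd]

@[simp] lemma wordProd_append (l l' : List ι) :
    wordProd P (l ++ l') = wordProd P l * wordProd P l' := by simp [wordProd]

section RootSystem

variable [P.IsRootSystem]

lemma act_injective : Function.Injective (act P) := by
  intro g h hgh
  have : ∀ x : M, g • x = h • x := by
    intro x
    have hx : x ∈ Submodule.span ℝ (Set.range P.root) := by
      rw [IsRootSystem.span_root_eq_top]; trivial
    induction hx using Submodule.span_induction with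
    | mem x hx =>
      obtain ⟨i, rfl⟩ := hx
      rw [← root_act, ← root_act, hgh]
    | zero => simp
    | add x y _ _ hx hy => rw [smul_add, smul_add, hx, hy]
    | smul t x _ hx => rw [smul_smul_weyl, smul_smul_weyl, hx]
  apply Subtype.ext
  apply Equiv.weightHom_injective P
  ext x
  exact this x

lemma mul_refl_mul_inv (w : P.weylGroup) (a : ι) : w * refl P a * w⁻¹ = refl P (act P w a) := by
  apply act_injective
  ext i
  rw [map_mul, map_mul, Equiv.Perm.mul_apply, Equiv.Perm.mul_apply, act_refl, act_refl,
    act_reflectionPerm, ← Equiv.Perm.mul_apply (act P w), ← map_mul, mul_inv_cancel, map_one,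
    Equiv.Perm.one_apply]

lemma mul_refl (w : P.weylGroup) (a : ι) : w * refl P a = refl P (act P w a) * w := by
  rw [← mul_refl_mul_inv, inv_mul_cancel_right]

lemma refl_mul_self (a : ι) : refl P a * refl P a = 1 := by
  apply act_injective
  ext i
  simp [act_refl]

lemma refl_opp (a : ι) : refl P (opp P a) = refl P a := by
  apply act_injective
  rw [act_refl, act_refl, reflectionPerm_opp_left]

lemma refl_inv (a : ι) : (refl P a)⁻¹ = refl P a :=
  inv_eq_of_mul_eq_one_left (refl_mul_self a)

end RootSystem

section Pos

variable (b : P.Base)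

lemma isPos_opp {i : ι} : b.IsPos (opp P i) ↔ ¬ b.IsPos i := Base.IsPos.neg_iff_not b i

lemma height_reflectionPerm [P.IsCrystallographic] (a i : ι) (w : P.weylGroup) :
    b.height (act P w (P.reflectionPerm a i)) =
      b.height (act P w i) - P.pairingIn ℤ i a * b.height (act P w a) := by
  have := b.height_add_zsmul (i := act P w i) (j := act P w a) (z := -P.pairingIn ℤ i a)
    (k := act P w (P.reflectionPerm a i)) (by
      rw [root_act_reflectionPerm, ← algebraMap_pairingIn P ℤ, sub_eq_add_neg, neg_smul,
        algebraMap_smul])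
  rw [this]; simp; ring

/-- The inversions of `w` in a set `D` of roots. -/
def invSet (b : P.Base) (D : Set ι) (w : P.weylGroup) : Set ι :=
  {x | x ∈ D ∧ b.IsPos x ∧ ¬ b.IsPos (act P w x)}

/-- The number of inversions of `w` in `D`. -/
def invCount (b : P.Base) (D : Set ι) (w : P.weylGroup) : ℕ := (invSet b D w).ncard

/-- `Δ` behaves as a set of simple roots for the positive roots in `D`. -/
structure IsSimpleIn (b : P.Base) (D Δ : Set ι) : Prop where
  subset : Δ ⊆ D
  pos : ∀ r ∈ Δ, b.IsPos r
  stable : ∀ r ∈ Δ, ∀ x ∈ D, P.reflectionPerm r x ∈ D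
  perm : ∀ r ∈ Δ, ∀ x ∈ D, b.IsPos x → x ≠ r → b.IsPos (P.reflectionPerm r x)

variable {b} {D Δ : Set ι}

lemma isPos_simple [Finite ι] [P.IsCrystallographic] [P.IsReduced] :
    IsSimpleIn b Set.univ (b.support : Set ι) where
  subset := Set.subset_univ _
  pos _ hr := Base.isPos_of_mem_support hr
  stable _ _ _ _ := trivial
  perm _ hr _ _ hx hne := Base.IsPos.reflectionPerm hx hr hne

lemma isPos_reflectionPerm_self {r : ι} : b.IsPos (P.reflectionPerm r r) ↔ ¬ b.IsPos r :=
  isPos_opp b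

variable [Finite ι] [P.IsRootSystem]

/-- The reflection in r permutes the positive roots of D other than r, so it transports the
inversions of w, and r itself is the only new one. The set D is kept general because the count is
needed both for the whole root system and for the rank two subsystem. -/
lemma IsSimpleIn.invSet_mul_refl (h : IsSimpleIn b D Δ) {r : ι} (hr : r ∈ Δ) (w : P.weylGroup)
    (hw : b.IsPos (act P w r)) :
    invSet b D (w * refl P r) = insert r (P.reflectionPerm r '' invSet b D w) := by
  ext x
  have hact : act P (w * refl P r) x = act P w (P.reflectionPerm r x) := by
    rw [map_mul, Equiv.Perm.mul_apply, act_refl]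
  simp only [invSet, Set.mem_insert_iff, Set.mem_image, Set.mem_ofPred_eq, hact]
  constructor
  · rintro ⟨hD, hp, hn⟩
    by_cases hx : x = r
    · exact Or.inl hx
    · exact Or.inr ⟨P.reflectionPerm r x, ⟨h.stable r hr x hD, h.perm r hr x hD hp hx, hn⟩,
        by simp⟩
  · rintro (rfl | ⟨y, ⟨hD, hp, hn⟩, rfl⟩)
    · refine ⟨h.subset hr, h.pos _ hr, ?_⟩
      have := act_opp w x
      rw [opp] at this
      rwa [this, isPos_opp, not_not]
    · have hy : y ≠ r := by rintro rfl; exact hn hw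
      exact ⟨h.stable r hr y hD, h.perm r hr y hD hp hy, by simpa using hn⟩

lemma IsSimpleIn.invCount_mul_refl (h : IsSimpleIn b D Δ) {r : ι} (hr : r ∈ Δ) (w : P.weylGroup)
    (hw : b.IsPos (act P w r)) : invCount b D (w * refl P r) = invCount b D w + 1 := by
  rw [invCount, h.invSet_mul_refl hr w hw, Set.ncard_insert_of_notMem _ (Set.toFinite _),
    Set.ncard_image_of_injective _ (P.reflectionPerm r).injective, invCount]
  rintro ⟨y, ⟨-, hp, -⟩, hy⟩
  have : y = opp P r := by rw [opp, ← P.reflectionPerm_self r y, hy]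
  rw [this, isPos_opp] at hp
  exact hp (h.pos r hr)

lemma IsSimpleIn.invCount_mul_refl' (h : IsSimpleIn b D Δ) {r : ι} (hr : r ∈ Δ) (w : P.weylGroup)
    (hw : ¬ b.IsPos (act P w r)) : invCount b D w = invCount b D (w * refl P r) + 1 := by
  rw [← h.invCount_mul_refl hr, mul_assoc, refl_mul_self, mul_one]
  have := act_opp w r
  rw [opp] at this
  rwa [map_mul, Equiv.Perm.mul_apply, act_refl, this, isPos_opp]

lemma invCount_one : invCount b D 1 = 0 := by
  have : invSet b D 1 = ∅ := by
    ext x; simp [invSet]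
  rw [invCount, this, Set.ncard_empty]

lemma IsSimpleIn.invCount_wordProd_le (h : IsSimpleIn b D Δ) (l : List ι) (hl : ∀ r ∈ l, r ∈ Δ) :
    invCount b D (wordProd P l) ≤ l.length := by
  induction l using List.reverseRecOn with
  | nil => simp [invCount_one]
  | append_singleton l r ih =>
    have h1 := ih fun x hx => hl x (by simp [hx])
    have hr := hl r (by simp)
    simp only [wordProd_append, wordProd_cons, wordProd_nil, mul_one, List.length_append,
      List.length_singleton]
    by_cases hp : b.IsPos (act P (wordProd P l) r)
    · rw [h.invCount_mul_refl hr _ hp]; omega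
    · have := h.invCount_mul_refl' hr _ hp; omega

lemma IsSimpleIn.act_wordProd_mem (h : IsSimpleIn b D Δ) (l : List ι) (hl : ∀ r ∈ l, r ∈ Δ)
    {x : ι} (hx : x ∈ D) : act P (wordProd P l) x ∈ D := by
  induction l with
  | nil => simpa
  | cons a l ih =>
    rw [wordProd_cons, map_mul, Equiv.Perm.mul_apply, act_refl]
    exact h.stable a (hl a (by simp)) _ (ih fun r hr => hl r (by simp [hr]))

/-- The exchange condition. At the letter a where the image of r turns negative, that image must
have been a, the only positive root of D made negative by s_a. Moving s_r to the left through the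
tail then turns it into s_a, which cancels the letter. -/
lemma IsSimpleIn.exchange (h : IsSimpleIn b D Δ) {r : ι} (hr : r ∈ Δ) (l : List ι)
    (hl : ∀ x ∈ l, x ∈ Δ) (hn : ¬ b.IsPos (act P (wordProd P l) r)) :
    ∃ l' : List ι, (∀ x ∈ l', x ∈ Δ) ∧ l'.length + 1 = l.length ∧
      wordProd P l' = wordProd P l * refl P r := by
  induction l with
  | nil => simp [h.pos r hr] at hn
  | cons a t ih =>
    have ha := hl a (by simp)
    have ht : ∀ x ∈ t, x ∈ Δ := fun x hx => hl x (by simp [hx])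
    by_cases hp : b.IsPos (act P (wordProd P t) r)
    · refine ⟨t, ht, by simp, ?_⟩
      have : act P (wordProd P t) r = a := by
        by_contra hne
        rw [wordProd_cons, map_mul, Equiv.Perm.mul_apply, act_refl] at hn
        exact hn (h.perm a ha _ (h.act_wordProd_mem t ht (h.subset hr)) hp hne)
      rw [wordProd_cons, mul_assoc, mul_refl, this, ← mul_assoc, refl_mul_self, one_mul]
    · obtain ⟨t', h1, h2, h3⟩ := ih ht hp
      refine ⟨a :: t', ?_, by simp [h2], by simp [h3, mul_assoc]⟩
      intro x hx
      rcases List.mem_cons.mp hx with rfl | hx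
      · exact ha
      · exact h1 x hx

lemma IsSimpleIn.exists_shorter (h : IsSimpleIn b D Δ) (l : List ι) (hl : ∀ x ∈ l, x ∈ Δ)
    (hlt : invCount b D (wordProd P l) < l.length) :
    ∃ l' : List ι, (∀ x ∈ l', x ∈ Δ) ∧ l'.length < l.length ∧ wordProd P l' = wordProd P l := by
  induction l using List.reverseRecOn with
  | nil => simp at hlt
  | append_singleton l r ih =>
    have hr := hl r (by simp)
    have hl' : ∀ x ∈ l, x ∈ Δ := fun x hx => hl x (by simp [hx])
    by_cases hc : invCount b D (wordProd P l) < l.length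
    · obtain ⟨t, h1, h2, h3⟩ := ih hl' hc
      refine ⟨t ++ [r], ?_, by simpa using h2, by simp [h3]⟩
      intro x hx
      rcases List.mem_append.mp hx with hx | hx
      · exact h1 x hx
      · rw [List.mem_singleton.mp hx]; exact hr
    · have hn : ¬ b.IsPos (act P (wordProd P l) r) := by
        intro hp
        have := h.invCount_mul_refl hr _ hp
        simp only [wordProd_append, wordProd_cons, wordProd_nil, mul_one, List.length_append,
          List.length_singleton] at hlt
        omega
      obtain ⟨t, h1, h2, h3⟩ := h.exchange hr l hl' hn
      exact ⟨t, h1, by simp; omega, by simp [h3]⟩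

lemma IsSimpleIn.exists_reduced (h : IsSimpleIn b D Δ) (l : List ι) (hl : ∀ x ∈ l, x ∈ Δ) :
    ∃ l' : List ι, (∀ x ∈ l', x ∈ Δ) ∧ wordProd P l' = wordProd P l ∧
      l'.length = invCount b D (wordProd P l) := by
  induction hn : l.length using Nat.strong_induction_on generalizing l with
  | _ n ih =>
    rcases (h.invCount_wordProd_le l hl).lt_or_eq with hlt | heq
    · obtain ⟨t, h1, h2, h3⟩ := h.exists_shorter l hl hlt
      obtain ⟨t', h4, h5, h6⟩ := ih t.length (hn ▸ h2) t h1 rfl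
      exact ⟨t', h4, h5.trans h3, by rw [h6, h3]⟩
    · exact ⟨l, hl, rfl, heq.symm⟩

lemma exists_wordProd_of_mem_closure {w : P.weylGroup}
    (hw : w ∈ Subgroup.closure (refl P '' Δ)) :
    ∃ l : List ι, (∀ x ∈ l, x ∈ Δ) ∧ wordProd P l = w := by
  induction hw using Subgroup.closure_induction with
  | mem x hx => 
    obtain ⟨r, hr, rfl⟩ := hx
    exact ⟨[r], by simpa, by simp⟩
  | one => exact ⟨[], by simp, rfl⟩
  | mul x y _ _ hx hy =>
    obtain ⟨l, h1, rfl⟩ := hx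
    obtain ⟨l', h1', rfl⟩ := hy
    exact ⟨l ++ l', fun x hx => (List.mem_append.mp hx).elim (h1 x) (h1' x), by simp⟩
  | inv x hx' hx =>
    clear hx'
    obtain ⟨l, h1, rfl⟩ := hx
    refine ⟨l.reverse, fun x hx => h1 x (by simpa using hx), ?_⟩
    clear h1
    induction l with
    | nil => simp
    | cons a t ih => simp [ih, refl_inv]

/-- The word length equals the number of inversions. -/
lemma IsSimpleIn.wordLength_eq (h : IsSimpleIn b D Δ) {w : P.weylGroup}
    (hw : w ∈ Subgroup.closure (refl P '' Δ)) :
    wordLength (refl P '' Δ) w = invCount b D w := by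
  obtain ⟨l, hl, rfl⟩ := exists_wordProd_of_mem_closure hw
  obtain ⟨l', h1, h2, h3⟩ := h.exists_reduced l hl
  apply le_antisymm
  · refine Nat.sInf_le ⟨l'.map (refl P), by simp [h3], ?_, h2⟩
    intro x hx
    obtain ⟨r, hr, rfl⟩ := List.mem_map.mp hx
    exact ⟨r, h1 r hr, rfl⟩
  · refine le_csInf ⟨_, l.map (refl P), rfl, ?_, rfl⟩ ?_
    · intro x hx
      obtain ⟨r, hr, rfl⟩ := List.mem_map.mp hx
      exact ⟨r, hl r hr, rfl⟩
    · rintro k ⟨L, rfl, hL, hLp⟩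
      obtain ⟨L', h4, rfl⟩ : ∃ L' : List ι, (∀ r ∈ L', r ∈ Δ) ∧ L'.map (refl P) = L := by
        clear hLp
        induction L with
        | nil => exact ⟨[], by simp, rfl⟩
        | cons x t ih =>
          obtain ⟨r, hr, rfl⟩ := hL x (by simp)
          obtain ⟨t', h5, rfl⟩ := ih fun y hy => hL y (by simp [hy])
          exact ⟨r :: t', by simpa [hr] using h5, rfl⟩
      have h5 := h.invCount_wordProd_le L' h4
      rw [wordProd, hLp] at h5
      simpa using h5

variable [P.IsCrystallographic] [P.IsReduced]

/-- Put c = ⟨γ,β^∨⟩. The height of s_β γ is ht γ − c ht β; as it is not positive, c > 0. Then ht(w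
s_β γ) = ht(wγ) − c ht(wβ) is negative too. -/
lemma reflectionPerm_isPos_cases {β γ : ι} (w : P.weylGroup) (hβ : b.IsPos β)
    (hw : b.IsPos (act P w β)) (hγ : b.IsPos γ) (hn : ¬ b.IsPos (P.reflectionPerm β γ))
    (hwγ : ¬ b.IsPos (act P w γ)) : ¬ b.IsPos (act P w (P.reflectionPerm β γ)) := by
  have h1 := height_reflectionPerm b β γ 1
  have h2 := height_reflectionPerm b β γ w
  simp only [map_one, Equiv.Perm.one_apply] at h1
  rw [Base.isPos_iff] at *
  have : 0 < P.pairingIn ℤ γ β := by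
    by_contra h0
    nlinarith
  nlinarith

/-- The map f sends γ to s_β γ if that is positive and to γ otherwise. It embeds the inversions of w
into those of w s_β and misses β, which is an inversion of w s_β. -/
lemma invCount_lt_mul_refl {β : ι} (hβ : b.IsPos β) (w : P.weylGroup)
    (hw : b.IsPos (act P w β)) :
    invCount b Set.univ w < invCount b Set.univ (w * refl P β) := by
  classical
  have hact : ∀ x, act P (w * refl P β) x = act P w (P.reflectionPerm β x) := fun x => by
    rw [map_mul, Equiv.Perm.mul_apply, act_refl]
  let f : ι → ι := fun γ => if b.IsPos (P.reflectionPerm β γ) then P.reflectionPerm β γ else γ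
  have hβw : β ∈ invSet b Set.univ (w * refl P β) := by
    refine ⟨trivial, hβ, ?_⟩
    have := act_opp w β
    rw [opp] at this
    rwa [hact, this, isPos_opp, not_not]
  have hsub : f '' invSet b Set.univ w ⊆ invSet b Set.univ (w * refl P β) \ {β} := by
    rintro _ ⟨γ, ⟨-, hp, hn⟩, rfl⟩
    have hne : γ ≠ β := by rintro rfl; exact hn hw
    simp only [f]
    split_ifs with h
    · refine ⟨⟨trivial, h, by rwa [hact, P.reflectionPerm_self]⟩, ?_⟩
      intro h1
      have h1 : P.reflectionPerm β γ = β := h1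
      have : γ = opp P β := by rw [opp, ← P.reflectionPerm_self β γ, h1]
      rw [this, isPos_opp] at hp
      exact hp hβ
    · exact ⟨⟨trivial, hp, by rw [hact]; exact reflectionPerm_isPos_cases w hβ hw hp h hn⟩, hne⟩
  have hinj : Set.InjOn f (invSet b Set.univ w) := by
    rintro x ⟨-, hx, -⟩ y ⟨-, hy, -⟩ hxy
    simp only [f] at hxy
    split_ifs at hxy with h1 h2 h2
    · exact (P.reflectionPerm β).injective hxy
    · exact absurd (by rwa [← hxy, P.reflectionPerm_self]) h2
    · exact absurd (by rwa [hxy, P.reflectionPerm_self]) h1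
    · exact hxy
  rw [invCount, invCount, ← hinj.ncard_image]
  refine Set.ncard_lt_ncard ⟨hsub.trans Set.sdiff_subset, fun h => ?_⟩ (Set.toFinite _)
  exact (hsub (h hβw)).2 rfl

lemma closure_simple : Subgroup.closure (refl P '' (b.support : Set ι)) = ⊤ := by
  rw [eq_top_iff]
  rintro w -
  have key : ∀ a, refl P a ∈ Subgroup.closure (refl P '' (b.support : Set ι)) := by
    intro a
    induction a using b.induction_reflect with
    | h₀ i h => rw [← opp, refl_opp]; exact h
    | h₁ i h => exact Subgroup.subset_closure ⟨i, h, rfl⟩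
    | h₂ i j h hj =>
      have hj' := Subgroup.subset_closure (G := P.weylGroup) (Set.mem_image_of_mem (refl P) hj)
      rw [← act_refl_apply, ← mul_refl_mul_inv]
      exact mul_mem (mul_mem hj' h) (inv_mem hj')
  induction w using refl_induction with
  | one => exact one_mem _
  | mul a w h => exact mul_mem (key a) h

lemma length_eq_invCount (w : P.weylGroup) : length b w = invCount b Set.univ w :=
  isPos_simple.wordLength_eq (by rw [closure_simple]; trivial)

lemma length_lt_mul_refl {β : ι} (hβ : b.IsPos β) {w : P.weylGroup} (hw : b.IsPos (act P w β)) :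
    length b w < length b (w * refl P β) := by
  rw [length_eq_invCount, length_eq_invCount]
  exact invCount_lt_mul_refl hβ w hw

lemma length_mul_refl_lt {β : ι} (hβ : b.IsPos β) {w : P.weylGroup} (hw : ¬ b.IsPos (act P w β)) :
    length b (w * refl P β) < length b w := by
  have := length_lt_mul_refl hβ (w := w * refl P β) (by
    have := act_opp w β
    rw [opp] at this
    rwa [map_mul, Equiv.Perm.mul_apply, act_refl, this, isPos_opp])
  rwa [mul_assoc, refl_mul_self, mul_one] at this

lemma length_lt_mul_refl_iff {β : ι} (hβ : b.IsPos β) {w : P.weylGroup} :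
    length b w < length b (w * refl P β) ↔ b.IsPos (act P w β) :=
  ⟨fun h => by_contra fun hn => lt_asymm h (length_mul_refl_lt hβ hn), length_lt_mul_refl hβ⟩

lemma length_inv (w : P.weylGroup) : length b w⁻¹ = length b w := by
  rw [length_eq_invCount, length_eq_invCount, invCount, invCount]
  have : invSet b Set.univ w⁻¹ = (fun x => opp P (act P w x)) '' invSet b Set.univ w := by
    ext x
    simp only [invSet, Set.mem_image, Set.mem_ofPred_eq, Set.mem_univ, true_and]
    have h1 : ∀ y, act P w (act P w⁻¹ y) = y := fun y => by
      rw [← Equiv.Perm.mul_apply, ← map_mul, mul_inv_cancel, map_one, Equiv.Perm.one_apply]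
    have h2 : ∀ y, act P w⁻¹ (act P w y) = y := fun y => by
      rw [← Equiv.Perm.mul_apply, ← map_mul, inv_mul_cancel, map_one, Equiv.Perm.one_apply]
    constructor
    · rintro ⟨hp, hn⟩
      refine ⟨opp P (act P w⁻¹ x), ⟨by rwa [isPos_opp], ?_⟩, ?_⟩
      · rwa [act_opp, h1, isPos_opp, not_not]
      · rw [act_opp, h1, opp_opp]
    · rintro ⟨y, ⟨hp, hn⟩, rfl⟩
      refine ⟨by rwa [isPos_opp], ?_⟩
      rwa [act_opp, h2, isPos_opp, not_not]
  rw [this, Set.ncard_image_of_injective]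
  exact opp_injective.comp (act P w).injective

lemma length_refl_mul {p : ι} (hp : p ∈ b.support) {w : P.weylGroup}
    (h : b.IsPos (act P w⁻¹ p)) : length b (refl P p * w) = length b w + 1 := by
  rw [← length_inv, mul_inv_rev, refl_inv, length_eq_invCount, isPos_simple.invCount_mul_refl hp _ h,
    ← length_eq_invCount, length_inv]

lemma length_refl_mul' {p : ι} (hp : p ∈ b.support) {w : P.weylGroup}
    (h : ¬ b.IsPos (act P w⁻¹ p)) : length b w = length b (refl P p * w) + 1 := by
  rw [← length_inv w, ← length_inv (_ * _), mul_inv_rev, refl_inv, length_eq_invCount,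
    isPos_simple.invCount_mul_refl' hp _ h, ← length_eq_invCount]

lemma act_inv_mul_refl (w : P.weylGroup) (β p : ι) :
    act P (w * refl P β)⁻¹ p = P.reflectionPerm β (act P w⁻¹ p) := by
  rw [mul_inv_rev, refl_inv, map_mul, Equiv.Perm.mul_apply, act_refl]

/-- The lifting property of Bruhat covers. -/
lemma eq_of_cover {p β : ι} (hp : p ∈ b.support) (hβ : b.IsPos β) {w : P.weylGroup}
    (hcov : length b (w * refl P β) = length b w + 1) (h : b.IsPos (act P w⁻¹ p))
    (hn : ¬ b.IsPos (P.reflectionPerm β (act P w⁻¹ p))) : act P w⁻¹ p = β := by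
  have h1 := length_refl_mul hp h
  have h2 := length_refl_mul' hp (w := w * refl P β) (by rwa [act_inv_mul_refl])
  have h3 : b.IsPos (act P w β) := (length_lt_mul_refl_iff hβ).mp (by omega)
  -- Since ℓ(s_p w s_β) = ℓ(w) < ℓ(s_p w), the root s_p w β is negative. As wβ is positive and s_p
  -- makes only α_p negative, wβ = α_p.
  have h4 : ¬ b.IsPos (act P (refl P p * w) β) := by
    rw [← length_lt_mul_refl_iff hβ, mul_assoc]; omega
  rw [map_mul, Equiv.Perm.mul_apply, act_refl] at h4
  have h5 : act P w β = p := by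
    by_contra hne
    exact h4 (h3.reflectionPerm hp hne)
  rw [← h5, ← Equiv.Perm.mul_apply, ← map_mul, inv_mul_cancel, map_one, Equiv.Perm.one_apply]

end Pos

end AlcoveModel
end

/-! ### λ-chains as alcove paths: positions of alcoves between parallel hyperplanes. -/

noncomputable section

namespace AlcoveModel

open RootPairing

variable {ι M N : Type*} [AddCommGroup M] [Module ℝ M] [AddCommGroup N] [Module ℝ N]
  {P : RootPairing ι ℝ M N} {n : ℕ}

lemma coroot'_reflectionPerm_eq (a i : ι) (x : M) :
    P.coroot' (P.reflectionPerm a i) x = P.coroot' i x - P.pairing a i * P.coroot' a x := by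
  rw [← P.coroot'_reflection, reflection_apply, map_sub, map_smul, root_coroot'_eq_pairing,
    smul_eq_mul]
  simp [mul_comm]

lemma coroot'_opp (i : ι) (x : M) : P.coroot' (opp P i) x = -P.coroot' i x := by
  rw [opp, coroot'_reflectionPerm_eq, pairing_same]; ring

lemma pairingIn_opp_right [P.IsCrystallographic] (i j : ι) :
    P.pairingIn ℤ i (opp P j) = -P.pairingIn ℤ i j := by
  rw [opp, pairingIn_reflectionPerm_self_right]

lemma pairingIn_opp_left [P.IsCrystallographic] (i j : ι) :
    P.pairingIn ℤ (opp P i) j = -P.pairingIn ℤ i j := by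
  rw [opp, pairingIn_reflectionPerm_self_left]

lemma pairingIn_self_reflectionPerm [P.IsCrystallographic] (i j : ι) :
    P.pairingIn ℤ i (P.reflectionPerm i j) = -P.pairingIn ℤ i j := by
  rw [← pairingIn_act (refl P i), act_refl, P.reflectionPerm_self]
  exact pairingIn_opp_left i j

lemma pairing_eq_intCast [P.IsCrystallographic] (i j : ι) :
    P.pairing i j = (P.pairingIn ℤ i j : ℝ) := by
  rw [← algebraMap_pairingIn P ℤ]; rfl

lemma pairingIn_flip [P.IsCrystallographic] (i j : ι) :
    P.flip.pairingIn ℤ i j = P.pairingIn ℤ j i := by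
  apply FaithfulSMul.algebraMap_injective ℤ ℝ
  simp only [algebraMap_pairingIn, pairing_flip]

open scoped Classical in
/-- The number of occurrences of the root `α` among the first `i` roots of `Γ`. -/
def occ (Γ : Fin n → ι) (i : ℕ) (α : ι) : ℕ :=
  (Finset.univ.filter fun j : Fin n => (j : ℕ) < i ∧ Γ j = α).card

open scoped Classical in
/-- The position of the `i`th alcove of `Γ` relative to the hyperplanes orthogonal to `α`: the
alcove satisfies `N - 1 < -⟨x, α^∨⟩ < N`. -/
def strip (b : P.Base) (Γ : Fin n → ι) (i : ℕ) (α : ι) : ℤ :=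
  if b.IsPos α then occ Γ i α else 1 - occ Γ i (opp P α)

open scoped Classical in
/-- The position of the fundamental alcove. -/
def strip₀ (b : P.Base) (α : ι) : ℤ := if b.IsPos α then 0 else 1

lemma occ_zero (Γ : Fin n → ι) (α : ι) : occ Γ 0 α = 0 := by simp [occ]

open scoped Classical in
lemma occ_succ (Γ : Fin n → ι) (i : Fin n) (α : ι) :
    occ Γ (i + 1) α = occ Γ i α + if Γ i = α then 1 else 0 := by
  have : (Finset.univ.filter fun j : Fin n => (j : ℕ) < i + 1 ∧ Γ j = α) =
      (Finset.univ.filter fun j : Fin n => (j : ℕ) < i ∧ Γ j = α) ∪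
      (if Γ i = α then {i} else ∅) := by
    ext j
    by_cases h : Γ i = α
    · by_cases hj : j = i
      · subst hj; simp [h]
      · have : (j : ℕ) ≠ i := fun h => hj (Fin.ext h)
        simp only [Finset.mem_filter, Finset.mem_univ, true_and, h, if_true, Finset.mem_union,
          Finset.mem_singleton, hj, or_false]
        constructor <;> rintro ⟨h1, h2⟩ <;> exact ⟨by omega, h2⟩
    · by_cases hj : j = i
      · subst hj; simp [h]
      · have : (j : ℕ) ≠ i := fun h => hj (Fin.ext h)
        simp only [Finset.mem_filter, Finset.mem_univ, true_and, h, if_false, Finset.mem_union,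
          Finset.notMem_empty, or_false]
        constructor <;> rintro ⟨h1, h2⟩ <;> exact ⟨by omega, h2⟩
  rw [occ, this, Finset.card_union_of_disjoint, occ]
  · congr 1; split_ifs <;> simp
  · rw [Finset.disjoint_left]
    intro j h1 h2
    split_ifs at h2
    · rw [Finset.mem_singleton] at h2; subst h2; simp at h1
    · simp at h2

lemma initLevel_eq_occ (Γ : Fin n → ι) (i : Fin n) : initLevel Γ i = occ Γ i (Γ i) := by
  classical
  rw [initLevel, occ]
  congr!

variable {b : P.Base} {Γ : Fin n → ι}

lemma strip_zero (α : ι) : strip b Γ 0 α = strip₀ b α := by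
  simp [strip, strip₀, occ_zero]

lemma strip_opp (i : ℕ) (α : ι) : strip b Γ i (opp P α) = 1 - strip b Γ i α := by
  by_cases h : b.IsPos α <;> simp [strip, isPos_opp, h]

lemma strip₀_opp (α : ι) : strip₀ b (opp P α) = 1 - strip₀ b α := by
  by_cases h : b.IsPos α <;> simp [strip₀, isPos_opp, h]

lemma strip_succ_self {i : Fin n} (h : b.IsPos (Γ i)) :
    strip b Γ (i + 1) (Γ i) = strip b Γ i (Γ i) + 1 := by
  simp [strip, h, occ_succ]

lemma strip_succ_opp {i : Fin n} (h : b.IsPos (Γ i)) :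
    strip b Γ (i + 1) (opp P (Γ i)) = strip b Γ i (opp P (Γ i)) - 1 := by
  rw [strip_opp, strip_opp, strip_succ_self h]; ring

lemma strip_succ_of_ne {i : Fin n} {α : ι} (h1 : α ≠ Γ i) (h2 : α ≠ opp P (Γ i)) :
    strip b Γ (i + 1) α = strip b Γ i α := by
  have h3 : ¬ Γ i = opp P α := fun h => h2 (by rw [h, opp_opp])
  simp [strip, occ_succ, h1.symm, h3]

/-- The properties of a `λ`-chain that govern the folding of its alcove path. -/
structure IsAlcovePath (b : P.Base) [P.IsCrystallographic] (lam : M) (Γ : Fin n → ι) : Prop where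
  pos : ∀ i, b.IsPos (Γ i)
  step : ∀ (i : Fin n) (α : ι), strip b Γ (i + 1) (P.reflectionPerm (Γ i) α) +
    strip b Γ i (Γ i) * P.pairingIn ℤ (Γ i) α = strip b Γ i α
  final : ∀ α, b.IsPos α → P.coroot' α lam = (strip b Γ n α : ℝ)

section Flip

variable [Finite ι] [P.IsCrystallographic] [P.IsReduced]

lemma flip_reflectionPerm (i j : ι) : P.flip.reflectionPerm i j = P.reflectionPerm i j := rfl

/-- A simple reflection changes the sign of ±α_j only, for roots and for coroots alike, so the two
notions agree along orbits. This is needed because θ is maximal for the height of coroots, while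
positivity is defined by the height of roots. -/
lemma flip_isPos (i : ι) : b.flip.IsPos i ↔ b.IsPos i := by
  induction i using b.induction_reflect with
  | h₀ i h => 
    change b.flip.IsPos (opp P.flip i) ↔ b.IsPos (opp P i)
    rw [isPos_opp, isPos_opp]; exact not_congr h
  | h₁ i h =>
    exact iff_of_true (Base.isPos_of_mem_support (b := b.flip) h)
      (Base.isPos_of_mem_support h)
  | h₂ i j h hj => 
    have hj' : j ∈ b.flip.support := hj
    by_cases h1 : i = j
    · subst h1
      change b.flip.IsPos (opp P.flip i) ↔ b.IsPos (opp P i)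
      rw [isPos_opp, isPos_opp]; exact not_congr h
    by_cases hp : b.IsPos i
    · exact iff_of_true ((h.mpr hp).reflectionPerm hj' h1) (hp.reflectionPerm hj h1)
    · by_cases h2 : i = opp P j
      · subst h2
        rw [opp, P.reflectionPerm_self]
        exact iff_of_true (Base.isPos_of_mem_support (b := b.flip) hj) 
          (Base.isPos_of_mem_support hj)
      · have h3 : b.IsPos (opp P i) := by rwa [isPos_opp]
        have h4 : b.flip.IsPos (opp P.flip i) := by rw [isPos_opp]; exact fun h' => hp (h.mp h')
        have h5 : opp P i ≠ j := fun h => h2 (by rw [← h, opp_opp])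
        have h6 := h3.reflectionPerm hj h5
        have h7 := h4.reflectionPerm hj' h5
        rw [reflectionPerm_opp, isPos_opp] at h6 h7
        exact iff_of_false h7 h6

/-- The real number `⟨θ, η^∨⟩` is `0` or `1` for positive `η ≠ θ`. -/
lemma IsHighestCoroot.pairing_cases {θ : ι} (hθ : IsHighestCoroot b θ) {η : ι} (hη : b.IsPos η)
    (hne : η ≠ θ) : P.pairingIn ℤ θ η = 0 ∧ P.reflectionPerm θ η = η ∨
      P.pairingIn ℤ θ η = 1 ∧ ¬ b.IsPos (P.reflectionPerm θ η) := by
  have hη' : 0 < b.flip.height η := (flip_isPos η).mpr hη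
  have hle := hθ η
  have hfl := pairingIn_flip (P := P) η θ
  have hs := height_reflectionPerm b.flip θ η 1
  simp only [map_one, Equiv.Perm.one_apply, hfl, flip_reflectionPerm] at hs
  rcases lt_trichotomy (P.pairingIn ℤ θ η) 0 with h | h | h
  -- A negative pairing would make η^∨ + θ^∨ a coroot higher than θ^∨.
  · obtain ⟨k, hk⟩ := P.flip.root_add_root_mem_of_pairingIn_neg (i := η) (j := θ) (by rwa [hfl])
      (by
        intro h1
        have : η = opp P θ := P.flip.root.injective (by rw [h1]; exact (coroot_opp θ).symm)
        have h2 : b.flip.IsPos (opp P.flip θ) := by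
          rw [flip_isPos]; exact this ▸ hη
        rw [isPos_opp, Base.isPos_iff] at h2
        omega)
    have h1 := b.flip.height_add hk
    have h2 := hθ k
    omega
  · refine Or.inl ⟨h, ?_⟩
    apply P.root.injective
    have h1 : P.pairing η θ = 0 := by
      rw [← pairing_eq_zero_iff', pairing_eq_intCast, h]; simp
    rw [root_reflectionPerm_eq, h1]; simp
  · obtain ⟨k, hk⟩ := P.flip.root_sub_root_mem_of_pairingIn_pos (i := η) (j := θ) (by rwa [hfl]) hne
    have h1 := b.flip.height_sub hk
    have h2 := b.flip.height_ne_zero k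
    -- With c = ⟨θ,η^∨⟩, the negative of the coroot of s_θ η has height c·ht θ^∨ − ht η^∨, which is
    -- at most ht θ^∨. So c ≥ 2 would force ht η^∨ ≥ ht θ^∨, which is excluded since η^∨ − θ^∨ is a
    -- coroot and has nonzero height.
    have h3 := hθ (opp P (P.reflectionPerm θ η))
    have h4 := b.flip.height_reflectionPerm_self (P.reflectionPerm θ η)
    change b.flip.height (opp P (P.reflectionPerm θ η)) = _ at h4
    have h5 : P.pairingIn ℤ θ η < 2 := by
      by_contra h6
      have h8 : 0 ≤ (P.pairingIn ℤ θ η - 2) * b.flip.height θ :=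
        mul_nonneg (by omega) (by omega)
      have h9 : b.flip.height η < b.flip.height θ := by omega
      linarith
    have h7 : P.pairingIn ℤ θ η = 1 := by omega
    refine Or.inr ⟨h7, ?_⟩
    rw [← flip_isPos, Base.isPos_iff, hs, h7]
    omega

lemma IsHighestCoroot.isPos {θ : ι} (hθ : IsHighestCoroot b θ) : b.IsPos θ := by
  by_contra h
  have h1 : b.flip.IsPos (opp P θ) := by rwa [flip_isPos, isPos_opp]
  have h2 := hθ (opp P θ)
  rw [← flip_isPos] at h
  rw [Base.isPos_iff] at h h1
  omega

/-- The effect of a generator of the affine Weyl group on the position of the fundamental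
alcove. -/
lemma strip₀_step {θ : ι} (hθ : IsHighestCoroot b θ) {s : Option b.support}
    {a : ι} {κ : ℤ} (has : a = affSimpleRoot b θ s) (hκs : κ = if s = none then 1 else 0) (η : ι) :
    strip₀ b a = κ ∧
    (η = a → strip₀ b (P.reflectionPerm a η) + κ * P.pairingIn ℤ a η = strip₀ b η + 1) ∧
    (η = opp P a → strip₀ b (P.reflectionPerm a η) + κ * P.pairingIn ℤ a η = strip₀ b η - 1) ∧
    (η ≠ a → η ≠ opp P a →
      strip₀ b (P.reflectionPerm a η) + κ * P.pairingIn ℤ a η = strip₀ b η) := by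
  have hself : P.reflectionPerm a a = opp P a := rfl
  have hopp : P.reflectionPerm a (opp P a) = a := P.reflectionPerm_self a a
  have ha : strip₀ b a = κ := by
    rcases s with _ | i
    · have : a = opp P θ := has
      rw [this, strip₀_opp]; simp [strip₀, hθ.isPos, hκs]
    · have : b.IsPos a := by rw [has]; exact Base.isPos_of_mem_support i.2
      simp [strip₀, this, hκs]
  refine ⟨ha, ?_, ?_, ?_⟩
  · rintro h
    rw [h, hself, strip₀_opp, ha, pairingIn_same]; ring
  · rintro h
    rw [h, hopp, strip₀_opp, ha, pairingIn_opp_right, pairingIn_same]; ring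
  · intro h1 h2
    rcases s with _ | i
    · have hκ : κ = 1 := hκs
      have haθ : a = opp P θ := has
      rw [haθ, opp_opp] at h2
      rw [haθ] at h1
      have key : ∀ η, b.IsPos η → η ≠ θ → strip₀ b (P.reflectionPerm θ η) - P.pairingIn ℤ θ η =
          strip₀ b η := by
        intro η hη hne
        rcases hθ.pairing_cases hη hne with ⟨h3, h4⟩ | ⟨h3, h4⟩
        · rw [h3, h4]; ring
        · rw [h3]; simp [strip₀, h4, hη]
      rw [haθ, hκ, reflectionPerm_opp_left, pairingIn_opp_left]
      by_cases hη : b.IsPos η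
      · have := key η hη h2; linarith
      · have := key (opp P η) (by rwa [isPos_opp]) (fun h => h1 (by rw [← h, opp_opp]))
        rw [reflectionPerm_opp, strip₀_opp, strip₀_opp, pairingIn_opp_right] at this
        linarith
    · have hκ : κ = 0 := by simp [hκs]
      have hi : a ∈ b.support := by rw [has]; exact i.2
      rw [hκ, zero_mul, add_zero]
      have key : ∀ η, b.IsPos η → η ≠ a → strip₀ b (P.reflectionPerm a η) = strip₀ b η := by
        intro η hη hne
        simp [strip₀, hη, hη.reflectionPerm hi hne]
      by_cases hη : b.IsPos η
      · exact key η hη h1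
      · have := key (opp P η) (by rwa [isPos_opp]) (fun h => h2 (by rw [← h, opp_opp]))
        rw [reflectionPerm_opp, strip₀_opp, strip₀_opp] at this
        linarith

end Flip

section Chain

variable [Finite ι] [P.IsRootSystem] [P.IsCrystallographic] [P.IsReduced]

lemma coroot'_act_refl_mul (w : P.weylGroup) (a α : ι) (x : M) :
    P.coroot' (act P w⁻¹ α) (P.reflection a x) = P.coroot' (act P (w * refl P a)⁻¹ α) x := by
  rw [act_inv_mul_refl, ← P.coroot'_reflection]

/-- One step of an alcove path, in coordinates: `w` and `τ` are the linear part and the translation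
part of the element of the affine Weyl group that corresponds to the `j`th alcove. -/
lemma strip_step {θ : ι} (hθ : IsHighestCoroot b θ) (s : Option b.support) (w : P.weylGroup)
    (τ : M) (j : Fin n) (hΓ : Γ j = act P w (affSimpleRoot b θ s)) (hpos : b.IsPos (Γ j))
    (hN : ∀ α, (strip b Γ j α : ℝ) = strip₀ b (act P w⁻¹ α) - P.coroot' α τ) :
    let κ : ℤ := if s = none then 1 else 0
    (∀ α, (strip b Γ (j + 1) α : ℝ) =
      strip₀ b (act P (w * refl P (affSimpleRoot b θ s))⁻¹ α) -
        P.coroot' α (τ - (κ : ℝ) • P.root (Γ j))) ∧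
    ∀ α, strip b Γ (j + 1) (P.reflectionPerm (Γ j) α) +
      strip b Γ j (Γ j) * P.pairingIn ℤ (Γ j) α = strip b Γ j α := by
  intro κ
  set a := affSimpleRoot b θ s with ha
  have hinv : ∀ α, act P w (act P w⁻¹ α) = α := fun α => by
    rw [← Equiv.Perm.mul_apply, ← map_mul, mul_inv_cancel, map_one, Equiv.Perm.one_apply]
  have hinv' : ∀ α, act P w⁻¹ (act P w α) = α := fun α => by
    rw [← Equiv.Perm.mul_apply, ← map_mul, inv_mul_cancel, map_one, Equiv.Perm.one_apply]
  have hroot : ∀ α, P.coroot' α (P.root (Γ j)) = P.pairingIn ℤ a (act P w⁻¹ α) := by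
    intro α
    rw [root_coroot'_eq_pairing, pairing_eq_intCast, ← pairingIn_act w a, hinv, hΓ]
  have hA : ∀ α, (strip b Γ (j + 1) α : ℝ) = strip₀ b (act P (w * refl P a)⁻¹ α) -
      P.coroot' α (τ - (κ : ℝ) • P.root (Γ j)) := by
    intro α
    obtain ⟨-, h1, h2, h3⟩ := strip₀_step hθ ha (rfl : κ = _) (act P w⁻¹ α)
    rw [act_inv_mul_refl, map_sub, map_smul, hroot, smul_eq_mul]
    have hN' := hN α
    by_cases c1 : α = Γ j
    · have h4 := h1 (by rw [c1, hΓ, hinv'])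
      rw [c1] at h4 hN' ⊢
      rw [strip_succ_self hpos]
      have h5 := congrArg (Int.cast : ℤ → ℝ) h4
      push_cast at h5 ⊢
      linarith
    by_cases c2 : α = opp P (Γ j)
    · have h4 := h2 (by rw [c2, hΓ, ← act_opp, hinv'])
      rw [c2] at h4 hN' ⊢
      rw [strip_succ_opp hpos]
      have h5 := congrArg (Int.cast : ℤ → ℝ) h4
      push_cast at h5 ⊢
      linarith
    · have h4 := h3 (fun h => c1 (by rw [hΓ, ← h, hinv]))
        (fun h => c2 (by rw [hΓ, ← act_opp, ← h, hinv]))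
      rw [strip_succ_of_ne c1 c2]
      have h5 := congrArg (Int.cast : ℤ → ℝ) h4
      push_cast at h5 ⊢
      linarith
  refine ⟨hA, fun α => ?_⟩
  -- Conjugation by w turns s_{β_j} into the linear part of the generator, and κ is the initial
  -- position with respect to a; hence the translation parts cancel between times j and j + 1.
  have h1 := hA (P.reflectionPerm (Γ j) α)
  have h2 := hN α
  have h3 := hN (Γ j)
  have h4 : act P w⁻¹ (Γ j) = a := by rw [hΓ, hinv']
  have h5 : strip₀ b a = κ := (strip₀_step hθ ha (rfl : κ = _) a).1
  rw [act_inv_mul_refl, act_reflectionPerm, h4, P.reflectionPerm_self, map_sub, map_smul,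
    hroot, act_reflectionPerm, h4, pairingIn_self_reflectionPerm,
    coroot'_reflectionPerm_eq, smul_eq_mul, pairing_eq_intCast] at h1
  rw [h4, h5] at h3
  have h6 : P.pairingIn ℤ a (act P w⁻¹ α) = P.pairingIn ℤ (Γ j) α := by
    rw [← pairingIn_act w a, hinv, hΓ]
  rw [h6] at h1
  have : (strip b Γ (j + 1) (P.reflectionPerm (Γ j) α) +
      strip b Γ j (Γ j) * P.pairingIn ℤ (Γ j) α : ℝ) = strip b Γ j α := by
    push_cast at h1
    rw [h1, h2, h3]; ring
  exact_mod_cast this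

/-- A point on which every simple coroot takes the value `1`. -/
lemma exists_forall_coroot'_eq_height (b : P.Base) :
    ∃ x : M, ∀ α, P.coroot' α x = (b.flip.height α : ℝ) := by
  obtain ⟨x, hx⟩ := (LinearMap.IsPerfPair.bijective_left P.toLinearMap).2
    (b.toCoweightBasis.constr ℝ fun _ => (1 : ℝ))
  refine ⟨x, fun α => ?_⟩
  have h1 : ∀ i ∈ b.support, P.coroot' i x = 1 := by
    intro i hi
    have := LinearMap.congr_fun hx (P.coroot i)
    rw [← b.toCoweightBasis_apply ⟨i, hi⟩, Module.Basis.constr_basis] at this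
    simpa using this
  obtain ⟨f, -, -, hf⟩ := b.flip.exists_root_eq_sum_int α
  rw [Base.height_eq_sum hf]
  have h2 : P.coroot' α x = P.toLinearMap x (P.coroot α) := rfl
  have h3 : P.coroot α = ∑ j ∈ b.support, f j • P.coroot j := hf
  rw [h2, h3, map_sum]
  push_cast
  refine Finset.sum_congr rfl fun i hi => ?_
  have h4 : P.toLinearMap x (P.coroot i) = 1 := h1 i hi
  rw [map_zsmul, h4]; simp

/-- Take ρ divided by ht θ^∨ + 1, where ρ has value 1 on all simple coroots: a positive coroot then
has the value ht α^∨ / (ht θ^∨ + 1). -/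
lemma fundAlcove_nonempty {θ : ι} (hθ : IsHighestCoroot b θ) : (fundAlcove b : Set M).Nonempty := by
  obtain ⟨x, hx⟩ := exists_forall_coroot'_eq_height b
  have hθ0 : 0 < b.flip.height θ := (flip_isPos θ).mpr hθ.isPos
  have hθ1 : (0 : ℝ) < b.flip.height θ + 1 := by exact_mod_cast (by omega)
  refine ⟨(b.flip.height θ + 1 : ℝ)⁻¹ • x, fun α hα => ?_⟩
  have h1 : 0 < b.flip.height α := (flip_isPos α).mpr hα
  have h2 := hθ α
  have h3 : (0 : ℝ) < b.flip.height α := by exact_mod_cast h1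
  have h4 : (b.flip.height α : ℝ) < b.flip.height θ + 1 := by exact_mod_cast (by omega)
  rw [map_smul, hx, smul_eq_mul]
  refine ⟨by positivity, ?_⟩
  rw [inv_mul_lt_iff₀ hθ1]; linarith

lemma affGen_eq (b : P.Base) (θ : ι) (s : Option b.support) : affGen b θ s =
    affRefl P (affSimpleRoot b θ s) (-(if s = none then 1 else 0 : ℤ)) := by
  rcases s with _ | i <;> simp [affGen, affSimpleRoot]

lemma affRefl_apply (a : ι) (k : ℤ) (x : M) :
    affRefl P a k x = P.reflection a x + (k : ℝ) • P.root a := by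
  simp [affRefl, add_comm]

/-- The j-th alcove is the image of A_∘ under the product V_j of the first j generators. Counting
occurrences of roots in Γ yields its true position because each new generator moves the alcove
across one wall, orthogonal to β_j. From here on only `IsAlcovePath` is used; neither the word nor
its reducedness matters any more. -/
theorem IsLambdaChain.isAlcovePath {lam : M} (hlam : IsDominantWeight b lam)
    (h : IsLambdaChain b lam Γ) : IsAlcovePath b lam Γ := by
  obtain ⟨θ, hθ, word, hv, -, hΓ⟩ := h
  set a : Fin n → ι := fun j => affSimpleRoot b θ (word j) with ha
  let W : ℕ → P.weylGroup := fun j => ((List.ofFn fun i => refl P (a i)).take j).prod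
  let V : ℕ → (M ≃ᵃ[ℝ] M) := fun j => ((List.ofFn fun i => affGen b θ (word i)).take j).prod
  have hW : ∀ j : Fin n, W (j + 1) = W j * refl P (a j) := by
    intro j
    have := List.prod_take_succ (List.ofFn fun i => refl P (a i)) j (by simp)
    simp only [W, this]; simp
  have hV : ∀ j : Fin n, V (j + 1) = V j * affGen b θ (word j) := by
    intro j
    have := List.prod_take_succ (List.ofFn fun i => affGen b θ (word i)) j (by simp)
    simp only [V, this]; simp
  have hΓW : ∀ j : Fin n, Γ j = act P (W j) (a j) := by
    intro j
    rw [(hΓ j).2]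
    congr 1
    simp only [W]
    rw [map_list_prod, List.map_take, List.map_ofFn]
    congr 3
  have hpos : ∀ j, b.IsPos (Γ j) := fun j => (hΓ j).1
  -- τ is the translation part of V_j and W_j its linear part.
  have key : ∀ j : ℕ, j ≤ n → ∃ τ : M,
      (∀ α, (strip b Γ j α : ℝ) = strip₀ b (act P (W j)⁻¹ α) - P.coroot' α τ) ∧
      ∀ α x, P.coroot' α (V j x) = P.coroot' (act P (W j)⁻¹ α) x + P.coroot' α τ := by
    intro j
    induction j with
    | zero => 
      intro _
      exact ⟨0, by simp [W, strip_zero], by simp [W, V]⟩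
    | succ j ih =>
      intro hj
      obtain ⟨τ, h1, h2⟩ := ih (by omega)
      have h3 := (strip_step hθ (word ⟨j, hj⟩) (W j) τ ⟨j, hj⟩ (hΓW ⟨j, hj⟩) (hpos _) h1).1
      rw [← hW ⟨j, hj⟩] at h3
      refine ⟨_, h3, fun α x => ?_⟩
      rw [hV ⟨j, hj⟩, hW ⟨j, hj⟩]
      have h4 : (V j * affGen b θ (word ⟨j, hj⟩)) x = V j (affGen b θ (word ⟨j, hj⟩) x) := rfl
      rw [h4, h2, affGen_eq, affRefl_apply, map_add, coroot'_act_refl_mul, map_smul, map_sub,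
        map_smul, hΓW ⟨j, hj⟩]
      have h5 : P.coroot' (act P (W j)⁻¹ α) (P.root (a ⟨j, hj⟩)) =
          P.coroot' α (P.root (act P (W j) (a ⟨j, hj⟩))) := by
        rw [root_coroot'_eq_pairing, root_coroot'_eq_pairing, ← pairing_act (W j),
          ← Equiv.Perm.mul_apply, ← map_mul, mul_inv_cancel, map_one, Equiv.Perm.one_apply]
      rw [h5]
      push_cast
      simp only [smul_eq_mul]
      ring
  refine ⟨hpos, fun j α => ?_, fun α hα => ?_⟩
  · obtain ⟨τ, h1, -⟩ := key j j.2.le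
    exact (strip_step hθ (word j) (W j) τ j (hΓW j) (hpos j) h1).2 α
  · obtain ⟨τ, h1, h2⟩ := key n le_rfl
    have hVn : V n = (List.ofFn fun j => affGen b θ (word j)).prod := by
      simp only [V]; rw [List.take_of_length_le (by simp)]
    obtain ⟨x, hx⟩ := fundAlcove_nonempty hθ
    have h3 : V n x ∈ (fun x => x - lam) '' fundAlcove b := by
      rw [← hv, hVn]; exact ⟨x, hx, rfl⟩
    obtain ⟨y, hy, hyx⟩ := h3
    have h4 := h2 α x
    have h5 := h1 α
    have hyx : y - lam = V n x := hyx
    rw [← hyx, map_sub] at h4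
    have h6 := hy α hα
    obtain ⟨z, hz⟩ := hlam.1 α
    have h7 : -(strip₀ b (act P (W n)⁻¹ α) : ℝ) < P.coroot' (act P (W n)⁻¹ α) x ∧
        P.coroot' (act P (W n)⁻¹ α) x < 1 - strip₀ b (act P (W n)⁻¹ α) := by
      by_cases hp : b.IsPos (act P (W n)⁻¹ α)
      · have := hx _ hp
        simp only [strip₀, hp, if_true]; push_cast
        constructor <;> linarith [this.1, this.2]
      · have := hx (opp P (act P (W n)⁻¹ α)) (by rwa [isPos_opp])
        rw [coroot'_opp] at this
        simp only [strip₀, hp, if_false]; push_cast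
        constructor <;> linarith [this.1, this.2]
    rw [hz] at h4 ⊢
    -- A point of the last alcove has the form y − λ with y in A_∘. Its value under α^∨ places the
    -- integer ⟨λ,α^∨⟩ at distance less than one from the integer `strip b Γ n α`.
    have h8 : (z : ℝ) < strip b Γ n α + 1 := by linarith [h6.1, h6.2, h7.1, h7.2]
    have h9 : (strip b Γ n α : ℝ) < z + 1 := by linarith [h6.1, h6.2, h7.1, h7.2]
    have h10 : z < strip b Γ n α + 1 := by exact_mod_cast h8
    have h11 : strip b Γ n α < z + 1 := by exact_mod_cast h9
    have : z = strip b Γ n α := by omega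
    rw [this]

end Chain

end AlcoveModel
end

/-! ### Folding: pulled-back hyperplanes, heights, and the levels l_i. -/

noncomputable section

namespace AlcoveModel

open RootPairing

variable {ι M N : Type*} [AddCommGroup M] [Module ℝ M] [AddCommGroup N] [Module ℝ N]
  {P : RootPairing ι ℝ M N} {n : ℕ}

/-- The elements of `J` among the first `i` positions. -/
def before (J : Finset (Fin n)) (i : ℕ) : Finset (Fin n) := J.filter fun j : Fin n => (j : ℕ) < i

lemma sort_eq_of_pairwise_lt {α : Type*} [LinearOrder α] {s : Finset α} {l : List α}
    (hl : l.Pairwise (· < ·)) (h : ∀ x, x ∈ l ↔ x ∈ s) : s.sort (· ≤ ·) = l := by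
  have hs : s = l.toFinset := by ext x; simp [h]
  rw [hs]
  exact (List.toFinset_sort (· ≤ ·) (hl.imp fun h => ne_of_lt h)).mpr (hl.imp fun h => h.le)

lemma pairwise_lt_sort {α : Type*} [LinearOrder α] (s : Finset α) :
    (s.sort (· ≤ ·)).Pairwise (· < ·) :=
  s.sortedLT_sort.pairwise

lemma sort_before_succ (J : Finset (Fin n)) (i : Fin n) :
    (before J (i + 1)).sort (· ≤ ·) =
      (before J i).sort (· ≤ ·) ++ if i ∈ J then [i] else [] := by
  apply sort_eq_of_pairwise_lt
  · rw [List.pairwise_append]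
    refine ⟨pairwise_lt_sort _, by split_ifs <;> simp, ?_⟩
    intro x hx y hy
    split_ifs at hy
    · rw [Finset.mem_sort, before, Finset.mem_filter] at hx
      rw [List.mem_singleton.mp hy]
      exact hx.2
    · simp at hy
  · intro x
    by_cases hi : i ∈ J
    · by_cases hx : x = i
      · subst hx; simp [before, hi]
      · have : (x : ℕ) ≠ i := fun h => hx (Fin.ext h)
        simp only [before, hi, if_true, List.mem_append, Finset.mem_sort, Finset.mem_filter,
          List.mem_singleton, hx, or_false, and_congr_right_iff]
        omega
    · by_cases hx : x = i
      · subst hx; simp [before, hi]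
      · have : (x : ℕ) ≠ i := fun h => hx (Fin.ext h)
        simp only [before, hi, if_false, List.append_nil, Finset.mem_sort, Finset.mem_filter,
          and_congr_right_iff]
        omega

lemma before_zero (J : Finset (Fin n)) : before J 0 = ∅ := by simp [before]

lemma before_last (J : Finset (Fin n)) : before J n = J := by
  ext j; simp [before]

lemma sort_filter_lt (J : Finset (Fin n)) (i : Fin n) :
    (J.sort (· ≤ ·)).filter (· < i) = (before J i).sort (· ≤ ·) := by
  symm
  apply sort_eq_of_pairwise_lt
  · exact (pairwise_lt_sort J).filter _
  · intro x; simp [before]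

/-- The Weyl group element `w(J ∩ {1, …, i})`. -/
def weylAt (P : RootPairing ι ℝ M N) (Γ : Fin n → ι) (J : Finset (Fin n)) (i : ℕ) : P.weylGroup :=
  weylElt P Γ (before J i)

lemma weylAt_zero (Γ : Fin n → ι) (J : Finset (Fin n)) : weylAt P Γ J 0 = 1 := by
  simp [weylAt, before_zero, weylElt]

lemma weylAt_succ_of_mem {Γ : Fin n → ι} {J : Finset (Fin n)} {i : Fin n} (hi : i ∈ J) :
    weylAt P Γ J (i + 1) = weylAt P Γ J i * refl P (Γ i) := by
  simp [weylAt, weylElt, sort_before_succ, hi]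

lemma weylAt_succ_of_notMem {Γ : Fin n → ι} {J : Finset (Fin n)} {i : Fin n} (hi : i ∉ J) :
    weylAt P Γ J (i + 1) = weylAt P Γ J i := by
  simp [weylAt, weylElt, sort_before_succ, hi]

section Duality

variable [Finite ι] [P.IsRootSystem] [P.IsCrystallographic] [P.IsReduced]

lemma reflHyp_reflHyp (a h : ι × ℤ) : reflHyp P a (reflHyp P a h) = h := by
  obtain ⟨η, k⟩ := h
  simp [reflHyp, pairingIn_self_reflectionPerm]

lemma reflHyp_add (a : ι × ℤ) (η : ι) (k c : ℤ) :
    reflHyp P a (η, k + c) = ((reflHyp P a (η, k)).1, (reflHyp P a (η, k)).2 + c) := by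
  simp only [reflHyp, Prod.mk.injEq, true_and]; ring

lemma reflHyp_opp (a : ι × ℤ) (η : ι) (k : ℤ) :
    reflHyp P a (opp P η, -k) = (opp P (reflHyp P a (η, k)).1, -(reflHyp P a (η, k)).2) := by
  simp only [reflHyp, Prod.mk.injEq, reflectionPerm_opp, pairingIn_opp_right, true_and]; ring

lemma foldr_reflHyp_foldl (l : List (ι × ℤ)) (h : ι × ℤ) :
    l.foldr (reflHyp P) (l.foldl (fun D a => reflHyp P a D) h) = h := by
  induction l generalizing h with
  | nil => rfl
  | cons a t ih => rw [List.foldl_cons, List.foldr_cons, ih, reflHyp_reflHyp]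

lemma foldr_reflHyp_add (l : List (ι × ℤ)) (η : ι) (k c : ℤ) :
    l.foldr (reflHyp P) (η, k + c) =
      ((l.foldr (reflHyp P) (η, k)).1, (l.foldr (reflHyp P) (η, k)).2 + c) := by
  induction l with
  | nil => rfl
  | cons a t ih => rw [List.foldr_cons, List.foldr_cons, ih, reflHyp_add]

lemma foldr_reflHyp_opp (l : List (ι × ℤ)) (η : ι) (k : ℤ) :
    l.foldr (reflHyp P) (opp P η, -k) =
      (opp P (l.foldr (reflHyp P) (η, k)).1, -(l.foldr (reflHyp P) (η, k)).2) := by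
  induction l with
  | nil => rfl
  | cons a t ih => rw [List.foldr_cons, List.foldr_cons, ih, reflHyp_opp]

lemma foldr_reflHyp_fst (l : List (ι × ℤ)) (h : ι × ℤ) :
    (l.foldr (reflHyp P) h).1 = act P (l.map fun a => refl P a.1).prod h.1 := by
  induction l with
  | nil => simp
  | cons a t ih =>
    rw [List.foldr_cons, List.map_cons, List.prod_cons, map_mul, Equiv.Perm.mul_apply, ← ih,
      act_refl]
    rfl

lemma foldl_reflHyp_fst (l : List (ι × ℤ)) (h : ι × ℤ) :
    (l.foldl (fun D a => reflHyp P a D) h).1 = act P (l.map fun a => refl P a.1).prod⁻¹ h.1 := by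
  have := foldr_reflHyp_fst (P := P) l (l.foldl (fun D a => reflHyp P a D) h)
  rw [foldr_reflHyp_foldl] at this
  rw [this, ← Equiv.Perm.mul_apply, ← map_mul, inv_mul_cancel, map_one, Equiv.Perm.one_apply]

/-- This is an identity of affine functions and not only of their zero sets, so it can be iterated
along a product of reflections and evaluated at −λ to obtain l_∞^p. -/
lemma coroot'_affRefl (a h : ι × ℤ) (x : M) :
    P.coroot' h.1 (affRefl P a.1 a.2 x) - h.2 =
      P.coroot' (reflHyp P a h).1 x - (reflHyp P a h).2 := by
  rw [affRefl_apply, map_add, map_smul, P.coroot'_reflection, root_coroot'_eq_pairing,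
    pairing_eq_intCast]
  simp only [reflHyp, smul_eq_mul]
  push_cast; ring

lemma coroot'_prod_affRefl (l : List (ι × ℤ)) (h : ι × ℤ) (x : M) :
    P.coroot' h.1 ((l.map fun a => affRefl P a.1 a.2).prod x) - h.2 =
      P.coroot' (l.foldl (fun D a => reflHyp P a D) h).1 x -
        (l.foldl (fun D a => reflHyp P a D) h).2 := by
  induction l generalizing h with
  | nil => simp
  | cons a t ih =>
    rw [List.map_cons, List.prod_cons, List.foldl_cons, ← ih, ← coroot'_affRefl]
    rfl

/-- Folds are applied from the last position to the first, and each changes only later positions. So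
every fold is made in the original wall g a, and position i feels exactly the folds before it. -/
lemma foldr_foldAt_apply (g : Fin n → ι × ℤ) (l : List (Fin n)) (hl : l.Pairwise (· < ·))
    (i : Fin n) : l.foldr (foldAt P) g i = ((l.filter (· < i)).map g).foldr (reflHyp P) (g i) := by
  induction l generalizing i with
  | nil => rfl
  | cons a t ih =>
    rw [List.pairwise_cons] at hl
    rw [List.foldr_cons, foldAt]
    split_ifs with h
    · have h1 : t.filter (· < a) = [] := by
        rw [List.filter_eq_nil_iff]
        intro x hx
        simpa using (hl.1 x hx).le
      rw [ih hl.2, ih hl.2, h1, List.filter_cons_of_pos (by simpa using h)]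
      rfl
    · rw [ih hl.2, List.filter_cons_of_neg (by simpa using h)]

end Duality

section State

variable [Finite ι] [P.IsRootSystem] [P.IsCrystallographic] [P.IsReduced]

/-- The pull-back of the hyperplane `H_{p,0}` along the folding of the first `i` steps of the
alcove path. -/
def pullback (P : RootPairing ι ℝ M N) [P.IsCrystallographic] (Γ : Fin n → ι) (p : ι)
    (J : Finset (Fin n)) (i : ℕ) : ι × ℤ :=
  (((before J i).sort (· ≤ ·)).map (initFolding Γ)).foldl (fun D a => reflHyp P a D) (p, 0)

/-- The position of the `i`th alcove of the folded alcove path with respect to the hyperplanes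
orthogonal to `p`. -/
def ht (b : P.Base) (Γ : Fin n → ι) (p : ι) (J : Finset (Fin n)) (i : ℕ) : ℤ :=
  strip b Γ i (pullback P Γ p J i).1 + (pullback P Γ p J i).2

variable {b : P.Base} {Γ : Fin n → ι} {p : ι} {J : Finset (Fin n)} {lam : M}

lemma pullback_zero : pullback P Γ p J 0 = (p, 0) := by simp [pullback, before_zero]

lemma pullback_succ_of_mem {i : Fin n} (hi : i ∈ J) :
    pullback P Γ p J (i + 1) = reflHyp P (initFolding Γ i) (pullback P Γ p J i) := by
  simp [pullback, sort_before_succ, hi]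

lemma pullback_succ_of_notMem {i : Fin n} (hi : i ∉ J) :
    pullback P Γ p J (i + 1) = pullback P Γ p J i := by
  simp [pullback, sort_before_succ, hi]

lemma initFolding_eq (h : IsAlcovePath b lam Γ) (i : Fin n) :
    initFolding Γ i = (Γ i, -strip b Γ i (Γ i)) := by
  simp [initFolding, initLevel_eq_occ, strip, h.pos]

lemma pullback_fst (i : ℕ) : (pullback P Γ p J i).1 = act P (weylAt P Γ J i)⁻¹ p := by
  rw [pullback, foldl_reflHyp_fst, weylAt, weylElt, List.map_map]
  rfl

lemma ht_zero (hp : b.IsPos p) : ht b Γ p J 0 = 0 := by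
  simp [ht, pullback_zero, strip_zero, strip₀, hp]

lemma pullback_fst_succ_of_mem {i : Fin n} (hi : i ∈ J) :
    (pullback P Γ p J (i + 1)).1 = P.reflectionPerm (Γ i) (pullback P Γ p J i).1 := by
  rw [pullback_succ_of_mem hi]; rfl

/-- The wall reflection that carries one neighbouring alcove to the other is also applied to the
pulled-back hyperplane. The field `step` says that the two effects cancel. -/
lemma ht_succ_of_mem (h : IsAlcovePath b lam Γ) {i : Fin n} (hi : i ∈ J) :
    ht b Γ p J (i + 1) = ht b Γ p J i := by
  rw [ht, pullback_succ_of_mem hi, initFolding_eq h, ht, ← h.step i (pullback P Γ p J i).1]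
  simp only [reflHyp]; ring

lemma ht_succ_of_eq (h : IsAlcovePath b lam Γ) {i : Fin n} (hi : i ∉ J)
    (hη : (pullback P Γ p J i).1 = Γ i) : ht b Γ p J (i + 1) = ht b Γ p J i + 1 := by
  rw [ht, pullback_succ_of_notMem hi, hη, strip_succ_self (h.pos i), ht, hη]; ring

lemma ht_succ_of_eq_opp (h : IsAlcovePath b lam Γ) {i : Fin n} (hi : i ∉ J)
    (hη : (pullback P Γ p J i).1 = opp P (Γ i)) : ht b Γ p J (i + 1) = ht b Γ p J i - 1 := by
  rw [ht, pullback_succ_of_notMem hi, hη, strip_succ_opp (h.pos i), ht, hη]; ring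

lemma ht_succ_of_ne {i : Fin n} (hi : i ∉ J) (h1 : (pullback P Γ p J i).1 ≠ Γ i)
    (h2 : (pullback P Γ p J i).1 ≠ opp P (Γ i)) : ht b Γ p J (i + 1) = ht b Γ p J i := by
  rw [ht, pullback_succ_of_notMem hi, strip_succ_of_ne h1 h2, ht]

lemma folding_eq (i : Fin n) : folding P Γ J i =
    (((before J i).sort (· ≤ ·)).map (initFolding Γ)).foldr (reflHyp P) (initFolding Γ i) := by
  rw [folding, foldr_foldAt_apply _ _ (pairwise_lt_sort J), sort_filter_lt]

/-- The i-th wall is a translate of the pulled-back hyperplane. The folds undo the pull-back and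
preserve differences of levels, so they carry the wall to a translate of H_{p,0}. -/
lemma folding_of_eq (h : IsAlcovePath b lam Γ) {i : Fin n} (hη : (pullback P Γ p J i).1 = Γ i) :
    folding P Γ J i = (p, -ht b Γ p J i) := by
  have h1 : initFolding Γ i = ((pullback P Γ p J i).1,
      (pullback P Γ p J i).2 + (-strip b Γ i (Γ i) - (pullback P Γ p J i).2)) := by
    rw [initFolding_eq h, hη]; simp
  rw [folding_eq, h1, foldr_reflHyp_add, Prod.mk.eta, pullback, foldr_reflHyp_foldl, ← pullback,
    ht, hη]
  ext <;> simp; ring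

lemma folding_of_eq_opp (h : IsAlcovePath b lam Γ) {i : Fin n}
    (hη : (pullback P Γ p J i).1 = opp P (Γ i)) :
    folding P Γ J i = (opp P p, ht b Γ p J i - 1) := by
  have h1 : initFolding Γ i = (opp P (pullback P Γ p J i).1,
      -(pullback P Γ p J i).2 + (-strip b Γ i (Γ i) + (pullback P Γ p J i).2)) := by
    rw [initFolding_eq h, hη]; simp
  rw [folding_eq, h1, foldr_reflHyp_add, foldr_reflHyp_opp, Prod.mk.eta]
  have h2 : (((before J i).sort (· ≤ ·)).map (initFolding Γ)).foldr (reflHyp P)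
    (pullback P Γ p J i) = (p, 0) := by rw [pullback, foldr_reflHyp_foldl]
  rw [h2, ht, hη, strip_opp]
  ext <;> simp; ring

lemma mem_posSet_iff {i : Fin n} : i ∈ posSet P p Γ J ↔
    (pullback P Γ p J i).1 = Γ i ∨ (pullback P Γ p J i).1 = opp P (Γ i) := by
  classical
  have h0 : (folding P Γ J i).1 = act P (weylAt P Γ J i) (Γ i) := by
    rw [folding_eq, foldr_reflHyp_fst, List.map_map]; rfl
  have h1 : ∀ x, act P (weylAt P Γ J i) (Γ i) = x ↔ act P (weylAt P Γ J i)⁻¹ x = Γ i := by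
    intro x
    constructor
    · rintro rfl
      rw [← Equiv.Perm.mul_apply, ← map_mul, inv_mul_cancel, map_one, Equiv.Perm.one_apply]
    · intro h
      rw [← h, ← Equiv.Perm.mul_apply, ← map_mul, mul_inv_cancel, map_one, Equiv.Perm.one_apply]
  rw [posSet, Finset.mem_filter, ← root_opp, P.root.injective.eq_iff, P.root.injective.eq_iff, h0,
    h1, h1, act_opp, opp_eq_iff, pullback_fst]
  simp

lemma level_of_eq (h : IsAlcovePath b lam Γ) (hp : b.IsPos p) {i : Fin n}
    (hη : (pullback P Γ p J i).1 = Γ i) : level b Γ J i = ht b Γ p J i := by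
  simp [level, folding_of_eq h hη, levelOf, hp]

lemma level_of_eq_opp (h : IsAlcovePath b lam Γ) (hp : b.IsPos p) {i : Fin n}
    (hη : (pullback P Γ p J i).1 = opp P (Γ i)) : level b Γ J i = ht b Γ p J i - 1 := by
  simp [level, folding_of_eq_opp h hη, levelOf, isPos_opp, hp]

lemma levelInf_eq : levelInf P lam p Γ J =
    P.coroot' (pullback P Γ p J n).1 lam + (pullback P Γ p J n).2 := by
  have h1 := coroot'_prod_affRefl (P := P) (((before J n).sort (· ≤ ·)).map (initFolding Γ))
    (p, 0) (-lam)
  rw [← pullback, List.map_map, before_last] at h1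
  have h2 : (fun a : ι × ℤ => affRefl P a.1 a.2) ∘ initFolding Γ = affReflAt P Γ := by
    ext i : 1; rfl
  rw [h2] at h1
  rw [levelInf, weight, map_neg]
  simp only [Int.cast_zero, sub_zero, map_neg] at h1
  rw [h1]; ring

lemma levelInf_of_pos (h : IsAlcovePath b lam Γ) (hp : b.IsPos (pullback P Γ p J n).1) :
    levelInf P lam p Γ J = ht b Γ p J n := by
  rw [levelInf_eq, h.final _ hp, ht]; push_cast; ring

/-- The vertex −λ bounds the last strip from below or from above according to the sign of the
pulled-back root, whence the shift by one. -/
lemma levelInf_of_not_pos (h : IsAlcovePath b lam Γ) (hp : ¬ b.IsPos (pullback P Γ p J n).1) :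
    levelInf P lam p Γ J = ht b Γ p J n - 1 := by
  have h1 := h.final (opp P (pullback P Γ p J n).1) (by rwa [isPos_opp])
  rw [coroot'_opp, strip_opp] at h1
  rw [levelInf_eq, ht]; push_cast at h1 ⊢; linarith

end State

end AlcoveModel
end

/-! ### Height walks and their turns at the maximum. -/

noncomputable section

namespace AlcoveModel

open RootPairing

section Walk

variable {n : ℕ}

/-- The combinatorics of the heights `h` and the directions `s` along a folded alcove path: the
steps in `U` and `D` touch a hyperplane from below and from above, and `J` is the set of
folding positions. -/
structure IsWalk (J : Finset (Fin n)) (U D : Fin n → Prop) (h : ℕ → ℤ) (s : ℕ → Prop) : Prop where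
  zero_ht : h 0 = 0
  zero_pos : s 0
  up_pos : ∀ i : Fin n, U i → s i
  down_neg : ∀ i : Fin n, D i → ¬ s i
  fold_ht : ∀ i : Fin n, i ∈ J → h (i + 1) = h i
  up_ht : ∀ i : Fin n, i ∉ J → U i → h (i + 1) = h i + 1
  down_ht : ∀ i : Fin n, i ∉ J → D i → h (i + 1) = h i - 1
  keep_ht : ∀ i : Fin n, i ∉ J → ¬ U i → ¬ D i → h (i + 1) = h i
  fold_neg : ∀ i : Fin n, i ∈ J → U i → ¬ s (i + 1)
  keep_pos : ∀ i : Fin n, s i → ¬ (i ∈ J ∧ U i) → s (i + 1)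
  keep_of_notMem : ∀ i : Fin n, i ∉ J → (s (i + 1) ↔ s i)

/-- `k` is the last crossing into the maximal height `M` before the first folding `m` at this
height, where `m = n` if there is no such folding. -/
structure IsTurn (J : Finset (Fin n)) (U D : Fin n → Prop) (h : ℕ → ℤ) (s : ℕ → Prop)
    (M : ℤ) (k : Fin n) (m : ℕ) : Prop where
  lt : (k : ℕ) < m
  le : m ≤ n
  ht_lt : ∀ i ≤ (k : ℕ), h i < M
  mid : ∀ i, (k : ℕ) < i → i ≤ m → h i = M ∧ s i
  keep : ∀ i : Fin n, k < i → (i : ℕ) < m → ¬ U i ∧ ¬ D i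
  up : U k
  notMem : k ∉ J
  fold : ∀ hm : m < n, U ⟨m, hm⟩ ∧ ⟨m, hm⟩ ∈ J ∧ h (m + 1) = M ∧ ¬ s (m + 1)

variable {J : Finset (Fin n)} {U D : Fin n → Prop} {h : ℕ → ℤ} {s : ℕ → Prop} {M : ℤ}
  {k : Fin n} {m : ℕ}

/-- Together with `IsTurn.fold_lt_iff`, this recovers k and m from heights and signs alone: the
maximum is first reached at time k + 1, and it first occurs with negative sign at time m + 1. Turns
of different paths can thus be compared without their folding sets. -/
lemma IsTurn.lt_iff (H : IsTurn J U D h s M k m) {i : ℕ} :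
    (k : ℕ) < i ↔ ∃ j ≤ i, h j = M := by
  constructor
  · intro hi
    exact ⟨k + 1, hi, (H.mid (k + 1) (by omega) H.lt).1⟩
  · rintro ⟨j, hj, hM⟩
    by_contra hk
    have := H.ht_lt j (by omega)
    omega

lemma IsTurn.fold_lt_iff (H : IsTurn J U D h s M k m) {i : ℕ} (hi : i ≤ n) :
    m < i ↔ ∃ j ≤ i, h j = M ∧ ¬ s j := by
  constructor
  · intro hm
    exact ⟨m + 1, hm, (H.fold (by omega)).2.2⟩
  · rintro ⟨j, hj, hM, hs⟩
    by_contra hk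
    by_cases h1 : j ≤ k
    · have := H.ht_lt j h1; omega
    · exact hs (H.mid j (by omega) (by omega)).2

namespace IsWalk

lemma exists_max (n : ℕ) (h : ℕ → ℤ) : ∃ M, (∀ i ≤ n, h i ≤ M) ∧ ∃ i ≤ n, h i = M := by
  obtain ⟨i, hi, hmax⟩ := Finset.exists_max_image (Finset.range (n + 1)) h ⟨0, by simp⟩
  exact ⟨h i, fun j hj => hmax j (by simp; omega), i, by simp at hi; omega, rfl⟩

/-- An unfolded upward step would exceed the maximum. -/
lemma of_up (H : IsWalk J U D h s) (hM : ∀ i ≤ n, h i ≤ M) {i : Fin n} (hU : U i) (hi : h i = M) :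
    i ∈ J ∧ h (i + 1) = M ∧ ¬ s (i + 1) := by
  have hJ : i ∈ J := by
    by_contra hJ
    have := H.up_ht i hJ hU
    have := hM (i + 1) (by omega)
    omega
  exact ⟨hJ, by rw [H.fold_ht i hJ, hi], H.fold_neg i hJ hU⟩

/-- A new occurrence of height M with negative sign cannot come from an unfolded step: signs are
kept there, and a downward step would start above M. So it comes from a fold that turns the sign,
which is a fold at an upward wall. -/
lemma up_of (H : IsWalk J U D h s) (hM : ∀ i ≤ n, h i ≤ M) {i : Fin n} (h1 : h (i + 1) = M)
    (h2 : ¬ s (i + 1)) (h3 : ¬ (h i = M ∧ ¬ s i)) : U i ∧ h i = M := by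
  by_cases hJ : i ∈ J
  · have h4 := H.fold_ht i hJ
    have hs : s i := by
      by_contra hs; exact h3 ⟨by omega, hs⟩
    refine ⟨?_, by omega⟩
    by_contra hU
    exact h2 (H.keep_pos i hs fun h => hU h.2)
  · have hs : ¬ s i := by rwa [H.keep_of_notMem i hJ] at h2
    have hU : ¬ U i := fun hU => hs (H.up_pos i hU)
    by_cases hD : D i
    · have := H.down_ht i hJ hD
      have := hM i (by omega)
      omega
    · exact absurd ⟨by rw [← h1, H.keep_ht i hJ hU hD], hs⟩ h3

lemma up_of_lt (H : IsWalk J U D h s) {i : Fin n} (h1 : h (i + 1) = M) (h2 : h i < M) :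
    i ∉ J ∧ U i ∧ s (i + 1) := by
  have hJ : i ∉ J := fun hJ => by have := H.fold_ht i hJ; omega
  have hU : U i := by
    by_contra hU
    by_cases hD : D i
    · have := H.down_ht i hJ hD; omega
    · have := H.keep_ht i hJ hU hD; omega
  exact ⟨hJ, hU, (H.keep_of_notMem i hJ).mpr (H.up_pos i hU)⟩

lemma pos_of_first (H : IsWalk J U D h s) {κ : ℕ} (hκ : κ ≤ n) (h1 : h κ = M)
    (h2 : ∀ i < κ, h i ≠ M) (hM : ∀ i ≤ n, h i ≤ M) : s κ := by
  rcases κ with _ | κ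
  · exact H.zero_pos
  · exact (H.up_of_lt (i := ⟨κ, hκ⟩) h1 (lt_of_le_of_ne (hM κ (by omega)) (h2 κ (by omega)))).2.2

/-- With positive sign no downward wall is met, and an upward wall at height M would be folded and
turn the sign. So the path cannot leave the maximum before its sign becomes negative. -/
lemma stay (H : IsWalk J U D h s) {κ : ℕ} (h1 : h κ = M) (h2 : s κ) (hM : ∀ i ≤ n, h i ≤ M) :
    ∀ i, κ ≤ i → i ≤ n → (∀ j, κ ≤ j → j ≤ i → ¬ (h j = M ∧ ¬ s j)) → h i = M ∧ s i := by
  intro i hi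
  induction i, hi using Nat.le_induction with
  | base => exact fun _ _ => ⟨h1, h2⟩
  | succ i hi ih =>
    intro hn hj
    obtain ⟨h3, h4⟩ := ih (by omega) fun j h5 h6 => hj j h5 (by omega)
    have hnot := hj (i + 1) (by omega) le_rfl
    have hU : ¬ U ⟨i, hn⟩ := fun hU => hnot (H.of_up hM (i := ⟨i, hn⟩) hU h3).2
    have hD : ¬ D ⟨i, hn⟩ := fun hD => H.down_neg _ hD h4
    refine ⟨?_, H.keep_pos ⟨i, hn⟩ h4 fun h => hU h.2⟩
    by_cases hJ : (⟨i, hn⟩ : Fin n) ∈ J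
    · rw [← h3]; exact H.fold_ht _ hJ
    · rw [← h3]; exact H.keep_ht _ hJ hU hD

/-- Let κ be the first time at height M; it is not 0 because M > 0, and k = κ − 1 is the crossing
that leads there. -/
lemma exists_isTurn (H : IsWalk J U D h s) (hM : ∀ i ≤ n, h i ≤ M) (hM' : ∃ i ≤ n, h i = M)
    (hpos : 0 < M) : ∃ k m, IsTurn J U D h s M k m := by
  classical
  let κ := Nat.find hM'
  obtain ⟨hκn, hκ⟩ := Nat.find_spec hM'
  have hκ' : ∀ i < κ, h i ≠ M := fun i hi h1 => Nat.find_min hM' hi ⟨by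
    have : κ ≤ n := hκn
    omega, h1⟩
  have hκn : κ ≤ n := hκn
  have hκ : h κ = M := hκ
  have hκ0 : κ ≠ 0 := fun h0 => by rw [h0, H.zero_ht] at hκ; omega
  have hsκ := H.pos_of_first hκn hκ hκ' hM
  have hlt : ∀ i < κ, h i < M := fun i hi => lt_of_le_of_ne (hM i (by omega)) (hκ' i hi)
  have hstep := H.up_of_lt (i := ⟨κ - 1, by omega⟩) (M := M)
    (by rw [Nat.sub_add_cancel (by omega)]; exact hκ) (hlt (κ - 1) (by omega))
  -- Time m + 1 is the first one at height M with negative sign; m = n stands for the absence of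
  -- such a time, which is the value ∞ of m in the definition of F_p.
  have hfirst : ∃ m, κ ≤ m ∧ m ≤ n ∧ (∀ j ≤ m, ¬ (h j = M ∧ ¬ s j)) ∧
      ∀ hm : m < n, h (m + 1) = M ∧ ¬ s (m + 1) := by
    have hbefore : ∀ j ≤ κ, ¬ (h j = M ∧ ¬ s j) := by
      rintro j hj ⟨h1, h2⟩
      rcases hj.lt_or_eq with hj | rfl
      · exact hκ' j hj h1
      · exact h2 hsκ
    by_cases hex : ∃ j, j ≤ n ∧ h j = M ∧ ¬ s j
    · obtain ⟨h1, h2, h3⟩ := Nat.find_spec hex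
      have h4 : ∀ j < Nat.find hex, ¬ (h j = M ∧ ¬ s j) := fun j hj h5 =>
        Nat.find_min hex hj ⟨by omega, h5⟩
      have h5 : κ < Nat.find hex := by
        by_contra h6
        exact hbefore _ (by omega) ⟨h2, h3⟩
      refine ⟨Nat.find hex - 1, by omega, by omega, fun j hj => h4 j (by omega), fun _ => ?_⟩
      rw [Nat.sub_add_cancel (by omega)]
      exact ⟨h2, h3⟩
    · push Not at hex
      exact ⟨n, hκn, le_rfl, fun j hj h1 => h1.2 (hex j hj h1.1), fun h => absurd h (lt_irrefl _)⟩
  obtain ⟨m, hm1, hm2, hm3, hm4⟩ := hfirst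
  have hmid : ∀ i, κ ≤ i → i ≤ m → h i = M ∧ s i := fun i hi him =>
    H.stay hκ hsκ hM i hi (by omega) fun j _ h2 => hm3 j (by omega)
  refine ⟨⟨κ - 1, by omega⟩, m, ⟨by simp; omega, hm2, ?_, ?_, ?_, hstep.2.1, hstep.1, ?_⟩⟩
  · intro i hi
    exact hlt i (by simp at hi; omega)
  · intro i hi
    exact hmid i (by simp at hi; omega)
  · intro i hi him
    have hi' : κ ≤ i := by have : κ - 1 < (i : ℕ) := hi; omega
    obtain ⟨h1, h2⟩ := hmid i hi' him.le
    refine ⟨fun hU => ?_, fun hD => H.down_neg i hD h2⟩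
    exact (H.of_up hM hU h1).2.2 (hmid (i + 1) (by omega) him).2
  · intro hm
    obtain ⟨h1, h2⟩ := hm4 hm
    obtain ⟨h3, h4⟩ := H.up_of hM (i := ⟨m, hm⟩) h1 h2 (hm3 m le_rfl)
    exact ⟨h3, (H.of_up hM h3 h4).1, h1, h2⟩

end IsWalk

end Walk

end AlcoveModel
end

/-! ### The root operator as the transfer of a fold from m to k. -/

noncomputable section

namespace AlcoveModel

open RootPairing

variable {ι M N : Type*} [AddCommGroup M] [Module ℝ M] [AddCommGroup N] [Module ℝ N]
  {P : RootPairing ι ℝ M N} {n : ℕ}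
  [Finite ι] [P.IsRootSystem] [P.IsCrystallographic] [P.IsReduced]
  {b : P.Base} {Γ : Fin n → ι} {p : ι} {J : Finset (Fin n)} {lam : M}

lemma isAdmissible_iff (hΓ : ∀ i, b.IsPos (Γ i)) : IsAdmissible b Γ J ↔
    ∀ i : Fin n, i ∈ J → length b (weylAt P Γ J (i + 1)) = length b (weylAt P Γ J i) + 1 := by
  have h1 : ∀ i : Fin n, (J.filter fun j => j ≤ i) = before J (i + 1) := fun i => by
    ext j
    simp only [before, Finset.mem_filter, and_congr_right_iff]
    intro _
    omega
  have h2 : ∀ i : Fin n, (J.filter fun j => j < i) = before J i := fun i => by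
    ext j; simp [before]
  refine forall₂_congr fun i hi => ?_
  rw [h1, h2]
  constructor
  · rintro ⟨β, -, -, h⟩
    exact h
  · intro h
    refine ⟨Γ i, hΓ i, ?_, h⟩
    change weylAt P Γ J i = weylAt P Γ J (i + 1) * _
    rw [weylAt_succ_of_mem hi, mul_assoc, refl_mul_self, mul_one]

/-- The root `w_i⁻¹ α_p`. -/
def rootAt (P : RootPairing ι ℝ M N) (Γ : Fin n → ι) (p : ι) (J : Finset (Fin n)) (i : ℕ) : ι :=
  act P (weylAt P Γ J i)⁻¹ p

lemma rootAt_succ_of_mem {i : Fin n} (hi : i ∈ J) :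
    rootAt P Γ p J (i + 1) = P.reflectionPerm (Γ i) (rootAt P Γ p J i) := by
  rw [rootAt, weylAt_succ_of_mem hi, act_inv_mul_refl, rootAt]

lemma rootAt_succ_of_notMem {i : Fin n} (hi : i ∉ J) :
    rootAt P Γ p J (i + 1) = rootAt P Γ p J i := by
  rw [rootAt, weylAt_succ_of_notMem hi, rootAt]

/-- If a fold turned the sign from plus to minus, the lifting property would identify w_i⁻¹α_p with
β_i. This is the only place where admissibility enters the height walk. -/
lemma isPos_rootAt_succ (hΓ : ∀ i, b.IsPos (Γ i)) (hp : p ∈ b.support) (hJ : IsAdmissible b Γ J)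
    {i : Fin n} (h : b.IsPos (rootAt P Γ p J i)) (hn : ¬ (i ∈ J ∧ rootAt P Γ p J i = Γ i)) :
    b.IsPos (rootAt P Γ p J (i + 1)) := by
  by_cases hi : i ∈ J
  · rw [rootAt_succ_of_mem hi]
    by_contra h1
    refine hn ⟨hi, eq_of_cover hp (hΓ i) ?_ h h1⟩
    rw [← weylAt_succ_of_mem hi]
    exact (isAdmissible_iff hΓ).mp hJ i hi
  · rwa [rootAt_succ_of_notMem hi]

lemma isWalk (h : IsAlcovePath b lam Γ) (hp : p ∈ b.support) (hJ : IsAdmissible b Γ J) :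
    IsWalk J (fun i => rootAt P Γ p J i = Γ i) (fun i => rootAt P Γ p J i = opp P (Γ i))
      (ht b Γ p J) (fun i => b.IsPos (rootAt P Γ p J i)) where
  zero_ht := ht_zero (Base.isPos_of_mem_support hp)
  zero_pos := by
    rw [rootAt, weylAt_zero, inv_one, map_one]; exact Base.isPos_of_mem_support hp
  up_pos i hi := by rw [hi]; exact h.pos i
  down_neg i hi := by rw [hi, isPos_opp, not_not]; exact h.pos i
  fold_ht i hi := ht_succ_of_mem h hi
  up_ht i hi hU := ht_succ_of_eq h hi (by rw [pullback_fst]; exact hU)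
  down_ht i hi hD := ht_succ_of_eq_opp h hi (by rw [pullback_fst]; exact hD)
  keep_ht i hi hU hD := ht_succ_of_ne hi (by rw [pullback_fst]; exact hU)
    (by rw [pullback_fst]; exact hD)
  fold_neg i hi hU := by
    rw [rootAt_succ_of_mem hi, hU, isPos_reflectionPerm_self, not_not]; exact h.pos i
  keep_pos i hs hn := isPos_rootAt_succ h.pos hp hJ hs hn
  keep_of_notMem i hi := by rw [rootAt_succ_of_notMem hi]

/-- Moving the folding position `m` to `k`. -/
def moveFold (J : Finset (Fin n)) (k : Fin n) (m : ℕ) : Finset (Fin n) :=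
  (J.filter fun i : Fin n => (i : ℕ) ≠ m) ∪ {k}

lemma mem_moveFold {k : Fin n} {m : ℕ} {i : Fin n} :
    i ∈ moveFold J k m ↔ (i ∈ J ∧ (i : ℕ) ≠ m) ∨ i = k := by
  simp [moveFold, or_comm]

variable (b Γ p J) in
/-- The turn of the folded alcove path of `J` in direction `p`. -/
abbrev IsPathTurn (L : ℤ) (k : Fin n) (m : ℕ) : Prop :=
  IsTurn J (fun i => rootAt P Γ p J i = Γ i) (fun i => rootAt P Γ p J i = opp P (Γ i))
      (ht b Γ p J) (fun i => b.IsPos (rootAt P Γ p J i)) L k m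

lemma level_le (h : IsAlcovePath b lam Γ) (hp : p ∈ b.support) {i : Fin n}
    (hi : i ∈ posSet P p Γ J) : level b Γ J i ≤ ht b Γ p J i := by
  have hp' := Base.isPos_of_mem_support hp
  rcases mem_posSet_iff.mp hi with h1 | h1
  · rw [level_of_eq h hp' h1]
  · rw [level_of_eq_opp h hp' h1]; omega

lemma maxLevel_le (h : IsAlcovePath b lam Γ) (hp : p ∈ b.support) {L : ℤ}
    (hL : ∀ i ≤ n, ht b Γ p J i ≤ L) : maxLevel b lam p Γ J ≤ L := by
  classical
  rw [maxLevel]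
  refine Finset.max'_le _ _ _ fun y hy => ?_
  rcases Finset.mem_insert.mp hy with rfl | hy
  · have h2 : (ht b Γ p J n : ℝ) ≤ L := by exact_mod_cast hL n le_rfl
    by_cases hs : b.IsPos (pullback P Γ p J n).1
    · rwa [levelInf_of_pos h hs]
    · rw [levelInf_of_not_pos h hs]; linarith
  · obtain ⟨i, hi, rfl⟩ := Finset.mem_image.mp hy
    exact_mod_cast (level_le h hp hi).trans (hL i i.2.le)

lemma level_le_maxLevel {i : Fin n} (hi : i ∈ posSet P p Γ J) :
    (level b Γ J i : ℝ) ≤ maxLevel b lam p Γ J := by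
  classical
  rw [maxLevel]
  exact Finset.le_max' _ _ (Finset.mem_insert_of_mem
    (Finset.mem_image_of_mem (fun i : Fin n => (level b Γ J i : ℝ)) hi))

lemma levelInf_le_maxLevel : levelInf P lam p Γ J ≤ maxLevel b lam p Γ J := by
  classical
  rw [maxLevel]
  exact Finset.le_max' _ _ (Finset.mem_insert_self _ _)

/-- The maximal height is attained as the level l_m if m is a position, and as l_∞^p if m = n, where
the final sign is positive. -/
lemma IsTurn.le_maxLevel (h : IsAlcovePath b lam Γ) (hp : p ∈ b.support) {L : ℤ} {k : Fin n}
    {m : ℕ} (H : IsPathTurn b Γ p J L k m) : L ≤ maxLevel b lam p Γ J := by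
  rcases H.le.lt_or_eq with hm | hm
  · have h1 := (H.fold hm).1
    have h2 : ((⟨m, hm⟩ : Fin n)) ∈ posSet P p Γ J :=
      mem_posSet_iff.mpr (Or.inl (by rw [pullback_fst]; exact h1))
    have h3 := level_le_maxLevel (b := b) (lam := lam) h2
    rw [level_of_eq h (Base.isPos_of_mem_support hp) (by rw [pullback_fst]; exact h1),
      (H.mid m H.lt le_rfl).1] at h3
    exact h3
  · obtain ⟨h1, h2⟩ := H.mid n (by have := H.lt; omega) hm.ge
    have h3 := levelInf_le_maxLevel (b := b) (lam := lam) (p := p) (Γ := Γ) (J := J)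
    rwa [levelInf_of_pos h (by rw [pullback_fst]; exact h2), h1] at h3

open scoped Classical in
lemma rootF_eq_none (h : IsAlcovePath b lam Γ) (hp : p ∈ b.support)
    (hL : ∀ i ≤ n, ht b Γ p J i ≤ 0) : rootF b lam p Γ J = none := by
  have := maxLevel_le h hp hL
  rw [rootF, if_neg]
  push_cast at this
  linarith

open scoped Classical in
lemma rootF_eq_some (h : IsAlcovePath b lam Γ) (hp : p ∈ b.support) {L : ℤ}
    (hL : ∀ i ≤ n, ht b Γ p J i ≤ L) (hpos : 0 < L) {k : Fin n} {m : ℕ}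
    (H : IsPathTurn b Γ p J L k m) : rootF b lam p Γ J = some (moveFold J k m) := by
  have hp' := Base.isPos_of_mem_support hp
  have hmax : maxLevel b lam p Γ J = L := le_antisymm (maxLevel_le h hp hL) (H.le_maxLevel h hp)
  have hmF : mF b lam p Γ J = if hm : m < n then ((⟨m, hm⟩ : Fin n) : WithTop (Fin n)) else ⊤ := by
    have hge : ∀ i ∈ (posSet P p Γ J).filter
        fun i : Fin n => (level b Γ J i : ℝ) = maxLevel b lam p Γ J, m ≤ (i : ℕ) := by
      intro i hi
      obtain ⟨h1, h2⟩ := Finset.mem_filter.mp hi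
      rw [hmax] at h2
      have h2 : level b Γ J i = L := by exact_mod_cast h2
      have h3 := hL i i.2.le
      have h4 := level_le h hp h1
      by_contra hlt
      -- Up to k the height, hence also the level, is below L; strictly between k and m no position
      -- belongs to I(J,p).
      by_cases hik : i ≤ k
      · have := H.ht_lt i hik; omega
      · have h5 := H.keep i (by omega) (by omega)
        rcases mem_posSet_iff.mp h1 with h6 | h6 <;> rw [pullback_fst] at h6
        · exact h5.1 h6
        · exact h5.2 h6
    rw [mF]
    split_ifs with hm
    · apply le_antisymm
      · apply Finset.min_le
        have h1 := (H.fold hm).1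
        rw [Finset.mem_filter]
        refine ⟨mem_posSet_iff.mpr (Or.inl (by rw [pullback_fst]; exact h1)), ?_⟩
        rw [level_of_eq h hp' (by rw [pullback_fst]; exact h1), hmax, (H.mid m H.lt le_rfl).1]
      · apply Finset.le_min
        intro i hi
        exact WithTop.coe_le_coe.mpr (Fin.le_def.mpr (hge i hi))
    · rw [Finset.min_eq_top, Finset.eq_empty_iff_forall_notMem]
      intro i hi
      have := hge i hi
      omega
  have hlt : ∀ i : Fin n, (i : WithTop (Fin n)) < mF b lam p Γ J ↔ (i : ℕ) < m := by
    intro i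
    rw [hmF]
    split_ifs with hm
    · rw [WithTop.coe_lt_coe, Fin.lt_def]
    · have := i.2
      exact iff_of_true (WithTop.coe_lt_top i) (by omega)
  have hne : ∀ i : Fin n, (i : WithTop (Fin n)) ≠ mF b lam p Γ J ↔ (i : ℕ) ≠ m := by
    intro i
    rw [hmF]
    split_ifs with hm
    · rw [Ne, WithTop.coe_inj, Fin.ext_iff]
    · have := i.2
      exact iff_of_true (WithTop.coe_ne_top) (by omega)
  have hkF : kF b lam p Γ J = ((k : Fin n) : WithBot (Fin n)) := by
    rw [kF]
    apply le_antisymm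
    · apply Finset.max_le
      intro i hi
      obtain ⟨h1, h2⟩ := Finset.mem_filter.mp hi
      rw [hlt] at h2
      rw [WithBot.coe_le_coe]
      by_contra hik
      have h5 := H.keep i (not_le.mp hik) h2
      rcases mem_posSet_iff.mp h1 with h6 | h6 <;> rw [pullback_fst] at h6
      · exact h5.1 h6
      · exact h5.2 h6
    · apply Finset.le_max
      rw [Finset.mem_filter, hlt]
      exact ⟨mem_posSet_iff.mpr (Or.inl (by rw [pullback_fst]; exact H.up)), H.lt⟩
  rw [rootF, if_pos (by rw [hmax]; exact_mod_cast hpos), hkF]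
  congr 1
  ext i
  simp only [hne, moveFold, Finset.mem_union, Finset.mem_filter, Finset.mem_univ, true_and,
    Finset.mem_singleton, WithBot.coe_inj]

variable {L : ℤ} {k : Fin n} {m : ℕ}

lemma weylAt_rootAt (i : ℕ) {β : ι} (h : rootAt P Γ p J i = β) :
    weylAt P Γ J i * refl P β = refl P p * weylAt P Γ J i := by
  have : act P (weylAt P Γ J i) β = p := by
    rw [← h, rootAt, ← Equiv.Perm.mul_apply, ← map_mul, mul_inv_cancel, map_one,
      Equiv.Perm.one_apply]
  rw [mul_refl, this]

/-- At k and at m the wall is orthogonal to α_p, so w s_β = s_p w there. The new fold at k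
introduces the factor s_p on the left, and the omission of the fold at m removes it. -/
lemma IsTurn.weylAt_moveFold (H : IsPathTurn b Γ p J L k m) (i : ℕ) (hi : i ≤ n) :
    weylAt P Γ (moveFold J k m) i =
      if (k : ℕ) < i ∧ i ≤ m then refl P p * weylAt P Γ J i else weylAt P Γ J i := by
  induction i with
  | zero => simp [weylAt_zero]
  | succ i ih =>
    have ih := ih (by omega)
    have hkm := H.lt
    by_cases c1 : i = k
    · subst c1
      rw [if_neg (by omega)] at ih
      rw [if_pos ⟨by omega, H.lt⟩, weylAt_succ_of_mem (mem_moveFold.mpr (Or.inr rfl)), ih,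
        weylAt_succ_of_notMem H.notMem, weylAt_rootAt _ H.up]
    by_cases c2 : i = m
    · subst c2
      obtain ⟨h1, h2, -⟩ := H.fold hi
      have h3 : (⟨i, hi⟩ : Fin n) ∉ moveFold J k i := by
        rw [mem_moveFold]; rintro (⟨-, h⟩ | h)
        · exact h rfl
        · exact c1 (congrArg Fin.val h)
      rw [if_pos ⟨H.lt, le_rfl⟩] at ih
      have h4 := weylAt_succ_of_notMem (P := P) (Γ := Γ) h3
      have h5 := weylAt_succ_of_mem (P := P) (Γ := Γ) h2
      have h6 := weylAt_rootAt _ h1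
      dsimp only at h4 h5 h6
      rw [if_neg (by omega), h4, ih, h5, h6]
    · have h0 : (⟨i, hi⟩ : Fin n) ∈ moveFold J k m ↔ (⟨i, hi⟩ : Fin n) ∈ J := by
        rw [mem_moveFold]
        constructor
        · rintro (h | h)
          · exact h.1
          · exact absurd (congrArg Fin.val h) c1
        · exact fun h => Or.inl ⟨h, c2⟩
      have h1 : ((k : ℕ) < i + 1 ∧ i + 1 ≤ m) ↔ ((k : ℕ) < i ∧ i ≤ m) := by omega
      simp only [h1]
      by_cases hJ : (⟨i, hi⟩ : Fin n) ∈ J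
      · have h4 := weylAt_succ_of_mem (P := P) (Γ := Γ) (h0.mpr hJ)
        have h5 := weylAt_succ_of_mem (P := P) (Γ := Γ) hJ
        dsimp only at h4 h5
        rw [h4, h5, ih]
        split_ifs
        · rw [mul_assoc]
        · rfl
      · have h4 := weylAt_succ_of_notMem (P := P) (Γ := Γ) (fun h => hJ (h0.mp h))
        have h5 := weylAt_succ_of_notMem (P := P) (Γ := Γ) hJ
        dsimp only at h4 h5
        rw [h4, h5, ih]

/-- Between k and m the sign is positive, so multiplication by s_p on the left adds one to every
length and keeps covers. The new fold at k is the cover w ⋖ s_p w. -/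
lemma IsTurn.isAdmissible (h : IsAlcovePath b lam Γ) (hp : p ∈ b.support)
    (hJ : IsAdmissible b Γ J) (H : IsPathTurn b Γ p J L k m) :
    IsAdmissible b Γ (moveFold J k m) := by
  rw [isAdmissible_iff h.pos]
  have hJ' := (isAdmissible_iff h.pos).mp hJ
  have hlen : ∀ i, (k : ℕ) < i → i ≤ m →
      length b (refl P p * weylAt P Γ J i) = length b (weylAt P Γ J i) + 1 := fun i h1 h2 =>
    length_refl_mul hp (H.mid i h1 h2).2
  intro i hi
  have hkm := H.lt
  rw [H.weylAt_moveFold _ i.2, H.weylAt_moveFold _ i.2.le]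
  by_cases c1 : i = k
  · subst c1
    rw [if_pos ⟨by omega, H.lt⟩, if_neg (by omega), hlen _ (by omega) H.lt,
      weylAt_succ_of_notMem H.notMem]
  · have c1' : (i : ℕ) ≠ k := fun h => c1 (Fin.ext h)
    obtain ⟨h1, h2⟩ := (mem_moveFold.mp hi).resolve_right c1
    have h3 := hJ' i h1
    by_cases c : (k : ℕ) < i ∧ (i : ℕ) ≤ m
    · rw [if_pos c, if_pos (by omega), hlen _ c.1 c.2, hlen _ (by omega) (by omega), h3]
    · rw [if_neg c, if_neg (by omega), h3]

end AlcoveModel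
end

/-! ### Chains of arcs: the integer combinatorics of dihedral groups and of Y_{q,a,b}. -/

noncomputable section

namespace AlcoveModel

/-- The sequence of arcs that belongs to the chain of elements of a dihedral group with the labels
in `K`: the reflection with label `j` sends the arc `c` to the arc `2j - 1 - c`, modulo `2q`, and
the length of the arc `c` is `|c|`. -/
structure IsArcPath (q : ℕ) (K : ℕ → Prop) (g : ℕ → ℤ) : Prop where
  mem : ∀ j ≤ q, -q ≤ g j ∧ g j ≤ q
  step : ∀ j < q, K (j + 1) → g (j + 1) = 2 * j + 1 - g j ∨ g (j + 1) = 2 * j + 1 - g j - 2 * q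
  length : ∀ j < q, K (j + 1) → |g (j + 1)| = |g j| + 1
  keep : ∀ j < q, ¬ K (j + 1) → g (j + 1) = g j

/-- The increasing chains from the arc `c` to the arc `d` whose labels are at most `i`. -/
def IsChainUpTo (q : ℕ) (i : ℕ) (c : ℤ) (K : ℕ → Prop) (d : ℤ) : Prop :=
  (0 ≤ c ∧ c ≤ d ∧ (d ≤ i ∨ d = c) ∧ ∀ x : ℕ, 1 ≤ x → x ≤ i → (K x ↔ c + 1 ≤ x ∧ x ≤ d)) ∨
  (0 ≤ c ∧ i = q ∧ c < -d ∧ -d ≤ q ∧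
    ∀ x : ℕ, 1 ≤ x → x ≤ i → (K x ↔ c + 1 ≤ x ∧ x < -d ∨ x = q)) ∨
  (c < 0 ∧ d = c ∧ ∀ x : ℕ, 1 ≤ x → x ≤ i → (K x ↔ False)) ∨
  (c < 0 ∧ d = c - 1 ∧ -d ≤ q ∧ q + c ≤ i ∧ ∀ x : ℕ, 1 ≤ x → x ≤ i → (K x ↔ (x : ℤ) = q + c)) ∨
  (c < 0 ∧ (-c < d ∧ d ≤ q) ∧ (d ≤ i ∨ d = -c + 1) ∧ 1 ≤ i ∧
    ∀ x : ℕ, 1 ≤ x → x ≤ i → (K x ↔ x = 1 ∨ -c + 2 ≤ x ∧ x ≤ d)) ∨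
  (c < 0 ∧ i = q ∧ -c + 1 < -d ∧ -d ≤ q ∧
    ∀ x : ℕ, 1 ≤ x → x ≤ i → (K x ↔ x = 1 ∨ -c + 2 ≤ x ∧ x < -d ∨ x = q))

/-- The length condition allows four steps. From g ≥ 0 they are label g + 1 to the arc g + 1, and
label q to −(g + 1). From g < 0 they are label 1 to −g + 1, and label q + g to g − 1. As labels
increase, after label q + g nothing can follow, so six shapes remain: a run; a run followed by q;
nothing; the single label q + g; label 1 and a run; label 1, a run, and q. -/
lemma IsArcPath.isChainUpTo {q : ℕ} {K : ℕ → Prop} {g : ℕ → ℤ} (h : IsArcPath q K g) (i : ℕ)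
    (hi : i ≤ q) : IsChainUpTo q i (g 0) K (g i) := by
  induction i with
  | zero =>
    rcases le_or_gt 0 (g 0) with h0 | h0
    · exact Or.inl ⟨h0, le_rfl, Or.inr rfl, fun x h1 h2 => by omega⟩
    · exact Or.inr (Or.inr (Or.inl ⟨h0, rfl, fun x h1 h2 => by omega⟩))
  | succ i ih =>
    have ih := ih (by omega)
    have hm := h.mem i (by omega)
    have hm' := h.mem (i + 1) hi
    have hm0 := h.mem 0 (by omega)
    have key : ∀ {A B : ℕ → Prop}, (∀ x : ℕ, 1 ≤ x → x ≤ i → (K x ↔ A x)) →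
        (∀ x : ℕ, 1 ≤ x → x ≤ i → (A x ↔ B x)) → (K (i + 1) ↔ B (i + 1)) →
        ∀ x : ℕ, 1 ≤ x → x ≤ i + 1 → (K x ↔ B x) := by
      intro A B h1 h2 h3 x hx hx'
      rcases hx'.lt_or_eq with hlt | rfl
      · exact (h1 x hx (by omega)).trans (h2 x hx (by omega))
      · exact h3
    by_cases hK : K (i + 1)
    · have hs := h.step i (by omega) hK
      have hl := h.length i (by omega) hK
      have hl : (0 ≤ g i ∧ (g (i + 1) = g i + 1 ∨ g (i + 1) = -(g i + 1))) ∨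
          (g i < 0 ∧ (g (i + 1) = -g i + 1 ∨ g (i + 1) = g i - 1)) := by
        rcases abs_cases (g (i + 1)) with ⟨h1, h2⟩ | ⟨h1, h2⟩ <;>
        rcases abs_cases (g i) with ⟨h3, h4⟩ | ⟨h3, h4⟩ <;> omega
      rcases ih with ⟨h1, h2, h3, h4⟩ | ⟨h1, h2, h3, h4, h5⟩ | ⟨h1, h2, h3⟩ | ⟨h1, h2, h3, h4, h5⟩ |
        ⟨h1, h2, h3, h4, h5⟩ | ⟨h1, h2, h3, h4, h5⟩
      · rcases hl with ⟨hl1, hl2 | hl2⟩ | hl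
        · refine Or.inl ⟨h1, by omega, by omega, key h4 ?_ (iff_of_true hK (by push_cast; omega))⟩
          intro x hx hx'; omega
        · refine Or.inr (Or.inl ⟨h1, by omega, by omega, by omega,
            key h4 ?_ (iff_of_true hK (by omega))⟩)
          intro x hx hx'; omega
        · omega
      · omega
      · rcases hl with hl | ⟨hl1, hl2 | hl2⟩
        · omega
        · refine Or.inr (Or.inr (Or.inr (Or.inr (Or.inl ⟨h1, by omega, by omega, by omega,
            key h3 ?_ (iff_of_true hK (by omega))⟩))))
          intro x hx hx'; omega
        · refine Or.inr (Or.inr (Or.inr (Or.inl ⟨h1, by omega, by omega, by omega,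
            key h3 ?_ (iff_of_true hK (by push_cast; omega))⟩)))
          exact fun x hx hx' => ⟨False.elim, fun h => by omega⟩
      · omega
      · rcases hl with ⟨hl1, hl2 | hl2⟩ | hl
        · refine Or.inr (Or.inr (Or.inr (Or.inr (Or.inl ⟨h1, by omega, by omega, by omega,
            key h5 ?_ (iff_of_true hK (by push_cast; omega))⟩))))
          intro x hx hx'; omega
        · refine Or.inr (Or.inr (Or.inr (Or.inr (Or.inr ⟨h1, by omega, by omega, by omega,
            key h5 ?_ (iff_of_true hK (by omega))⟩))))
          intro x hx hx'; omega
        · omega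
      · omega
    · have hs := h.keep i (by omega) hK
      rw [hs]
      rcases ih with ⟨h1, h2, h3, h4⟩ | ⟨h1, h2, h3, h4, h5⟩ | ⟨h1, h2, h3⟩ | ⟨h1, h2, h3, h4, h5⟩ |
        ⟨h1, h2, h3, h4, h5⟩ | ⟨h1, h2, h3, h4, h5⟩
      · exact Or.inl ⟨h1, h2, by omega, key h4 (fun _ _ _ => Iff.rfl)
          (iff_of_false hK (by push_cast; omega))⟩
      · omega
      · refine Or.inr (Or.inr (Or.inl ⟨h1, h2, key h3 (fun _ _ _ => Iff.rfl)
          (iff_of_false hK id)⟩))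
      · exact Or.inr (Or.inr (Or.inr (Or.inl ⟨h1, h2, h3, by omega, key h5 (fun _ _ _ => Iff.rfl)
          (iff_of_false hK (by push_cast; omega))⟩)))
      · exact Or.inr (Or.inr (Or.inr (Or.inr (Or.inl ⟨h1, h2, by omega, by omega,
          key h5 (fun _ _ _ => Iff.rfl) (iff_of_false hK (by push_cast; omega))⟩))))
      · omega

/-- The increasing chains from the arc `c` to the arc `d`. -/
abbrev IsChain (q : ℕ) (c : ℤ) (K : ℕ → Prop) (d : ℤ) : Prop := IsChainUpTo q q c K d

/-- The signs and sizes of c and d select the shape. The arcs q and −q must be allowed to replace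
one another, because they describe the same half of the cycle, that of the negative roots; a run
ending in q has both readings. -/
lemma IsChain.unique {q : ℕ} {c d d' : ℤ} {K K' : ℕ → Prop} (h : IsChain q c K d)
    (h' : IsChain q c K' d') (hc : -q ≤ c ∧ c ≤ q) (hd : d = d' ∨ |d| = q ∧ |d'| = q) {x : ℕ}
    (hx : 1 ≤ x) (hx' : x ≤ q) : K x ↔ K' x := by
  have hd : d = d' ∨ (d = q ∨ d = -q) ∧ (d' = q ∨ d' = -q) := by
    rcases abs_cases d with ⟨h1, h2⟩ | ⟨h1, h2⟩ <;>
    rcases abs_cases d' with ⟨h3, h4⟩ | ⟨h3, h4⟩ <;> omega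
  have key : ∀ {A B : ℕ → Prop}, (∀ x : ℕ, 1 ≤ x → x ≤ q → (K x ↔ A x)) →
        (∀ x : ℕ, 1 ≤ x → x ≤ q → (K' x ↔ B x)) → (A x ↔ B x) → (K x ↔ K' x) :=
    fun h1 h2 h3 => (h1 x hx hx').trans (h3.trans (h2 x hx hx').symm)
  rcases h with ⟨h1, h2, h3, h4⟩ | ⟨h1, h2, h3, h0, h4⟩ | ⟨h1, h2, h4⟩ | ⟨h1, h2, h3, h0, h4⟩ |
        ⟨h1, h2, h3, h0, h4⟩ | ⟨h1, h2, h3, h0, h4⟩ <;>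
  rcases h' with ⟨k1, k2, k3, k4⟩ | ⟨k1, k2, k3, k0, k4⟩ | ⟨k1, k2, k4⟩ | ⟨k1, k2, k3, k0, k4⟩ |
        ⟨k1, k2, k3, k0, k4⟩ | ⟨k1, k2, k3, k0, k4⟩ <;>
  first
  | omega
  | exact key h4 k4 (by omega)
  | exact (h4 x hx hx').trans (k4 x hx hx').symm

lemma isArcPath_of_abs {q : ℕ} {K : ℕ → Prop} {g : ℕ → ℤ}
    (mem : ∀ j ≤ q, -q ≤ g j ∧ g j ≤ q)
    (step : ∀ j < q, K (j + 1) →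
      (g (j + 1) = 2 * j + 1 - g j ∨ g (j + 1) = 2 * j + 1 - g j - 2 * q) ∧
      ((0 ≤ g j ∧ (g (j + 1) = g j + 1 ∨ g (j + 1) = -(g j + 1))) ∨
          (g j < 0 ∧ (g (j + 1) = -g j + 1 ∨ g (j + 1) = g j - 1))))
    (keep : ∀ j < q, ¬ K (j + 1) → g (j + 1) = g j) : IsArcPath q K g where
  mem := mem
  step j hj hK := (step j hj hK).1
  length j hj hK := by
    have := (step j hj hK).2
    rcases abs_cases (g (j + 1)) with ⟨h1, h2⟩ | ⟨h1, h2⟩ <;>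
    rcases abs_cases (g j) with ⟨h3, h4⟩ | ⟨h3, h4⟩ <;> omega
  keep := keep

/-- A run of labels is realised by clamping the time j to the interval of the run; the labels 1 and
q and a single label are added as jumps. -/
lemma IsChain.exists_isArcPath {q : ℕ} {c d : ℤ} {K : ℕ → Prop} (h : IsChain q c K d)
    (hc : -q ≤ c ∧ c ≤ q) (hq : 0 < q) : ∃ g, IsArcPath q K g ∧ g 0 = c ∧ g q = d := by
  rcases h with ⟨h1, h2, h3, h4⟩ | ⟨h1, h2, h3, h0, h4⟩ | ⟨h1, h2, h4⟩ | ⟨h1, h2, h3, h0, h4⟩ |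
        ⟨h1, h2, h3, h0, h4⟩ | ⟨h1, h2, h3, h0, h4⟩
  · refine ⟨fun j => max c (min j d), isArcPath_of_abs ?_ ?_ ?_, ?_, ?_⟩
    · intro j hj; omega
    · intro j hj hK; rw [h4 _ (by omega) (by omega)] at hK; push_cast at hK ⊢; omega
    · intro j hj hK; rw [h4 _ (by omega) (by omega)] at hK; push_cast at hK ⊢; omega
    · dsimp only; omega
    · dsimp only; omega
  · refine ⟨fun j => if j = q then d else max c (min j (-d - 1)), isArcPath_of_abs ?_ ?_ ?_, ?_, ?_⟩
    · intro j hj; split_ifs <;> omega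
    · intro j hj hK; rw [h4 _ (by omega) (by omega)] at hK; push_cast at hK ⊢
      split_ifs <;> omega
    · intro j hj hK; rw [h4 _ (by omega) (by omega)] at hK; push_cast at hK ⊢
      split_ifs <;> omega
    · dsimp only; split_ifs <;> omega
    · dsimp only; split_ifs <;> omega
  · refine ⟨fun j => c, isArcPath_of_abs ?_ ?_ ?_, rfl, h2.symm⟩
    · intro j hj; exact hc
    · intro j hj hK; exact ((h4 _ (by omega) (by omega)).mp hK).elim
    · intro j hj hK; rfl
  · refine ⟨fun j => if j < q + c then c else d, isArcPath_of_abs ?_ ?_ ?_, ?_, ?_⟩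
    · intro j hj; split_ifs <;> omega
    · intro j hj hK; rw [h4 _ (by omega) (by omega)] at hK; push_cast at hK ⊢
      split_ifs <;> omega
    · intro j hj hK; rw [h4 _ (by omega) (by omega)] at hK; push_cast at hK ⊢
      split_ifs <;> omega
    · dsimp only; split_ifs <;> omega
    · dsimp only; split_ifs <;> omega
  · refine ⟨fun j => if j = 0 then c else max (-c + 1) (min j d), isArcPath_of_abs ?_ ?_ ?_, ?_, ?_⟩
    · intro j hj; split_ifs <;> omega
    · intro j hj hK; rw [h4 _ (by omega) (by omega)] at hK; push_cast at hK ⊢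
      split_ifs <;> omega
    · intro j hj hK; rw [h4 _ (by omega) (by omega)] at hK; push_cast at hK ⊢
      split_ifs <;> omega
    · dsimp only; split_ifs <;> omega
    · dsimp only; split_ifs <;> omega
  · refine ⟨fun j => if j = 0 then c else if j = q then d else max (-c + 1) (min j (-d - 1)),
      isArcPath_of_abs ?_ ?_ ?_, ?_, ?_⟩
    · intro j hj; split_ifs <;> omega
    · intro j hj hK; rw [h4 _ (by omega) (by omega)] at hK; push_cast at hK ⊢
      split_ifs <;> omega
    · intro j hj hK; rw [h4 _ (by omega) (by omega)] at hK; push_cast at hK ⊢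
      split_ifs <;> omega
    · dsimp only; split_ifs <;> omega
    · dsimp only; split_ifs <;> omega

lemma IsChain.le {q : ℕ} {c d : ℤ} {K : ℕ → Prop} (h : IsChain q c K d) (hc : -q ≤ c ∧ c ≤ q) :
    -q ≤ d ∧ d ≤ q := by
  rcases h with ⟨h1, h2, h3, h4⟩ | ⟨h1, h2, h3, h0, h4⟩ | ⟨h1, h2, h4⟩ | ⟨h1, h2, h3, h0, h4⟩ |
        ⟨h1, h2, h3, h0, h4⟩ | ⟨h1, h2, h3, h0, h4⟩ <;> omega

/-- Any two arcs of different lengths, the lengths increasing by the number of steps, are joined by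
an increasing chain. -/
lemma exists_isChain {q : ℕ} {c d : ℤ} (hc : -q ≤ c ∧ c ≤ q) (hd : -q ≤ d ∧ d ≤ q)
    (h : |c| < |d|) : ∃ K, IsChain q c K d := by
  have h : c < d ∧ -c < d ∨ c < -d ∧ -c < -d := by
    rcases abs_cases c with ⟨h1, h2⟩ | ⟨h1, h2⟩ <;>
    rcases abs_cases d with ⟨h3, h4⟩ | ⟨h3, h4⟩ <;> omega
  rcases le_or_gt 0 c with h0 | h0
  · by_cases h1 : c ≤ d
    · exact ⟨_, Or.inl ⟨h0, h1, by omega, fun _ _ _ => Iff.rfl⟩⟩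
    · exact ⟨_, Or.inr (Or.inl ⟨h0, rfl, by omega, by omega, fun _ _ _ => Iff.rfl⟩)⟩
  · by_cases h1 : -c < d
    · exact ⟨_, Or.inr (Or.inr (Or.inr (Or.inr (Or.inl ⟨h0, by omega, by omega, by omega,
        fun _ _ _ => Iff.rfl⟩))))⟩
    · by_cases h2 : d = c - 1
      · exact ⟨_, Or.inr (Or.inr (Or.inr (Or.inl ⟨h0, h2, by omega, by omega,
          fun _ _ _ => Iff.rfl⟩)))⟩
      · exact ⟨_, Or.inr (Or.inr (Or.inr (Or.inr (Or.inr ⟨h0, rfl, by omega, by omega,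
          fun _ _ _ => Iff.rfl⟩))))⟩

/-- `K` is the set of those elements of `{1, …, q}` that satisfy `A`. -/
def EqOn (q : ℕ) (K : Finset ℕ) (A : ℕ → Prop) : Prop := ∀ x, 1 ≤ x → x ≤ q → (x ∈ K ↔ A x)

/-- Replacing equalities of finite sets by pointwise conditions on {1, …, q} makes the overlaps of
the defining cases a matter of linear arithmetic. -/
lemma ybInvolution_cases {q : ℕ} (a b : ℕ) {K : Finset ℕ} (hK : ∀ x ∈ K, 1 ≤ x ∧ x ≤ q)
    (hq : 2 ≤ q) :
    (a + 1 = b ∧ b ≤ q ∧ EqOn q K (fun x => x = 1) ∧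
      EqOn q (ybInvolution q a b K) (fun x => x = q)) ∨
    (a + 1 = b ∧ b ≤ q ∧ EqOn q K (fun x => x = q) ∧
      EqOn q (ybInvolution q a b K) (fun x => x = 1)) ∨
    (0 < a ∧ a + 1 = b ∧ b < q ∧ EqOn q K (fun x => x = q - a) ∧
      EqOn q (ybInvolution q a b K) (fun x => x = a + 1)) ∨
    (0 < a ∧ a + 1 = b ∧ b < q ∧ EqOn q K (fun x => x = a + 1) ∧
      EqOn q (ybInvolution q a b K) (fun x => x = q - a)) ∨
    (a + 2 ≤ b ∧ b < q ∧ EqOn q K (fun x => x = 1 ∨ a + 2 ≤ x ∧ x ≤ b) ∧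
      EqOn q (ybInvolution q a b K) (fun x => a + 1 ≤ x ∧ x ≤ b - 1 ∨ x = q)) ∨
    (a + 2 ≤ b ∧ b < q ∧ EqOn q K (fun x => a + 1 ≤ x ∧ x ≤ b - 1 ∨ x = q) ∧
      EqOn q (ybInvolution q a b K) (fun x => x = 1 ∨ a + 2 ≤ x ∧ x ≤ b)) ∨
    (0 < a ∧ a + 2 ≤ b ∧ b ≤ q ∧ EqOn q K (fun x => (x = 1 ∨ a + 2 ≤ x ∧ x ≤ b - 1) ∨ x = q) ∧
      EqOn q (ybInvolution q a b K) (fun x => a + 1 ≤ x ∧ x ≤ b)) ∨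
    (0 < a ∧ a + 2 ≤ b ∧ b ≤ q ∧ EqOn q K (fun x => a + 1 ≤ x ∧ x ≤ b) ∧
      EqOn q (ybInvolution q a b K) (fun x => (x = 1 ∨ a + 2 ≤ x ∧ x ≤ b - 1) ∨ x = q)) ∨
    ((a + 1 = b ∧ b ≤ q → ¬ EqOn q K (fun x => x = 1)) ∧
      (a + 1 = b ∧ b ≤ q → ¬ EqOn q K (fun x => x = q)) ∧
      (0 < a ∧ a + 1 = b ∧ b < q → ¬ EqOn q K (fun x => x = q - a)) ∧
      (0 < a ∧ a + 1 = b ∧ b < q → ¬ EqOn q K (fun x => x = a + 1)) ∧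
      (a + 2 ≤ b ∧ b < q → ¬ EqOn q K (fun x => x = 1 ∨ a + 2 ≤ x ∧ x ≤ b)) ∧
      (a + 2 ≤ b ∧ b < q → ¬ EqOn q K (fun x => a + 1 ≤ x ∧ x ≤ b - 1 ∨ x = q)) ∧
      (0 < a ∧ a + 2 ≤ b ∧ b ≤ q → ¬ EqOn q K (fun x => (x = 1 ∨ a + 2 ≤ x ∧ x ≤ b - 1) ∨ x = q)) ∧
      (0 < a ∧ a + 2 ≤ b ∧ b ≤ q → ¬ EqOn q K (fun x => a + 1 ≤ x ∧ x ≤ b)) ∧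
      ybInvolution q a b K = K) := by
  have ext : ∀ {X : Finset ℕ}, (∀ x ∈ X, 1 ≤ x ∧ x ≤ q) → ∀ {A : ℕ → Prop},
      (∀ x, x ∈ X ↔ A x) → EqOn q K A → K = X := fun {X} hX {A} hA hKX => by
    ext x
    rw [hA]
    refine ⟨fun hx => (hKX x (hK x hx).1 (hK x hx).2).mp hx, fun hx => ?_⟩
    have := hX x ((hA x).mpr hx)
    exact (hKX x this.1 this.2).mpr hx
  rw [ybInvolution]
  split_ifs with h1 h2 h3 h4 h5 h6 h7 h8
  · obtain ⟨i0, i1, e⟩ := h1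
    exact Or.inl ⟨i0, i1, fun x _ _ => by rw [e]; simp only [Finset.mem_union, Finset.mem_singleton, Finset.mem_Icc],
      fun x _ _ => by simp only [Finset.mem_union, Finset.mem_singleton, Finset.mem_Icc]⟩
  · obtain ⟨i0, i1, e⟩ := h2
    exact Or.inr (Or.inl ⟨i0, i1, fun x _ _ => by rw [e]; simp only [Finset.mem_union, Finset.mem_singleton, Finset.mem_Icc],
      fun x _ _ => by simp only [Finset.mem_union, Finset.mem_singleton, Finset.mem_Icc]⟩)
  · obtain ⟨i0, i1, i2, e⟩ := h3
    exact Or.inr (Or.inr (Or.inl ⟨i0, i1, i2, fun x _ _ => by rw [e]; simp only [Finset.mem_union, Finset.mem_singleton, Finset.mem_Icc],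
      fun x _ _ => by simp only [Finset.mem_union, Finset.mem_singleton, Finset.mem_Icc]⟩))
  · obtain ⟨i0, i1, i2, e⟩ := h4
    exact Or.inr (Or.inr (Or.inr (Or.inl ⟨i0, i1, i2, fun x _ _ => by rw [e]; simp only [Finset.mem_union, Finset.mem_singleton, Finset.mem_Icc],
      fun x _ _ => by simp only [Finset.mem_union, Finset.mem_singleton, Finset.mem_Icc]⟩)))
  · obtain ⟨i0, i1, e⟩ := h5
    exact Or.inr (Or.inr (Or.inr (Or.inr (Or.inl ⟨i0, i1, fun x _ _ => by rw [e]; simp only [Finset.mem_union, Finset.mem_singleton, Finset.mem_Icc],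
      fun x _ _ => by simp only [Finset.mem_union, Finset.mem_singleton, Finset.mem_Icc]⟩))))
  · obtain ⟨i0, i1, e⟩ := h6
    exact Or.inr (Or.inr (Or.inr (Or.inr (Or.inr (Or.inl ⟨i0, i1, fun x _ _ => by rw [e]; simp only [Finset.mem_union, Finset.mem_singleton, Finset.mem_Icc],
      fun x _ _ => by simp only [Finset.mem_union, Finset.mem_singleton, Finset.mem_Icc]⟩)))))
  · obtain ⟨i0, i1, i2, e⟩ := h7
    exact Or.inr (Or.inr (Or.inr (Or.inr (Or.inr (Or.inr (Or.inl ⟨i0, i1, i2, fun x _ _ => by rw [e]; simp only [Finset.mem_union, Finset.mem_singleton, Finset.mem_Icc],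
      fun x _ _ => by simp only [Finset.mem_union, Finset.mem_singleton, Finset.mem_Icc]⟩))))))
  · obtain ⟨i0, i1, i2, e⟩ := h8
    exact Or.inr (Or.inr (Or.inr (Or.inr (Or.inr (Or.inr (Or.inr (Or.inl ⟨i0, i1, i2, fun x _ _ => by rw [e]; simp only [Finset.mem_union, Finset.mem_singleton, Finset.mem_Icc],
      fun x _ _ => by simp only [Finset.mem_union, Finset.mem_singleton, Finset.mem_Icc]⟩)))))))
  · refine Or.inr (Or.inr (Or.inr (Or.inr (Or.inr (Or.inr (Or.inr (Or.inr (⟨fun hA hx => ?_, fun hA hx => ?_, fun hA hx => ?_, fun hA hx => ?_, fun hA hx => ?_, fun hA hx => ?_, fun hA hx => ?_, fun hA hx => ?_, rfl⟩))))))))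
    · refine h1 ⟨hA.1, hA.2, ext (fun x hx => ?_) (fun x => ?_) hx⟩
      · simp only [Finset.mem_union, Finset.mem_singleton, Finset.mem_Icc] at hx; omega
      · simp only [Finset.mem_union, Finset.mem_singleton, Finset.mem_Icc]
    · refine h2 ⟨hA.1, hA.2, ext (fun x hx => ?_) (fun x => ?_) hx⟩
      · simp only [Finset.mem_union, Finset.mem_singleton, Finset.mem_Icc] at hx; omega
      · simp only [Finset.mem_union, Finset.mem_singleton, Finset.mem_Icc]
    · refine h3 ⟨hA.1, hA.2.1, hA.2.2, ext (fun x hx => ?_) (fun x => ?_) hx⟩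
      · simp only [Finset.mem_union, Finset.mem_singleton, Finset.mem_Icc] at hx; omega
      · simp only [Finset.mem_union, Finset.mem_singleton, Finset.mem_Icc]
    · refine h4 ⟨hA.1, hA.2.1, hA.2.2, ext (fun x hx => ?_) (fun x => ?_) hx⟩
      · simp only [Finset.mem_union, Finset.mem_singleton, Finset.mem_Icc] at hx; omega
      · simp only [Finset.mem_union, Finset.mem_singleton, Finset.mem_Icc]
    · refine h5 ⟨hA.1, hA.2, ext (fun x hx => ?_) (fun x => ?_) hx⟩
      · simp only [Finset.mem_union, Finset.mem_singleton, Finset.mem_Icc] at hx; omega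
      · simp only [Finset.mem_union, Finset.mem_singleton, Finset.mem_Icc]
    · refine h6 ⟨hA.1, hA.2, ext (fun x hx => ?_) (fun x => ?_) hx⟩
      · simp only [Finset.mem_union, Finset.mem_singleton, Finset.mem_Icc] at hx; omega
      · simp only [Finset.mem_union, Finset.mem_singleton, Finset.mem_Icc]
    · refine h7 ⟨hA.1, hA.2.1, hA.2.2, ext (fun x hx => ?_) (fun x => ?_) hx⟩
      · simp only [Finset.mem_union, Finset.mem_singleton, Finset.mem_Icc] at hx; omega
      · simp only [Finset.mem_union, Finset.mem_singleton, Finset.mem_Icc]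
    · refine h8 ⟨hA.1, hA.2.1, hA.2.2, ext (fun x hx => ?_) (fun x => ?_) hx⟩
      · simp only [Finset.mem_union, Finset.mem_singleton, Finset.mem_Icc] at hx; omega
      · simp only [Finset.mem_union, Finset.mem_singleton, Finset.mem_Icc]

section Forms

variable {q a b : ℕ} {X : Finset ℕ}

lemma IsChain.of_increasing (h : a ≤ b) (hb : b ≤ q)
    (hX : EqOn q X fun x => a + 1 ≤ x ∧ x ≤ b) : IsChain q a (· ∈ X) b :=
  Or.inl ⟨by omega, by omega, by omega, fun x h1 h2 => (hX x h1 h2).trans (by omega)⟩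

lemma IsChain.of_increasing_last (h : a < b) (hb : b ≤ q)
    (hX : EqOn q X fun x => a + 1 ≤ x ∧ x ≤ b - 1 ∨ x = q) : IsChain q a (· ∈ X) (-b) :=
  Or.inr (Or.inl ⟨by omega, rfl, by omega, by omega, fun x h1 h2 => (hX x h1 h2).trans (by omega)⟩)

lemma IsChain.of_empty (ha : 0 < a) (hX : EqOn q X fun _ => False) :
    IsChain q (-a) (· ∈ X) (-a) :=
  Or.inr (Or.inr (Or.inl ⟨by omega, rfl, hX⟩))

lemma IsChain.of_single (ha : 0 < a) (hb : b = a + 1) (hq : b ≤ q)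
    (hX : EqOn q X fun x => x = q - a) : IsChain q (-a) (· ∈ X) (-b) :=
  Or.inr (Or.inr (Or.inr (Or.inl ⟨by omega, by omega, by omega, by omega,
    fun x h1 h2 => (hX x h1 h2).trans (by omega)⟩)))

lemma IsChain.of_first (ha : 0 < a) (h : a < b) (hb : b ≤ q)
    (hX : EqOn q X fun x => x = 1 ∨ a + 2 ≤ x ∧ x ≤ b) : IsChain q (-a) (· ∈ X) b :=
  Or.inr (Or.inr (Or.inr (Or.inr (Or.inl ⟨by omega, by omega, by omega, by omega,
    fun x h1 h2 => (hX x h1 h2).trans (by omega)⟩))))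

lemma IsChain.of_first_last (ha : 0 < a) (h : a + 1 < b) (hb : b ≤ q)
    (hX : EqOn q X fun x => (x = 1 ∨ a + 2 ≤ x ∧ x ≤ b - 1) ∨ x = q) :
    IsChain q (-a) (· ∈ X) (-b) :=
  Or.inr (Or.inr (Or.inr (Or.inr (Or.inr ⟨by omega, rfl, by omega, by omega,
    fun x h1 h2 => (hX x h1 h2).trans (by omega)⟩))))

lemma EqOn.congr {K : Finset ℕ} {A B : ℕ → Prop} (h : EqOn q K A)
    (hAB : ∀ x, 1 ≤ x → x ≤ q → (A x ↔ B x)) : EqOn q K B :=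
  fun x h1 h2 => (h x h1 h2).trans (hAB x h1 h2)

lemma EqOn.iff {K : Finset ℕ} {A B : ℕ → Prop} (h : EqOn q K A) (h' : EqOn q K B) (x : ℕ)
    (h1 : 1 ≤ x) (h2 : x ≤ q) : A x ↔ B x :=
  (h x h1 h2).symm.trans (h' x h1 h2)

variable {K : Finset ℕ}

/-- For extreme values of a and b, one set of labels can match several cases of the involution, for
instance {1} when a = 0 and b = 1. So every case is either excluded or shown to have an image of the
required shape. -/
lemma ybInvolution_of_increasing (hK : ∀ x ∈ K, 1 ≤ x ∧ x ≤ q) (hq : 2 ≤ q) (hab : a < b)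
    (hb : b ≤ q) (h : EqOn q K fun x => a + 1 ≤ x ∧ x ≤ b) :
    IsChain q (-a) (· ∈ ybInvolution q a b K) (-b) := by
  rcases ybInvolution_cases a b hK hq with hy | hy | hy | hy | hy | hy | hy | hy | hy
  · obtain ⟨i1, i2, e, e'⟩ := hy
    -- Comparing the two descriptions of K at the test labels 1, q, a + 1 and b determines a and b
    -- or refutes the case.
    have g1 := e.iff h 1 (by omega) (by omega)
    have gq := e.iff h q (by omega) (by omega)
    have ga := e.iff h (a + 1) (by omega) (by omega)
    have gb := e.iff h b (by omega) (by omega)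
    obtain rfl : a = 0 := by omega
    rw [Nat.cast_zero, neg_zero]
    exact IsChain.of_increasing_last (a := 0) (by omega) (by omega) (e'.congr (by omega))
  · obtain ⟨i1, i2, e, e'⟩ := hy
    have g1 := e.iff h 1 (by omega) (by omega)
    have gq := e.iff h q (by omega) (by omega)
    have ga := e.iff h (a + 1) (by omega) (by omega)
    have gb := e.iff h b (by omega) (by omega)
    exact .of_single (by omega) (by omega) (by omega) (e'.congr (by omega))
  · obtain ⟨i0, i1, i2, e, e'⟩ := hy
    have g1 := e.iff h 1 (by omega) (by omega)
    have gq := e.iff h q (by omega) (by omega)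
    have ga := e.iff h (a + 1) (by omega) (by omega)
    have gb := e.iff h b (by omega) (by omega)
    exact .of_single (by omega) (by omega) (by omega) (e'.congr (by omega))
  · obtain ⟨i0, i1, i2, e, e'⟩ := hy
    have g1 := e.iff h 1 (by omega) (by omega)
    have gq := e.iff h q (by omega) (by omega)
    have ga := e.iff h (a + 1) (by omega) (by omega)
    have gb := e.iff h b (by omega) (by omega)
    exact .of_single (by omega) (by omega) (by omega) (e'.congr (by omega))
  · obtain ⟨i1, i2, e, e'⟩ := hy
    have g1 := e.iff h 1 (by omega) (by omega)
    have gq := e.iff h q (by omega) (by omega)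
    have ga := e.iff h (a + 1) (by omega) (by omega)
    have gb := e.iff h b (by omega) (by omega)
    obtain rfl : a = 0 := by omega
    rw [Nat.cast_zero, neg_zero]
    exact IsChain.of_increasing_last (a := 0) (by omega) (by omega) (e'.congr (by omega))
  · obtain ⟨i1, i2, e, e'⟩ := hy
    have g1 := e.iff h 1 (by omega) (by omega)
    have gq := e.iff h q (by omega) (by omega)
    have ga := e.iff h (a + 1) (by omega) (by omega)
    have gb := e.iff h b (by omega) (by omega)
    omega
  · obtain ⟨i0, i1, i2, e, e'⟩ := hy
    have g1 := e.iff h 1 (by omega) (by omega)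
    have gq := e.iff h q (by omega) (by omega)
    have ga := e.iff h (a + 1) (by omega) (by omega)
    have gb := e.iff h b (by omega) (by omega)
    omega
  · obtain ⟨i0, i1, i2, e, e'⟩ := hy
    have g1 := e.iff h 1 (by omega) (by omega)
    have gq := e.iff h q (by omega) (by omega)
    have ga := e.iff h (a + 1) (by omega) (by omega)
    have gb := e.iff h b (by omega) (by omega)
    exact .of_first_last (by omega) (by omega) (by omega) (e'.congr (by omega))
  · obtain ⟨no1, no2, no3, no4, no5, no6, no7, no8, hyK⟩ := hy
    rw [hyK]
    by_cases c2 : b = a + 1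
    · by_cases c0 : a = 0
      · exact (no1 (by omega) (h.congr (by omega))).elim
      · by_cases c3 : b = q
        · exact (no2 (by omega) (h.congr (by omega))).elim
        · exact (no4 (by omega) (h.congr (by omega))).elim
    · by_cases c0 : a = 0
      · subst c0
        by_cases c3 : b = q
        · rw [Nat.cast_zero, neg_zero]
          -- For a = 0 and b = q the full set of labels is fixed; it is also the run 1, …, q − 1
          -- followed by q, which leads to the arc −q.
          exact IsChain.of_increasing_last (a := 0) (by omega) (by omega) (h.congr (by omega))
        · exact (no5 (by omega) (h.congr (by omega))).elim
      · exact (no8 (by omega) (h.congr (by omega))).elim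

lemma ybInvolution_of_increasing_last (hK : ∀ x ∈ K, 1 ≤ x ∧ x ≤ q) (hq : 2 ≤ q) (hab : a < b)
    (hb : b ≤ q) (h : EqOn q K fun x => a + 1 ≤ x ∧ x ≤ b - 1 ∨ x = q) :
    IsChain q (-a) (· ∈ ybInvolution q a b K) b := by
  rcases ybInvolution_cases a b hK hq with hy | hy | hy | hy | hy | hy | hy | hy | hy
  · obtain ⟨i1, i2, e, e'⟩ := hy
    have g1 := e.iff h 1 (by omega) (by omega)
    have gq := e.iff h q (by omega) (by omega)
    have ga := e.iff h (a + 1) (by omega) (by omega)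
    have gb := e.iff h b (by omega) (by omega)
    omega
  · obtain ⟨i1, i2, e, e'⟩ := hy
    have g1 := e.iff h 1 (by omega) (by omega)
    have gq := e.iff h q (by omega) (by omega)
    have ga := e.iff h (a + 1) (by omega) (by omega)
    have gb := e.iff h b (by omega) (by omega)
    rcases Nat.eq_zero_or_pos a with rfl | ha
    · rw [Nat.cast_zero, neg_zero]
      exact IsChain.of_increasing (a := 0) (by omega) (by omega) (e'.congr (by omega))
    · exact .of_first (by omega) (by omega) (by omega) (e'.congr (by omega))
  · obtain ⟨i0, i1, i2, e, e'⟩ := hy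
    have g1 := e.iff h 1 (by omega) (by omega)
    have gq := e.iff h q (by omega) (by omega)
    have ga := e.iff h (a + 1) (by omega) (by omega)
    have gb := e.iff h b (by omega) (by omega)
    omega
  · obtain ⟨i0, i1, i2, e, e'⟩ := hy
    have g1 := e.iff h 1 (by omega) (by omega)
    have gq := e.iff h q (by omega) (by omega)
    have ga := e.iff h (a + 1) (by omega) (by omega)
    have gb := e.iff h b (by omega) (by omega)
    omega
  · obtain ⟨i1, i2, e, e'⟩ := hy
    have g1 := e.iff h 1 (by omega) (by omega)
    have gq := e.iff h q (by omega) (by omega)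
    have ga := e.iff h (a + 1) (by omega) (by omega)
    have gb := e.iff h b (by omega) (by omega)
    omega
  · obtain ⟨i1, i2, e, e'⟩ := hy
    have g1 := e.iff h 1 (by omega) (by omega)
    have gq := e.iff h q (by omega) (by omega)
    have ga := e.iff h (a + 1) (by omega) (by omega)
    have gb := e.iff h b (by omega) (by omega)
    rcases Nat.eq_zero_or_pos a with rfl | ha
    · rw [Nat.cast_zero, neg_zero]
      exact IsChain.of_increasing (a := 0) (by omega) (by omega) (e'.congr (by omega))
    · exact .of_first (by omega) (by omega) (by omega) (e'.congr (by omega))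
  · obtain ⟨i0, i1, i2, e, e'⟩ := hy
    have g1 := e.iff h 1 (by omega) (by omega)
    have gq := e.iff h q (by omega) (by omega)
    have ga := e.iff h (a + 1) (by omega) (by omega)
    have gb := e.iff h b (by omega) (by omega)
    omega
  · obtain ⟨i0, i1, i2, e, e'⟩ := hy
    have g1 := e.iff h 1 (by omega) (by omega)
    have gq := e.iff h q (by omega) (by omega)
    have ga := e.iff h (a + 1) (by omega) (by omega)
    have gb := e.iff h b (by omega) (by omega)
    exact .of_first (by omega) (by omega) (by omega) (e'.congr (by omega))
  · obtain ⟨no1, no2, no3, no4, no5, no6, no7, no8, hyK⟩ := hy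
    rw [hyK]
    by_cases c1 : b = a + 1
    · exact (no2 (by omega) (h.congr (by omega))).elim
    by_cases c2 : b < q
    · exact (no6 (by omega) (h.congr (by omega))).elim
    by_cases c0 : a = 0
    · subst c0
      rw [Nat.cast_zero, neg_zero]
      exact IsChain.of_increasing (a := 0) (by omega) (by omega) (h.congr (by omega))
    · exact (no8 (by omega) (h.congr (by omega))).elim

lemma ybInvolution_of_single (hK : ∀ x ∈ K, 1 ≤ x ∧ x ≤ q) (hq : 2 ≤ q) (ha : 0 < a)
    (hab : b = a + 1) (hb : b ≤ q) (h : EqOn q K fun x => x = q - a) :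
    IsChain q a (· ∈ ybInvolution q a b K) b := by
  rcases ybInvolution_cases a b hK hq with hy | hy | hy | hy | hy | hy | hy | hy | hy
  · obtain ⟨i1, i2, e, e'⟩ := hy
    have g1 := e.iff h 1 (by omega) (by omega)
    have gq := e.iff h q (by omega) (by omega)
    have ga := e.iff h (a + 1) (by omega) (by omega)
    have gb := e.iff h b (by omega) (by omega)
    exact .of_increasing (by omega) (by omega) (e'.congr (by omega))
  · obtain ⟨i1, i2, e, e'⟩ := hy
    have g1 := e.iff h 1 (by omega) (by omega)
    have gq := e.iff h q (by omega) (by omega)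
    have ga := e.iff h (a + 1) (by omega) (by omega)
    have gb := e.iff h b (by omega) (by omega)
    omega
  · obtain ⟨i0, i1, i2, e, e'⟩ := hy
    have g1 := e.iff h 1 (by omega) (by omega)
    have gq := e.iff h q (by omega) (by omega)
    have ga := e.iff h (a + 1) (by omega) (by omega)
    have gb := e.iff h b (by omega) (by omega)
    exact .of_increasing (by omega) (by omega) (e'.congr (by omega))
  · obtain ⟨i0, i1, i2, e, e'⟩ := hy
    have g1 := e.iff h 1 (by omega) (by omega)
    have gq := e.iff h q (by omega) (by omega)
    have ga := e.iff h (a + 1) (by omega) (by omega)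
    have gb := e.iff h b (by omega) (by omega)
    exact .of_increasing (by omega) (by omega) (e'.congr (by omega))
  · obtain ⟨i1, i2, e, e'⟩ := hy
    have g1 := e.iff h 1 (by omega) (by omega)
    have gq := e.iff h q (by omega) (by omega)
    have ga := e.iff h (a + 1) (by omega) (by omega)
    have gb := e.iff h b (by omega) (by omega)
    omega
  · obtain ⟨i1, i2, e, e'⟩ := hy
    have g1 := e.iff h 1 (by omega) (by omega)
    have gq := e.iff h q (by omega) (by omega)
    have ga := e.iff h (a + 1) (by omega) (by omega)
    have gb := e.iff h b (by omega) (by omega)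
    omega
  · obtain ⟨i0, i1, i2, e, e'⟩ := hy
    have g1 := e.iff h 1 (by omega) (by omega)
    have gq := e.iff h q (by omega) (by omega)
    have ga := e.iff h (a + 1) (by omega) (by omega)
    have gb := e.iff h b (by omega) (by omega)
    omega
  · obtain ⟨i0, i1, i2, e, e'⟩ := hy
    have g1 := e.iff h 1 (by omega) (by omega)
    have gq := e.iff h q (by omega) (by omega)
    have ga := e.iff h (a + 1) (by omega) (by omega)
    have gb := e.iff h b (by omega) (by omega)
    omega
  · obtain ⟨no1, no2, no3, no4, no5, no6, no7, no8, hyK⟩ := hy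
    rw [hyK]
    by_cases c2 : b < q
    · exact (no3 (by omega) (h.congr (by omega))).elim
    · exact (no1 (by omega) (h.congr (by omega))).elim

lemma ybInvolution_of_first (hK : ∀ x ∈ K, 1 ≤ x ∧ x ≤ q) (hq : 2 ≤ q) (ha : 0 < a)
    (hab : a < b) (hb : b ≤ q) (h : EqOn q K fun x => x = 1 ∨ a + 2 ≤ x ∧ x ≤ b) :
    IsChain q a (· ∈ ybInvolution q a b K) (-b) := by
  rcases ybInvolution_cases a b hK hq with hy | hy | hy | hy | hy | hy | hy | hy | hy
  · obtain ⟨i1, i2, e, e'⟩ := hy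
    have g1 := e.iff h 1 (by omega) (by omega)
    have gq := e.iff h q (by omega) (by omega)
    have ga := e.iff h (a + 1) (by omega) (by omega)
    have gb := e.iff h b (by omega) (by omega)
    exact .of_increasing_last (by omega) (by omega) (e'.congr (by omega))
  · obtain ⟨i1, i2, e, e'⟩ := hy
    have g1 := e.iff h 1 (by omega) (by omega)
    have gq := e.iff h q (by omega) (by omega)
    have ga := e.iff h (a + 1) (by omega) (by omega)
    have gb := e.iff h b (by omega) (by omega)
    omega
  · obtain ⟨i0, i1, i2, e, e'⟩ := hy
    have g1 := e.iff h 1 (by omega) (by omega)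
    have gq := e.iff h q (by omega) (by omega)
    have ga := e.iff h (a + 1) (by omega) (by omega)
    have gb := e.iff h b (by omega) (by omega)
    omega
  · obtain ⟨i0, i1, i2, e, e'⟩ := hy
    have g1 := e.iff h 1 (by omega) (by omega)
    have gq := e.iff h q (by omega) (by omega)
    have ga := e.iff h (a + 1) (by omega) (by omega)
    have gb := e.iff h b (by omega) (by omega)
    omega
  · obtain ⟨i1, i2, e, e'⟩ := hy
    have g1 := e.iff h 1 (by omega) (by omega)
    have gq := e.iff h q (by omega) (by omega)
    have ga := e.iff h (a + 1) (by omega) (by omega)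
    have gb := e.iff h b (by omega) (by omega)
    exact .of_increasing_last (by omega) (by omega) (e'.congr (by omega))
  · obtain ⟨i1, i2, e, e'⟩ := hy
    have g1 := e.iff h 1 (by omega) (by omega)
    have gq := e.iff h q (by omega) (by omega)
    have ga := e.iff h (a + 1) (by omega) (by omega)
    have gb := e.iff h b (by omega) (by omega)
    omega
  · obtain ⟨i0, i1, i2, e, e'⟩ := hy
    have g1 := e.iff h 1 (by omega) (by omega)
    have gq := e.iff h q (by omega) (by omega)
    have ga := e.iff h (a + 1) (by omega) (by omega)
    have gb := e.iff h b (by omega) (by omega)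
    exact .of_increasing_last (by omega) (by omega) (e'.congr (by omega))
  · obtain ⟨i0, i1, i2, e, e'⟩ := hy
    have g1 := e.iff h 1 (by omega) (by omega)
    have gq := e.iff h q (by omega) (by omega)
    have ga := e.iff h (a + 1) (by omega) (by omega)
    have gb := e.iff h b (by omega) (by omega)
    omega
  · obtain ⟨no1, no2, no3, no4, no5, no6, no7, no8, hyK⟩ := hy
    rw [hyK]
    by_cases c1 : b = a + 1
    · exact (no1 (by omega) (h.congr (by omega))).elim
    by_cases c2 : b < q
    · exact (no5 (by omega) (h.congr (by omega))).elim
    · exact (no7 (by omega) (h.congr (by omega))).elim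

lemma ybInvolution_of_first_last (hK : ∀ x ∈ K, 1 ≤ x ∧ x ≤ q) (hq : 2 ≤ q) (ha : 0 < a)
    (hab : a + 1 < b) (hb : b ≤ q)
    (h : EqOn q K fun x => (x = 1 ∨ a + 2 ≤ x ∧ x ≤ b - 1) ∨ x = q) :
    IsChain q a (· ∈ ybInvolution q a b K) b := by
  rcases ybInvolution_cases a b hK hq with hy | hy | hy | hy | hy | hy | hy | hy | hy
  · obtain ⟨i1, i2, e, e'⟩ := hy
    have g1 := e.iff h 1 (by omega) (by omega)
    have gq := e.iff h q (by omega) (by omega)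
    have ga := e.iff h (a + 1) (by omega) (by omega)
    have gb := e.iff h b (by omega) (by omega)
    omega
  · obtain ⟨i1, i2, e, e'⟩ := hy
    have g1 := e.iff h 1 (by omega) (by omega)
    have gq := e.iff h q (by omega) (by omega)
    have ga := e.iff h (a + 1) (by omega) (by omega)
    have gb := e.iff h b (by omega) (by omega)
    omega
  · obtain ⟨i0, i1, i2, e, e'⟩ := hy
    have g1 := e.iff h 1 (by omega) (by omega)
    have gq := e.iff h q (by omega) (by omega)
    have ga := e.iff h (a + 1) (by omega) (by omega)
    have gb := e.iff h b (by omega) (by omega)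
    omega
  · obtain ⟨i0, i1, i2, e, e'⟩ := hy
    have g1 := e.iff h 1 (by omega) (by omega)
    have gq := e.iff h q (by omega) (by omega)
    have ga := e.iff h (a + 1) (by omega) (by omega)
    have gb := e.iff h b (by omega) (by omega)
    omega
  · obtain ⟨i1, i2, e, e'⟩ := hy
    have g1 := e.iff h 1 (by omega) (by omega)
    have gq := e.iff h q (by omega) (by omega)
    have ga := e.iff h (a + 1) (by omega) (by omega)
    have gb := e.iff h b (by omega) (by omega)
    omega
  · obtain ⟨i1, i2, e, e'⟩ := hy
    have g1 := e.iff h 1 (by omega) (by omega)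
    have gq := e.iff h q (by omega) (by omega)
    have ga := e.iff h (a + 1) (by omega) (by omega)
    have gb := e.iff h b (by omega) (by omega)
    omega
  · obtain ⟨i0, i1, i2, e, e'⟩ := hy
    have g1 := e.iff h 1 (by omega) (by omega)
    have gq := e.iff h q (by omega) (by omega)
    have ga := e.iff h (a + 1) (by omega) (by omega)
    have gb := e.iff h b (by omega) (by omega)
    exact .of_increasing (by omega) (by omega) (e'.congr (by omega))
  · obtain ⟨i0, i1, i2, e, e'⟩ := hy
    have g1 := e.iff h 1 (by omega) (by omega)
    have gq := e.iff h q (by omega) (by omega)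
    have ga := e.iff h (a + 1) (by omega) (by omega)
    have gb := e.iff h b (by omega) (by omega)
    omega
  · obtain ⟨no1, no2, no3, no4, no5, no6, no7, no8, hyK⟩ := hy
    rw [hyK]
    exact (no7 (by omega) (h.congr (by omega))).elim

lemma ybInvolution_self (hq : 2 ≤ q) (hK : ∀ x ∈ K, 1 ≤ x ∧ x ≤ q) : ybInvolution q a a K = K := by
  rcases ybInvolution_cases a a hK hq with hy | hy | hy | hy | hy | hy | hy | hy | hy
  · omega
  · omega
  · omega
  · omega
  · omega
  · omega
  · omega
  · omega
  · exact hy.2.2.2.2.2.2.2.2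

end Forms

/-- Arcs change sign when the labels are reversed, so the image must be the chain from −c to −d. The
involution exchanges runs with the shape 1, run, q (or with a single label if the run has length
one), and the shape run, q with the shape 1, run. The arc 0 is its own negative, so for c = 0 the
shapes of nonnegative arcs occur on both sides. -/
lemma IsChain.ybInvolution {q : ℕ} {c d : ℤ} {K : Finset ℕ} (hK : ∀ x ∈ K, 1 ≤ x ∧ x ≤ q)
    (h : IsChain q c (· ∈ K) d) (hc : -q ≤ c ∧ c ≤ q) (hq : 2 ≤ q) :
    IsChain q (-c) (· ∈ ybInvolution q c.natAbs d.natAbs K) (-d) := by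
  have hd := h.le hc
  obtain ⟨a, ha⟩ := Int.eq_nat_or_neg c
  obtain ⟨b, hb⟩ := Int.eq_nat_or_neg d
  have ha' : c.natAbs = a := by omega
  have hb' : d.natAbs = b := by omega
  rw [ha', hb']
  rcases h with ⟨k1, k2, k3, k4⟩ | ⟨k1, k2, k3, k0, k4⟩ | ⟨k1, k2, k4⟩ | ⟨k1, k2, k3, k0, k4⟩ |
        ⟨k1, k2, k3, k0, k4⟩ | ⟨k1, k2, k3, k0, k4⟩
  · obtain rfl : c = a := by omega
    obtain rfl : d = b := by omega
    rcases Nat.lt_or_ge a b with hab | hab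
    · exact ybInvolution_of_increasing hK hq hab (by omega) fun x h1 h2 =>
        (k4 x h1 h2).trans (by omega)
    · obtain rfl : a = b := by omega
      rw [ybInvolution_self hq hK]
      rcases Nat.eq_zero_or_pos a with rfl | ha
      · exact IsChain.of_increasing (a := 0) (b := 0) le_rfl (by omega) fun x h1 h2 =>
          (k4 x h1 h2).trans (by omega)
      · exact IsChain.of_empty ha fun x h1 h2 => (k4 x h1 h2).trans (iff_of_false (by omega) id)
  · obtain rfl : c = a := by omega
    obtain rfl : d = -b := by omega
    rw [neg_neg]
    exact ybInvolution_of_increasing_last hK hq (by omega) (by omega) fun x h1 h2 =>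
      (k4 x h1 h2).trans (by omega)
  · obtain rfl : c = -a := by omega
    obtain rfl : d = -a := by omega
    obtain rfl : a = b := by omega
    rw [ybInvolution_self hq hK, neg_neg]
    exact IsChain.of_increasing le_rfl (by omega) fun x h1 h2 => by
      exact (k4 x h1 h2).trans (iff_of_false id fun h => by dsimp only at h; omega)
  · obtain rfl : c = -a := by omega
    obtain rfl : d = -b := by omega
    rw [neg_neg, neg_neg]
    exact ybInvolution_of_single hK hq (by omega) (by omega) (by omega) fun x h1 h2 =>
      (k4 x h1 h2).trans (by omega)
  · obtain rfl : c = -a := by omega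
    obtain rfl : d = b := by omega
    rw [neg_neg]
    exact ybInvolution_of_first hK hq (by omega) (by omega) (by omega) fun x h1 h2 =>
      (k4 x h1 h2).trans (by omega)
  · obtain rfl : c = -a := by omega
    obtain rfl : d = -b := by omega
    rw [neg_neg, neg_neg]
    exact ybInvolution_of_first_last hK hq (by omega) (by omega) (by omega) fun x h1 h2 =>
      (k4 x h1 h2).trans (by omega)

end AlcoveModel
end

/-! ### Dihedral reflection subgroups: arcs of coset elements and cover walks. -/

noncomputable section

namespace AlcoveModel

open RootPairing

variable {ι M N : Type*} [AddCommGroup M] [Module ℝ M] [AddCommGroup N] [Module ℝ N]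
  {P : RootPairing ι ℝ M N}

/-- The roots of a rank two subsystem in cyclic order: `bt 1, …, bt q` are the positive ones. -/
structure IsRootCycle (b : P.Base) (q : ℕ) (bt : ℤ → ι) : Prop where
  two_le : 2 ≤ q
  add_period : ∀ j, bt (j + q) = opp P (bt j)
  pos : ∀ j : ℤ, 1 ≤ j → j ≤ q → b.IsPos (bt j)
  inj : ∀ i j : ℤ, 1 ≤ i → i ≤ q → 1 ≤ j → j ≤ q → bt i = bt j → i = j

/-- The reflections act on the cyclically ordered roots as in a dihedral group. -/
structure IsDihedral (b : P.Base) (q : ℕ) (bt : ℤ → ι) : Prop extends IsRootCycle b q bt where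
  reflect : ∀ i j, P.reflectionPerm (bt j) (bt i) = bt (2 * j - i + q)

/-- The dihedral reflection subgroup. -/
def dihedralSubgroup (P : RootPairing ι ℝ M N) (bt : ℤ → ι) : Subgroup P.weylGroup :=
  Subgroup.closure (refl P '' Set.range bt)

/-- The roots of the rank two subsystem that `u` sends to positive roots are those with labels
`c + 1, …, c + q`. -/
def HasArc (b : P.Base) (q : ℕ) (bt : ℤ → ι) (u : P.weylGroup) (c : ℤ) : Prop :=
  ∀ i, c < i → i ≤ c + q → b.IsPos (act P u (bt i))

variable {b : P.Base} {q : ℕ} {bt : ℤ → ι} {u v : P.weylGroup} {c d : ℤ}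

variable [Finite ι] [P.IsRootSystem] [P.IsCrystallographic] [P.IsReduced]

namespace IsRootCycle

lemma sub_period (h : IsRootCycle b q bt) (j : ℤ) : bt (j - q) = opp P (bt j) := by
  rw [← opp_eq_iff.mpr (show bt (j - q) = opp P (bt j) from ?_), opp_opp]
  rw [← opp_eq_iff, ← h.add_period, sub_add_cancel]

lemma add_two_period (h : IsRootCycle b q bt) (j : ℤ) : bt (j + 2 * q) = bt j := by
  rw [two_mul, ← add_assoc, h.add_period, h.add_period, opp_opp]

lemma add_mul_period (h : IsRootCycle b q bt) (j k : ℤ) : bt (j + k * (2 * q)) = bt j :=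
  Function.Periodic.int_mul (f := bt) (c := 2 * q) h.add_two_period k j

lemma exists_eq (h : IsRootCycle b q bt) (c j : ℤ) :
    ∃ i, c < i ∧ i ≤ c + q ∧ (bt j = bt i ∨ bt j = opp P (bt i)) := by
  have hq : (0 : ℤ) < 2 * q := by have := h.two_le; omega
  have h0 := Int.emod_nonneg (j - c - 1) hq.ne'
  have h1 := Int.emod_lt_of_pos (j - c - 1) hq
  have h2 := Int.emod_add_mul_ediv (j - c - 1) (2 * q)
  have h3 := h.add_mul_period ((j - c - 1) % (2 * q) + c + 1) ((j - c - 1) / (2 * q))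
  rw [show (j - c - 1) % (2 * q) + c + 1 + (j - c - 1) / (2 * q) * (2 * q) = j by linarith] at h3
  by_cases hlt : (j - c - 1) % (2 * q) < q
  · exact ⟨_, by omega, by omega, Or.inl h3⟩
  · refine ⟨(j - c - 1) % (2 * q) + c + 1 - q, by omega, by omega, Or.inr ?_⟩
    rw [h.sub_period, opp_opp, h3]

lemma mem_range_opp (h : IsRootCycle b q bt) {x : ι} (hx : x ∈ Set.range bt) :
    opp P x ∈ Set.range bt := by
  obtain ⟨j, rfl⟩ := hx
  exact ⟨j + q, h.add_period j⟩

lemma exists_eq_of_isPos (h : IsRootCycle b q bt) {x : ι} (hx : x ∈ Set.range bt)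
    (hp : b.IsPos x) : ∃ i : ℤ, 1 ≤ i ∧ i ≤ q ∧ x = bt i := by
  obtain ⟨j, rfl⟩ := hx
  obtain ⟨i, h1, h2, h3 | h3⟩ := h.exists_eq 0 j
  · exact ⟨i, by omega, by omega, h3⟩
  · rw [h3, isPos_opp] at hp
    exact (hp (h.pos i (by omega) (by omega))).elim

end IsRootCycle

namespace IsDihedral

lemma act_mem_range (h : IsDihedral b q bt) (hu : u ∈ dihedralSubgroup P bt) :
    ∀ x ∈ Set.range bt, act P u x ∈ Set.range bt := by
  induction hu using Subgroup.closure_induction with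
  | mem x hx =>
    obtain ⟨_, ⟨j, rfl⟩, rfl⟩ := hx
    rintro _ ⟨i, rfl⟩
    exact ⟨_, (by rw [act_refl_apply]; exact (h.reflect i j).symm)⟩
  | one => intro x hx; rwa [map_one]
  | mul x y hx hy ihx ihy =>
    intro z hz
    rw [map_mul]
    exact ihx _ (ihy z hz)
  | inv x hx ih =>
    intro z hz
    have : Set.BijOn (act P x) (Set.range bt) (Set.range bt) :=
      ((Set.toFinite (Set.range bt)).injOn_iff_bijOn_of_mapsTo ih).mp (act P x).injective.injOn
    obtain ⟨y, hy, rfl⟩ := this.surjOn hz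
    rwa [← Equiv.Perm.mul_apply, ← map_mul, inv_mul_cancel, map_one]

/-- The reflection with label j acts on labels by i ↦ 2j − i + q, which maps the half-circle after
2j − 1 − c onto the one after c. -/
lemma hasArc_mul_refl (h : IsDihedral b q bt) (hu : HasArc b q bt u c) (j : ℤ) :
    HasArc b q bt (u * refl P (bt j)) (2 * j - 1 - c) := by
  intro i h1 h2
  rw [map_mul, Equiv.Perm.mul_apply, act_refl, h.reflect]
  exact hu _ (by omega) (by omega)

lemma hasArc_sub (h : IsDihedral b q bt) (hu : HasArc b q bt u c) :
    HasArc b q bt u (c - 2 * q) := by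
  intro i h1 h2
  rw [← h.add_two_period]
  exact hu _ (by omega) (by omega)

lemma isPos_act_iff (h : IsDihedral b q bt) (hu : HasArc b q bt u c) (hc : -q ≤ c ∧ c ≤ q)
    {j : ℤ} (hj : 1 ≤ j) (hjq : j ≤ q) : b.IsPos (act P u (bt j)) ↔ c < j ∧ j ≤ c + q := by
  refine ⟨fun hp => ?_, fun hj => hu j hj.1 hj.2⟩
  by_contra hn
  have key : ∀ i, bt i = opp P (bt j) → c < i → i ≤ c + q → False := fun i hi h1 h2 => by
    have := hu i h1 h2
    rw [hi, act_opp, isPos_opp] at this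
    exact this hp
  by_cases h1 : c < j
  · exact key (j - q) (h.sub_period j) (by omega) (by omega)
  · exact key (j + q) (h.add_period j) (by omega) (by omega)

lemma arc_unique (h : IsDihedral b q bt) (hu : HasArc b q bt u c) (hu' : HasArc b q bt u d)
    (hc : -q ≤ c ∧ c ≤ q) (hd : -q ≤ d ∧ d ≤ q) : c = d ∨ (|c| = q ∧ |d| = q) := by
  have h2 := h.two_le
  have key : ∀ j : ℤ, 1 ≤ j → j ≤ q → (c < j ∧ j ≤ c + q ↔ d < j ∧ j ≤ d + q) := fun j h1 h2 =>
    (h.isPos_act_iff hu hc h1 h2).symm.trans (h.isPos_act_iff hu' hd h1 h2)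
  -- Two windows of length q that agree on {1, …, q} are compared at its ends and at their own
  -- boundary points.
  have k1 := key 1 le_rfl (by omega)
  have k2 := key q (by omega) le_rfl
  have k3 : 1 ≤ c → _ := fun h => key c h (by omega)
  have k4 : 1 ≤ d → _ := fun h => key d h (by omega)
  have k5 : 1 ≤ c + q → _ := fun h => key (c + q) h
  have k6 : 1 ≤ d + q → _ := fun h => key (d + q) h
  by_cases hcd : c = d
  · exact Or.inl hcd
  · right
    rcases abs_cases c with ⟨a1, a2⟩ | ⟨a1, a2⟩ <;>
    rcases abs_cases d with ⟨a3, a4⟩ | ⟨a3, a4⟩ <;> rw [a1, a3] <;> constructor <;> omega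

lemma hasArc_add_mul (h : IsDihedral b q bt) (hu : HasArc b q bt u c) (k : ℤ) :
    HasArc b q bt u (c + k * (2 * q)) := by
  intro i h1 h2
  have := h.add_mul_period (i - k * (2 * q)) k
  rw [sub_add_cancel] at this
  rw [this]
  exact hu _ (by omega) (by omega)

lemma exists_arc_mem (h : IsDihedral b q bt) (hu : HasArc b q bt u c) :
    ∃ d : ℤ, (-q ≤ d ∧ d ≤ q) ∧ HasArc b q bt u d := by
  have hq : (0 : ℤ) < 2 * q := by have := h.two_le; omega
  have h0 := Int.emod_nonneg (c + q) hq.ne'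
  have h1 := Int.emod_lt_of_pos (c + q) hq
  have h2 := Int.emod_add_mul_ediv (c + q) (2 * q)
  refine ⟨(c + q) % (2 * q) - q, ⟨by omega, by omega⟩, ?_⟩
  have := h.hasArc_add_mul hu (-((c + q) / (2 * q)))
  rwa [show c + -((c + q) / (2 * q)) * (2 * q) = (c + q) % (2 * q) - q by linarith] at this

lemma exists_arc_wordProd (h : IsDihedral b q bt) (l : List ι) (hl : ∀ r ∈ l, r ∈ Set.range bt)
    (hu : HasArc b q bt u c) : ∃ d, HasArc b q bt (u * wordProd P l) d := by
  induction l generalizing u c with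
  | nil => exact ⟨c, by rwa [wordProd_nil, mul_one]⟩
  | cons a l ih =>
    obtain ⟨j, rfl⟩ := hl a (by simp)
    rw [wordProd_cons, ← mul_assoc]
    exact ih (fun r hr => hl r (by simp [hr])) (h.hasArc_mul_refl hu j)

lemma refl_mem (bt : ℤ → ι) (j : ℤ) : refl P (bt j) ∈ dihedralSubgroup P bt :=
  Subgroup.subset_closure ⟨_, ⟨j, rfl⟩, rfl⟩

/-- If the minimal representative made a positive root of the subsystem negative, its product with
that reflection would be a shorter element of the same coset. -/
lemma hasArc_minRep (h : IsDihedral b q bt) (u : P.weylGroup) :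
    HasArc b q bt (minRep b (dihedralSubgroup P bt) u) 0 := by
  obtain ⟨h1, h2⟩ := (exists_minRep b (dihedralSubgroup P bt) u).choose_spec
  intro i hi hi'
  by_contra hn
  have h3 := length_mul_refl_lt (h.pos i (by omega) (by omega)) hn
  refine (h2 _ ?_).not_gt h3
  rw [mul_inv_rev, mul_assoc]
  exact Subgroup.mul_mem _ (Subgroup.inv_mem _ (refl_mem bt i)) h1

lemma minRep_mem (H : Subgroup P.weylGroup) (u : P.weylGroup) : (minRep b H u)⁻¹ * u ∈ H :=
  (exists_minRep b H u).choose_spec.1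

lemma exists_hasArc (h : IsDihedral b q bt) (u : P.weylGroup) :
    ∃ d : ℤ, (-q ≤ d ∧ d ≤ q) ∧ HasArc b q bt u d := by
  obtain ⟨l, hl, hlu⟩ := exists_wordProd_of_mem_closure (minRep_mem (b := b) (dihedralSubgroup P bt) u)
  obtain ⟨d, hd⟩ := h.exists_arc_wordProd l hl (h.hasArc_minRep u)
  rw [hlu, mul_inv_cancel_left] at hd
  exact h.exists_arc_mem hd

lemma isPos_act_congr (h : IsDihedral b q bt) (hu : HasArc b q bt u c) (hv : HasArc b q bt v c)
    {x : ι} (hx : x ∈ Set.range bt) : b.IsPos (act P u x) ↔ b.IsPos (act P v x) := by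
  obtain ⟨j, rfl⟩ := hx
  obtain ⟨i, h1, h2, h3 | h3⟩ := h.exists_eq c j
  · rw [h3]; exact iff_of_true (hu i h1 h2) (hv i h1 h2)
  · rw [h3, act_opp, act_opp, isPos_opp, isPos_opp]
    exact not_congr (iff_of_true (hu i h1 h2) (hv i h1 h2))

lemma hasArc_one (h : IsDihedral b q bt) : HasArc b q bt 1 0 := fun i h1 h2 => by
  rw [map_one]; exact h.pos i (by omega) (by omega)

lemma isSimpleIn (h : IsDihedral b q bt) : IsSimpleIn b (Set.range bt) {bt 1, bt q} where
  subset := by rintro _ (rfl | rfl) <;> exact Set.mem_range_self _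
  pos := by
    have := h.two_le
    rintro _ (rfl | rfl) <;> exact h.pos _ (by omega) (by omega)
  stable := by
    rintro _ (rfl | rfl) _ ⟨i, rfl⟩ <;> rw [h.reflect] <;> exact Set.mem_range_self _
  perm := by
    rintro _ (rfl | rfl) x hx hp hne <;> obtain ⟨i, h1, h2, rfl⟩ := h.exists_eq_of_isPos hx hp
    · have : i ≠ 1 := fun h => hne (by rw [h])
      rw [h.reflect]
      exact h.pos _ (by omega) (by omega)
    · have : i ≠ q := fun h => hne (by rw [h])
      rw [h.reflect, show 2 * (q : ℤ) - i + q = q - i + 2 * q by ring, h.add_two_period]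
      exact h.pos _ (by omega) (by omega)

lemma dihedralSubgroup_eq (h : IsDihedral b q bt) :
    dihedralSubgroup P bt = Subgroup.closure (refl P '' {bt 1, bt q}) := by
  apply le_antisymm
  · have key : ∀ j : ℕ, refl P (bt j) ∈ Subgroup.closure (refl P '' {bt 1, bt q}) ∧
        refl P (bt (j + 1)) ∈ Subgroup.closure (refl P '' {bt 1, bt q}) := by
      intro j
      induction j with
      | zero =>
        refine ⟨?_, Subgroup.subset_closure ⟨bt 1, by simp, by simp⟩⟩
        have := h.sub_period q
        rw [sub_self] at this
        rw [Nat.cast_zero, this, refl_opp]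
        exact Subgroup.subset_closure ⟨bt q, by simp, rfl⟩
      | succ j ih =>
        refine ⟨by exact_mod_cast ih.2, ?_⟩
        -- Conjugating the reflection with label j by the one with label j + 1 gives the one with
        -- label j + 2, so labels 0 and 1 generate all; label 0 is the negative of the root with
        -- label q.
        have h1 := mul_refl_mul_inv (refl P (bt (j + 1))) (bt j)
        rw [act_refl, h.reflect, show 2 * ((j : ℤ) + 1) - j + q = j + 1 + 1 + q by ring,
          h.add_period, refl_opp] at h1
        rw [Nat.cast_succ, ← h1]
        exact Subgroup.mul_mem _ (Subgroup.mul_mem _ ih.2 ih.1) (Subgroup.inv_mem _ ih.2)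
    rw [dihedralSubgroup, Subgroup.closure_le]
    rintro _ ⟨_, ⟨j, rfl⟩, rfl⟩
    obtain ⟨i, h1, h2, h3⟩ := h.exists_eq 0 j
    have h4 := (key i.toNat).1
    rw [Int.toNat_of_nonneg (by omega)] at h4
    rcases h3 with h3 | h3
    · rwa [h3]
    · rwa [h3, refl_opp]
  · exact Subgroup.closure_mono (Set.image_mono h.isSimpleIn.subset)

/-- The elements of a coset of the dihedral subgroup are determined by their arcs. -/
lemma eq_of_hasArc (h : IsDihedral b q bt) (huv : u⁻¹ * v ∈ dihedralSubgroup P bt)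
    (hu : HasArc b q bt u c) (hv : HasArc b q bt v c) : u = v := by
  set x := minRep b (dihedralSubgroup P bt) u with hx
  have hxu : x⁻¹ * u ∈ dihedralSubgroup P bt := minRep_mem _ u
  have hxv : x⁻¹ * v ∈ dihedralSubgroup P bt := by
    have := Subgroup.mul_mem _ hxu huv
    rwa [mul_assoc, mul_inv_cancel_left] at this
  have hx0 : ∀ y ∈ Set.range bt, (b.IsPos (act P x y) ↔ b.IsPos y) := fun y hy => by
    have := h.isPos_act_congr (h.hasArc_minRep u) h.hasArc_one hy
    rwa [map_one] at this
  have hz : x⁻¹ * v * (x⁻¹ * u)⁻¹ ∈ dihedralSubgroup P bt :=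
    Subgroup.mul_mem _ hxv (Subgroup.inv_mem _ hxu)
  -- The minimal representative preserves signs on the subsystem, and u and v have equal signs
  -- there. So this element of W̄ has no inversions and is the empty word.
  have hinv : invCount b (Set.range bt) (x⁻¹ * v * (x⁻¹ * u)⁻¹) = 0 := by
    rw [invCount, Set.ncard_eq_zero]
    ext y
    simp only [invSet, Set.mem_ofPred_eq, Set.mem_empty_iff_false, iff_false, not_and, not_not]
    intro hy hp
    have hy' := h.act_mem_range (Subgroup.inv_mem _ hxu) y hy
    rw [map_mul, Equiv.Perm.mul_apply, ← hx0 _ (h.act_mem_range hxv _ hy'),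
      ← Equiv.Perm.mul_apply (act P x), ← map_mul, mul_inv_cancel_left,
      h.isPos_act_congr hv hu hy', ← Equiv.Perm.mul_apply, ← map_mul, mul_inv_rev, inv_inv,
      mul_inv_cancel_left, hx0 _ hy]
    exact hp
  have hz' := hz
  rw [h.dihedralSubgroup_eq] at hz'
  obtain ⟨l, hl, hlz⟩ := exists_wordProd_of_mem_closure hz'
  obtain ⟨l', -, h1, h2⟩ := h.isSimpleIn.exists_reduced l hl
  rw [hlz, hinv, List.length_eq_zero_iff] at h2
  rw [h2, wordProd_nil, hlz] at h1
  have := mul_inv_eq_one.mp h1.symm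
  exact (mul_left_cancel this).symm

/-- The factor ⌊u⌋ does not change signs on the subsystem, so the inversions of ū are the labels in
{1, …, q} outside the arc: 1, …, c if c ≥ 0, and c + q + 1, …, q otherwise. -/
lemma wordLength_eq_natAbs (h : IsDihedral b q bt) (hu : HasArc b q bt u c)
    (hc : -q ≤ c ∧ c ≤ q) :
    wordLength (refl P '' {bt 1, bt q}) ((minRep b (dihedralSubgroup P bt) u)⁻¹ * u) =
      c.natAbs := by
  set x := minRep b (dihedralSubgroup P bt) u with hx
  have hxu : x⁻¹ * u ∈ dihedralSubgroup P bt := minRep_mem _ u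
  have hx0 : ∀ y ∈ Set.range bt, (b.IsPos (act P x y) ↔ b.IsPos y) := fun y hy => by
    have := h.isPos_act_congr (h.hasArc_minRep u) h.hasArc_one hy
    rwa [map_one] at this
  rw [h.isSimpleIn.wordLength_eq (by rw [← h.dihedralSubgroup_eq]; exact hxu), invCount]
  have hset : invSet b (Set.range bt) (x⁻¹ * u) =
      bt '' ((if 0 ≤ c then Finset.Icc 1 c else Finset.Ioc (c + q) q : Finset ℤ) : Set ℤ) := by
    ext y
    simp only [invSet, Set.mem_ofPred_eq, Set.mem_image, Finset.mem_coe]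
    have hact : ∀ y ∈ Set.range bt, (b.IsPos (act P (x⁻¹ * u) y) ↔ b.IsPos (act P u y)) :=
      fun y hy => by
        rw [← hx0 _ (h.act_mem_range hxu y hy), ← Equiv.Perm.mul_apply, ← map_mul,
          mul_inv_cancel_left]
    constructor
    · rintro ⟨h1, h2, h3⟩
      rw [hact y h1] at h3
      obtain ⟨i, h4, h5, rfl⟩ := h.exists_eq_of_isPos h1 h2
      rw [h.isPos_act_iff hu hc h4 h5] at h3
      refine ⟨i, ?_, rfl⟩
      split_ifs <;> simp only [Finset.mem_Icc, Finset.mem_Ioc] <;> omega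
    · rintro ⟨i, hi, rfl⟩
      have hi : 1 ≤ i ∧ i ≤ q ∧ ¬ (c < i ∧ i ≤ c + q) := by
        split_ifs at hi <;> simp only [Finset.mem_Icc, Finset.mem_Ioc] at hi <;> omega
      refine ⟨Set.mem_range_self i, h.pos i hi.1 hi.2.1, ?_⟩
      rw [hact _ (Set.mem_range_self i), h.isPos_act_iff hu hc hi.1 hi.2.1]
      exact hi.2.2
  rw [hset, Set.InjOn.ncard_image, Set.ncard_coe_finset]
  · split_ifs <;> simp only [Int.card_Icc, Int.card_Ioc] <;> omega
  · intro i hi j hj hij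
    have : ∀ i, i ∈ ((if 0 ≤ c then Finset.Icc 1 c else Finset.Ioc (c + q) q : Finset ℤ) : Set ℤ) →
        1 ≤ i ∧ i ≤ q := by
      intro i hi
      rw [Finset.mem_coe] at hi
      split_ifs at hi <;> simp only [Finset.mem_Icc, Finset.mem_Ioc] at hi <;> omega
    exact h.inj i j (this i hi).1 (this i hi).2 (this j hj).1 (this j hj).2 hij

lemma reverse (h : IsDihedral b q bt) : IsDihedral b q (fun j => bt (q + 1 - j)) where
  two_le := h.two_le
  add_period j := by
    rw [← h.sub_period]; congr 1; ring
  reflect i j := by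
    rw [h.reflect, ← h.add_two_period (q + 1 - _)]; congr 1; ring
  pos j h1 h2 := h.pos _ (by omega) (by omega)
  inj i j h1 h2 h3 h4 hij := by
    have := h.inj _ _ (by omega) (by omega) (by omega) (by omega) hij
    omega

lemma hasArc_reverse (hu : HasArc b q bt u c) : HasArc b q (fun j => bt (q + 1 - j)) u (-c) :=
  fun i h1 h2 => hu _ (by omega) (by omega)

lemma dihedralSubgroup_reverse (bt : ℤ → ι) (q : ℕ) :
    dihedralSubgroup P (fun j => bt (q + 1 - j)) = dihedralSubgroup P bt := by
  rw [dihedralSubgroup, dihedralSubgroup]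
  congr 2
  ext x
  constructor
  · rintro ⟨j, rfl⟩; exact ⟨_, rfl⟩
  · rintro ⟨j, rfl⟩; exact ⟨q + 1 - j, by simp⟩

end IsDihedral

open scoped Classical in
/-- The products of `u` with the reflections whose labels belong to `K`. -/
def walk (P : RootPairing ι ℝ M N) (bt : ℤ → ι) (K : ℕ → Prop) (u : P.weylGroup) : ℕ → P.weylGroup
  | 0 => u
  | j + 1 => if K (j + 1) then walk P bt K u j * refl P (bt (j + 1)) else walk P bt K u j

variable {K K' : ℕ → Prop} {g : ℕ → ℤ}

lemma walk_succ_of_mem {j : ℕ} (hj : K (j + 1)) :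
    walk P bt K u (j + 1) = walk P bt K u j * refl P (bt (j + 1)) := by
  rw [walk, if_pos hj]

lemma walk_succ_of_notMem {j : ℕ} (hj : ¬ K (j + 1)) :
    walk P bt K u (j + 1) = walk P bt K u j := by
  rw [walk, if_neg hj]

lemma walk_mem (bt : ℤ → ι) (K : ℕ → Prop) (u : P.weylGroup) (j : ℕ) :
    u⁻¹ * walk P bt K u j ∈ dihedralSubgroup P bt := by
  induction j with
  | zero => rw [walk, inv_mul_cancel]; exact Subgroup.one_mem _
  | succ j ih =>
    by_cases hj : K (j + 1)
    · rw [walk_succ_of_mem hj, ← mul_assoc]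
      exact Subgroup.mul_mem _ ih (IsDihedral.refl_mem bt _)
    · rwa [walk_succ_of_notMem hj]

variable (b q bt K u) in
/-- Each step of the walk goes up by one in the Bruhat order. -/
def IsCoverWalk : Prop :=
  ∀ j < q, K (j + 1) → length b (walk P bt K u (j + 1)) = length b (walk P bt K u j) + 1

namespace IsDihedral

lemma walk_spec (h : IsDihedral b q bt) (hg : IsArcPath q K g) (hu : HasArc b q bt u (g 0))
    (j : ℕ) (hj : j ≤ q) : HasArc b q bt (walk P bt K u j) (g j) := by
  induction j with
  | zero => exact hu
  | succ j ih =>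
    by_cases hK : K (j + 1)
    · rw [walk_succ_of_mem hK]
      have h1 := h.hasArc_mul_refl (ih (by omega)) (j + 1)
      rcases hg.step j hj hK with h2 | h2
      · rwa [h2, show 2 * (j : ℤ) + 1 - g j = 2 * (j + 1) - 1 - g j by ring]
      · rw [h2, show 2 * (j : ℤ) + 1 - g j - 2 * q = 2 * (j + 1) - 1 - g j - 2 * q by ring]
        exact h.hasArc_sub h1
    · rw [walk_succ_of_notMem hK, hg.keep j hj hK]
      exact ih (by omega)

/-- A step that lengthens the arc reflects in a root that is still sent to a positive root. It
raises the length in W by at least one and |g| by exactly one. -/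
lemma walk_length (h : IsDihedral b q bt) (hg : IsArcPath q K g) (hu : HasArc b q bt u (g 0))
    (j : ℕ) (hj : j < q) : (length b (walk P bt K u j) : ℤ) - |g j| ≤
      length b (walk P bt K u (j + 1)) - |g (j + 1)| := by
  by_cases hK : K (j + 1)
  · have h1 := h.walk_spec hg hu j hj.le
    have h2 := hg.mem j hj.le
    have h3 := hg.mem (j + 1) hj
    have h4 := hg.step j hj hK
    have h5 := hg.length j hj hK
    have h6 : b.IsPos (act P (walk P bt K u j) (bt (j + 1))) := by
      rw [h.isPos_act_iff h1 h2 (by omega) (by omega)]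
      rcases abs_cases (g (j + 1)) with ⟨a1, a2⟩ | ⟨a1, a2⟩ <;>
      rcases abs_cases (g j) with ⟨a3, a4⟩ | ⟨a3, a4⟩ <;> omega
    have h7 := length_lt_mul_refl (h.pos (j + 1) (by omega) (by omega)) h6
    rw [walk_succ_of_mem hK, h5]
    omega
  · rw [walk_succ_of_notMem hK, hg.keep j hj hK]

lemma walk_length_le (h : IsDihedral b q bt) (hg : IsArcPath q K g) (hu : HasArc b q bt u (g 0))
    {i j : ℕ} (hij : i ≤ j) (hj : j ≤ q) : (length b (walk P bt K u i) : ℤ) - |g i| ≤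
      length b (walk P bt K u j) - |g j| := by
  induction j, hij using Nat.le_induction with
  | base => exact le_rfl
  | succ j hij ih => exact (ih (by omega)).trans (h.walk_length hg hu j hj)

/-- The covers in the Bruhat order by reflections of a dihedral subgroup are covers in its cosets. -/
lemma exists_arc_of_cover (h : IsDihedral b q bt) (hu : HasArc b q bt u c) (hc : -q ≤ c ∧ c ≤ q)
    {j : ℤ} (hj : 1 ≤ j) (hjq : j ≤ q) (hcov : length b (u * refl P (bt j)) = length b u + 1) :
    ∃ e : ℤ, (-q ≤ e ∧ e ≤ q) ∧ (e = 2 * j - 1 - c ∨ e = 2 * j - 1 - c - 2 * q) ∧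
      |e| = |c| + 1 ∧ HasArc b q bt (u * refl P (bt j)) e := by
  have h1 := (length_lt_mul_refl_iff (w := u) (h.pos j hj hjq)).mp (by omega)
  rw [h.isPos_act_iff hu hc hj hjq] at h1
  have h2 := h.hasArc_mul_refl hu j
  obtain ⟨e, he1, he2, he3⟩ : ∃ e : ℤ, (-q ≤ e ∧ e ≤ q) ∧
      (e = 2 * j - 1 - c ∨ e = 2 * j - 1 - c - 2 * q) ∧
      HasArc b q bt (u * refl P (bt j)) e := by
    by_cases hle : 2 * j - 1 - c ≤ q
    · exact ⟨_, by omega, Or.inl rfl, h2⟩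
    · exact ⟨_, by omega, Or.inr rfl, h.hasArc_sub h2⟩
  refine ⟨e, he1, he2, ?_, he3⟩
  have hlt : |c| < |e| := by
    rcases abs_cases c with ⟨a1, a2⟩ | ⟨a1, a2⟩ <;>
    rcases abs_cases e with ⟨a3, a4⟩ | ⟨a3, a4⟩ <;> omega
  -- A chain of arcs from c to e has |e| − |c| steps, each of which raises the length in W. It ends
  -- at the same element u s, whose length exceeds that of u by one, so there is just one step.
  obtain ⟨K, hK⟩ := exists_isChain hc he1 hlt
  obtain ⟨g, hg, hg0, hgq⟩ := hK.exists_isArcPath hc (by have := h.two_le; omega)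
  rw [← hg0] at hu
  have h3 := h.walk_length_le hg hu (Nat.zero_le q) le_rfl
  have h4 := h.walk_spec hg hu q le_rfl
  rw [hgq] at h4
  have h5 : walk P bt K u q = u * refl P (bt j) := by
    refine h.eq_of_hasArc ?_ h4 he3
    have := Subgroup.mul_mem _ (Subgroup.inv_mem _ (walk_mem (P := P) bt K u q))
      (IsDihedral.refl_mem (P := P) bt j)
    rwa [mul_inv_rev, inv_inv, mul_assoc] at this
  rw [h5, hg0, hgq, hcov, walk] at h3
  push_cast at h3
  omega

lemma exists_isArcPath (h : IsDihedral b q bt) (hu : HasArc b q bt u c) (hc : -q ≤ c ∧ c ≤ q)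
    (hK : IsCoverWalk b q bt u K) :
    ∃ g, IsArcPath q K g ∧ g 0 = c ∧ ∀ j ≤ q, HasArc b q bt (walk P bt K u j) (g j) := by
  classical
  -- The new arc is reduced modulo 2q into [−q, q], with preference for q over −q; this may differ
  -- from the arc provided by the cover property, but not in absolute value.
  let g : ℕ → ℤ := fun j => Nat.rec c (fun j e => if K (j + 1) then
    (if 2 * (j : ℤ) + 1 - e ≤ q then 2 * (j : ℤ) + 1 - e else 2 * (j : ℤ) + 1 - e - 2 * q) else e) j
  have hg : ∀ j, g (j + 1) = if K (j + 1) then (if 2 * (j : ℤ) + 1 - g j ≤ q then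
      2 * (j : ℤ) + 1 - g j else 2 * (j : ℤ) + 1 - g j - 2 * q) else g j := fun j => rfl
  have step : ∀ j < q, (-q ≤ g j ∧ g j ≤ q) ∧ HasArc b q bt (walk P bt K u j) (g j) →
      ((-q ≤ g (j + 1) ∧ g (j + 1) ≤ q) ∧ HasArc b q bt (walk P bt K u (j + 1)) (g (j + 1))) ∧
      (K (j + 1) → |g (j + 1)| = |g j| + 1) := by
    rintro j hj ⟨h1, h2⟩
    by_cases hj' : K (j + 1)
    · have hcov := hK j hj hj'
      rw [walk_succ_of_mem hj'] at hcov
      obtain ⟨e, he1, he2, he3, he4⟩ := h.exists_arc_of_cover h2 h1 (by omega) (by omega) hcov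
      rw [walk_succ_of_mem hj']
      have h3 := h.hasArc_mul_refl h2 (j + 1)
      rw [show 2 * ((j : ℤ) + 1) - 1 - g j = 2 * (j : ℤ) + 1 - g j by ring] at h3
      have h4 : g (j + 1) = e ∨ g (j + 1) = q ∧ e = -q := by
        rw [hg, if_pos hj']
        split_ifs <;> omega
      refine ⟨⟨?_, ?_⟩, fun _ => ?_⟩
      · omega
      · rw [hg, if_pos hj']
        split_ifs
        · exact h3
        · exact h.hasArc_sub h3
      · rcases h4 with h4 | ⟨h4, h5⟩
        · rw [h4, he3]
        · rw [h4, ← he3, h5, abs_neg]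
    · rw [walk_succ_of_notMem hj', hg, if_neg hj']
      exact ⟨⟨h1, h2⟩, fun h => absurd h hj'⟩
  have key : ∀ j ≤ q, (-q ≤ g j ∧ g j ≤ q) ∧ HasArc b q bt (walk P bt K u j) (g j) := by
    intro j hj
    induction j with
    | zero => exact ⟨hc, hu⟩
    | succ j ih => exact (step j hj (ih (by omega))).1
  refine ⟨g, ⟨fun j hj => (key j hj).1, fun j hj hj' => ?_, fun j hj => (step j hj (key j hj.le)).2,
    fun j hj hj' => by rw [hg, if_neg hj']⟩, rfl, fun j hj => (key j hj).2⟩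
  rw [hg, if_pos hj']
  split_ifs
  · exact Or.inl rfl
  · exact Or.inr rfl

/-- Increasing walks in a dihedral subgroup are determined by their end points. -/
lemma coverWalk_unique (h : IsDihedral b q bt) (hK : IsCoverWalk b q bt u K)
    (hK' : IsCoverWalk b q bt u K') (hw : walk P bt K u q = walk P bt K' u q) {x : ℕ}
    (hx : 1 ≤ x) (hxq : x ≤ q) : K x ↔ K' x := by
  obtain ⟨c, hc, hu⟩ := h.exists_hasArc u
  obtain ⟨g, hg, hg0, hga⟩ := h.exists_isArcPath hu hc hK
  obtain ⟨g', hg', hg0', hga'⟩ := h.exists_isArcPath hu hc hK'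
  have h1 := hg.isChainUpTo q le_rfl
  have h2 := hg'.isChainUpTo q le_rfl
  rw [hg0] at h1
  rw [hg0'] at h2
  refine IsChain.unique h1 h2 hc ?_ hx hxq
  have h3 := hga q le_rfl
  rw [hw] at h3
  exact h.arc_unique h3 (hga' q le_rfl) (hg.mem q le_rfl) (hg'.mem q le_rfl)

/-- The involution `Y_{q,a,b}` turns an increasing walk into the increasing walk with the same end
points for the opposite order of the roots. -/
lemma coverWalk_ybInvolution (h : IsDihedral b q bt) {K : Finset ℕ}
    (hKq : ∀ x ∈ K, 1 ≤ x ∧ x ≤ q) (hK : IsCoverWalk b q bt u (· ∈ K)) {w : P.weylGroup}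
    (hw : walk P bt (· ∈ K) u q = w) {K' : Finset ℕ}
    (hK' : K' = ybInvolution q
      (wordLength (refl P '' {bt 1, bt q}) ((minRep b (dihedralSubgroup P bt) u)⁻¹ * u))
      (wordLength (refl P '' {bt 1, bt q}) ((minRep b (dihedralSubgroup P bt) w)⁻¹ * w)) K) :
    walk P (fun j => bt (q + 1 - j)) (· ∈ K') u q = w ∧
      IsCoverWalk b q (fun j => bt (q + 1 - j)) u (· ∈ K') := by
  obtain ⟨c, hc, hu⟩ := h.exists_hasArc u
  obtain ⟨g, hg, hg0, hga⟩ := h.exists_isArcPath hu hc hK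
  have h1 := hg.isChainUpTo q le_rfl
  rw [hg0] at h1
  have hwa := hga q le_rfl
  rw [hw] at hwa
  rw [h.wordLength_eq_natAbs hu hc, h.wordLength_eq_natAbs hwa (hg.mem q le_rfl)] at hK'
  have h2 := IsChain.ybInvolution hKq h1 hc h.two_le
  rw [← hK'] at h2
  obtain ⟨g', hg', hg0', hgq'⟩ := h2.exists_isArcPath (by omega) (by have := h.two_le; omega)
  have hr := h.reverse
  have hu' : HasArc b q (fun j => bt (q + 1 - j)) u (g' 0) := hg0' ▸ hasArc_reverse hu
  have h3 := hr.walk_spec hg' hu' q le_rfl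
  rw [hgq'] at h3
  have h4 : walk P (fun j => bt (q + 1 - j)) (· ∈ K') u q = w := by
    refine hr.eq_of_hasArc ?_ h3 (hasArc_reverse hwa)
    have h5 := walk_mem (P := P) (fun j => bt (q + 1 - j)) (· ∈ K') u q
    have h6 := walk_mem (P := P) bt (· ∈ K) u q
    rw [dihedralSubgroup_reverse] at h5 ⊢
    rw [hw] at h6
    have := Subgroup.mul_mem _ (Subgroup.inv_mem _ h5) h6
    rwa [mul_inv_rev, inv_inv, mul_assoc, mul_inv_cancel_left] at this
  refine ⟨h4, fun j hj hj' => ?_⟩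
  -- Along the given cover walk ℓ − |g| is constant. Along the new walk it is nondecreasing and has
  -- the same values at both ends, so it is constant there too and every step is a cover.
  have e1 : ∀ i ≤ q, (length b (walk P bt (· ∈ K) u i) : ℤ) - |g i| = length b u - |c| := by
    intro i hi
    induction i with
    | zero => rw [walk, hg0]
    | succ i ih =>
      rw [← ih (by omega)]
      by_cases hi' : i + 1 ∈ K
      · rw [hK i hi hi', hg.length i hi hi']; push_cast; ring
      · rw [walk_succ_of_notMem (K := (· ∈ K)) hi', hg.keep i hi hi']
  have e1 := e1 q le_rfl
  have l1 := hr.walk_length_le hg' hu' (Nat.zero_le j) hj.le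
  have l2 := hr.walk_length hg' hu' j hj
  have l3 := hr.walk_length_le hg' hu' (i := j + 1) hj le_rfl
  rw [hg'.length j hj hj'] at l2 l3
  rw [h4, hgq', abs_neg] at l3
  rw [hg0', abs_neg, walk] at l1
  rw [hw] at e1
  omega

end IsDihedral

end AlcoveModel
end

/-! ### Cyclic order of the segment: simple roots of rank two positive systems. -/

noncomputable section

namespace AlcoveModel

open RootPairing

variable {ι M N : Type*} [AddCommGroup M] [Module ℝ M] [AddCommGroup N] [Module ℝ N]
  {P : RootPairing ι ℝ M N}

/-- `r` behaves as a simple root for the positive system `Z`. -/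
def IsEnd (P : RootPairing ι ℝ M N) (Z : Set ι) (r : ι) : Prop :=
  r ∈ Z ∧ ∀ x ∈ Z, x ≠ r → P.reflectionPerm r x ∈ Z

variable {b : P.Base} {q : ℕ} {bt : ℤ → ι}

variable [Finite ι] [P.IsRootSystem] [P.IsCrystallographic] [P.IsReduced]

/-- If the pairings were positive, s_s r and s_r s would be positive roots obtained by subtracting
positive multiples of the other root; then each of r and s would be higher than the other. -/
lemma IsEnd.pairingIn_nonpos {Z : Set ι} (hZ : ∀ x ∈ Z, b.IsPos x) {r s : ι} (hr : IsEnd P Z r)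
    (hs : IsEnd P Z s) (hrs : r ≠ s) : P.pairingIn ℤ r s ≤ 0 := by
  by_contra! hlt
  have hlt' := (P.zero_lt_pairingIn_iff' ℤ).mp hlt
  have h1 := hZ _ (hs.2 r hr.1 hrs)
  have h2 := hZ _ (hr.2 s hs.1 hrs.symm)
  have h3 := height_reflectionPerm b s r 1
  have h4 := height_reflectionPerm b r s 1
  have h5 := hZ r hr.1
  have h6 := hZ s hs.1
  simp only [map_one, Equiv.Perm.one_apply] at h3 h4
  rw [Base.isPos_iff] at h1 h2 h5 h6
  nlinarith

/-- Vectors in an open half-space with pairwise nonpositive inner products are linearly independent.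
-/
lemma linearIndependent_ends {Z : Set ι} (hZ : ∀ x ∈ Z, b.IsPos x) {κ : Type*} {r : κ → ι}
    (hr : Function.Injective r) (h : ∀ k, IsEnd P Z (r k)) :
    LinearIndependent ℝ fun k => P.root (r k) := by
  have : Fintype ι := Fintype.ofFinite ι
  let M₀ := Submodule.span ℝ (Set.range P.root)
  let v (k : κ) : M₀ := P.rootSpanMem ℝ (r k)
  change LinearIndependent ℝ (M₀.subtype ∘ v)
  suffices LinearIndependent ℝ v by
    rwa [LinearMap.linearIndependent_iff_of_disjoint M₀.subtype (by simp)]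
  obtain ⟨B, hB⟩ : ∃ B : P.RootPositiveForm ℝ, B.posForm.toQuadraticMap.PosDef :=
    ⟨P.posRootForm ℝ, by simpa using P.posRootForm_rootFormIn_posDef ℝ⟩
  -- For the dual system this yields a vector of N on which each root takes its height as value, and
  -- thereby defines the half-space.
  obtain ⟨x, hx⟩ := exists_forall_coroot'_eq_height b.flip
  refine LinearMap.BilinForm.linearIndependent_of_pairwise_le_zero B.posForm hB
    ((P.toLinearMap.flip x) ∘ₗ M₀.subtype) v (fun k => ?_) fun k l hkl => ?_
  · have h1 : (P.toLinearMap.flip x) (P.root (r k)) = (b.height (r k) : ℝ) := hx (r k)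
    have h2 := hZ _ (h k).1
    rw [Base.isPos_iff] at h2
    change 0 < (P.toLinearMap.flip x) (P.root (r k))
    rw [h1]
    exact_mod_cast h2
  · change B.posForm ⟨P.root (r k), _⟩ ⟨P.root (r l), _⟩ ≤ 0
    rw [B.posForm_apply_root_root_le_zero_iff, ← P.algebraMap_pairingIn' ℝ ℤ]
    have := IsEnd.pairingIn_nonpos hZ (h k) (h l) (hr.ne hkl)
    simpa using this

lemma IsEnd.eq_or_eq {Z : Set ι} (hZ : ∀ x ∈ Z, b.IsPos x)
    (hrk : Module.finrank ℝ (Submodule.span ℝ (P.root '' Z)) = 2) {r₁ r₂ r₃ : ι}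
    (h₁ : IsEnd P Z r₁) (h₂ : IsEnd P Z r₂) (h₃ : IsEnd P Z r₃) (hne : r₁ ≠ r₂) :
    r₃ = r₁ ∨ r₃ = r₂ := by
  by_contra! hn
  have hinj : Function.Injective ![r₁, r₂, r₃] := by
    intro i j hij
    fin_cases i <;> fin_cases j <;> simp_all
  have hends : ∀ k, IsEnd P Z (![r₁, r₂, r₃] k) := by
    intro k; fin_cases k
    · exact h₁
    · exact h₂
    · exact h₃
  have hli := linearIndependent_ends hZ hinj hends
  let v : Fin 3 → Submodule.span ℝ (P.root '' Z) := fun k =>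
    ⟨P.root (![r₁, r₂, r₃] k), Submodule.subset_span ⟨_, (hends k).1, rfl⟩⟩
  have hv : LinearIndependent ℝ v := by
    apply LinearIndependent.of_comp (Submodule.subtype _)
    exact hli
  have : Module.Finite ℝ (Submodule.span ℝ (P.root '' Z)) :=
    FiniteDimensional.span_of_finite ℝ (Set.toFinite _)
  have := hv.fintype_card_le_finrank
  rw [hrk, Fintype.card_fin] at this
  omega

lemma IsEnd.reflect {Z Z' : Set ι} {a r : ι} (h1 : ∀ x ∈ Z, P.reflectionPerm a x ∈ Z')
    (h2 : ∀ x ∈ Z', P.reflectionPerm a x ∈ Z) (h : IsEnd P Z r) :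
    IsEnd P Z' (P.reflectionPerm a r) := by
  refine ⟨h1 r h.1, fun x hx hne => ?_⟩
  have h3 := h.2 _ (h2 x hx) fun he => hne (by rw [← he, P.reflectionPerm_self])
  have h4 := h1 _ h3
  rwa [← act_refl, act_reflectionPerm, act_refl, P.reflectionPerm_self] at h4

namespace IsRootCycle

/-- The positive system of the roots with labels `c + 1, …, c + q`. -/
def arc (bt : ℤ → ι) (q : ℕ) (c : ℤ) : Set ι := bt '' Set.Ioc c (c + q)

lemma succ_ne (h : IsRootCycle b q bt) {j : ℤ} (hj : 0 ≤ j) (hjq : j ≤ q) :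
    bt (j + 1) ≠ bt (j + q) := by
  have h2 := h.two_le
  intro he
  rcases hj.eq_or_lt with rfl | hj
  · have := h.inj _ _ (by omega) (by omega) (by omega) (by omega) he
    omega
  rw [h.add_period] at he
  rcases hjq.eq_or_lt with rfl | hjq
  · rw [add_comm, h.add_period] at he
    have := h.inj _ _ (by omega) (by omega) (by omega) (by omega) (opp_injective he)
    omega
  · have h3 := h.pos (j + 1) (by omega) (by omega)
    rw [he, isPos_opp] at h3
    exact h3 (h.pos j (by omega) (by omega))

end IsRootCycle

open IsRootCycle in
/-- The reflections in the roots of the cycle move the positive system of the positive roots stepwise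
to the one of the negative roots. -/
structure IsReflectingCycle (b : P.Base) (q : ℕ) (bt : ℤ → ι) : Prop extends
    IsRootCycle b q bt where
  up : ∀ j : ℤ, 0 ≤ j → j < q → ∀ x ∈ arc bt q j, P.reflectionPerm (bt (j + 1)) x ∈ arc bt q (j + 1)
  down : ∀ j : ℤ, 0 ≤ j → j < q → ∀ x ∈ arc bt q (j + 1),
    P.reflectionPerm (bt (j + 1)) x ∈ arc bt q j
  rank : Module.finrank ℝ (Submodule.span ℝ (P.root '' arc bt q 0)) = 2

namespace IsReflectingCycle

open IsRootCycle

/-- The other roots of the arc j also belong to the arc j + 1, which this reflection maps back into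
the arc j. -/
lemma isEnd_first (h : IsReflectingCycle b q bt) {j : ℤ} (hj : 0 ≤ j) (hjq : j < q) :
    IsEnd P (arc bt q j) (bt (j + 1)) := by
  have := h.two_le
  refine ⟨⟨j + 1, ⟨by omega, by omega⟩, rfl⟩, ?_⟩
  rintro _ ⟨i, hi, rfl⟩ hne
  have hij : i ≠ j + 1 := fun h => hne (by rw [h])
  rw [Set.mem_Ioc] at hi
  exact h.down j hj hjq _ ⟨i, ⟨by omega, by omega⟩, rfl⟩

lemma isEnd_last (h : IsReflectingCycle b q bt) {j : ℤ} (hj : 0 ≤ j) (hjq : j < q) :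
    IsEnd P (arc bt q (j + 1)) (bt (j + 1 + q)) := by
  have := h.two_le
  refine ⟨⟨j + 1 + q, ⟨by omega, by omega⟩, rfl⟩, ?_⟩
  rintro _ ⟨i, hi, rfl⟩ hne
  have hij : i ≠ j + 1 + q := fun h => hne (by rw [h])
  rw [Set.mem_Ioc] at hi
  rw [h.add_period, reflectionPerm_opp_left]
  exact h.up j hj hjq _ ⟨i, ⟨by omega, by omega⟩, rfl⟩

/-- The arc q is the negative of the arc 0, so the last end of the arc q gives the last end of the
arc 0. -/
lemma arc_zero_last (h : IsReflectingCycle b q bt) : IsEnd P (arc bt q 0) (bt q) := by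
  have h2 := h.two_le
  have key := h.isEnd_last (j := q - 1) (by omega) (by omega)
  rw [sub_add_cancel] at key
  have harc : ∀ x, x ∈ arc bt q q ↔ opp P x ∈ arc bt q 0 := by
    intro x
    constructor
    · rintro ⟨i, hi, rfl⟩
      rw [Set.mem_Ioc] at hi
      exact ⟨i - q, ⟨by omega, by omega⟩, h.sub_period i⟩
    · rintro ⟨i, hi, hix⟩
      rw [Set.mem_Ioc] at hi
      refine ⟨i + q, ⟨by omega, by omega⟩, ?_⟩
      rw [h.add_period, hix, opp_opp]
  rw [h.add_period] at key
  refine ⟨⟨q, ⟨by omega, by omega⟩, rfl⟩, fun x hx hne => ?_⟩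
  have := key.2 (opp P x) ((harc _).mpr (by rwa [opp_opp])) fun he => hne (opp_injective he)
  rwa [harc, reflectionPerm_opp_left, reflectionPerm_opp, opp_opp] at this

/-- The bound of two ends comes from the rank for the arc 0, where all roots are positive for the
base; the reflections carry it to the other arcs. -/
lemma eq_or_eq_of_isEnd (h : IsReflectingCycle b q bt) (j : ℕ) (hj : j ≤ q) {r₁ r₂ r₃ : ι}
    (h₁ : IsEnd P (arc bt q j) r₁) (h₂ : IsEnd P (arc bt q j) r₂)
    (h₃ : IsEnd P (arc bt q j) r₃) (hne : r₁ ≠ r₂) : r₃ = r₁ ∨ r₃ = r₂ := by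
  induction j generalizing r₁ r₂ r₃ with
  | zero =>
    refine IsEnd.eq_or_eq (b := b) ?_ h.rank h₁ h₂ h₃ hne
    rintro _ ⟨i, hi, rfl⟩
    rw [Set.mem_Ioc] at hi
    exact h.pos i (by omega) (by omega)
  | succ j ih =>
    rw [Nat.cast_succ] at h₁ h₂ h₃
    have h4 : ∀ {r}, IsEnd P (arc bt q (j + 1)) r →
        IsEnd P (arc bt q j) (P.reflectionPerm (bt (j + 1)) r) := fun h5 =>
      h5.reflect (h.down j (by omega) (by omega)) (h.up j (by omega) (by omega))
    rcases ih (by omega) (h4 h₁) (h4 h₂) (h4 h₃)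
      (fun he => hne ((P.reflectionPerm _).injective he)) with h5 | h5
    · exact Or.inl ((P.reflectionPerm _).injective h5)
    · exact Or.inr ((P.reflectionPerm _).injective h5)

/-- The root with label j + 2 is an end of the arc j + 1, so its reflection is one of the two ends
of the arc j. It is not the one with label j + 1, since that is the reflection of its own negative;
so it is the other one. -/
lemma reflect_succ_of_lt (h : IsReflectingCycle b q bt) (j : ℕ) (hj : j < q) :
    P.reflectionPerm (bt (j + 1)) (bt (j + 1 + 1)) = bt (j + q) := by
  have h2 := h.two_le
  have e1 := h.isEnd_first (j := j) (by omega) (by omega)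
  have e2 : IsEnd P (arc bt q j) (bt (j + q)) := by
    rcases Nat.eq_zero_or_pos j with rfl | hj0
    · simpa using h.arc_zero_last
    · have := h.isEnd_last (j := j - 1) (by omega) (by omega)
      rwa [sub_add_cancel] at this
  have e3 : IsEnd P (arc bt q (j + 1)) (bt (j + 1 + 1)) := by
    by_cases hjq : j + 1 < q
    · exact h.isEnd_first (by omega) (by omega)
    · have hjq : (j : ℤ) + 1 = q := by omega
      have h0 := h.isEnd_first (j := 0) le_rfl (by omega)
      refine ⟨⟨j + 1 + 1, ⟨by omega, by omega⟩, rfl⟩, ?_⟩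
      rintro _ ⟨i, hi, rfl⟩ hne
      rw [Set.mem_Ioc] at hi
      have hb : bt ((j : ℤ) + 1 + 1) = opp P (bt (0 + 1)) := by
        rw [hjq, ← h.add_period]; congr 1; ring
      rw [hb] at hne ⊢
      have := h0.2 (bt (i - q)) ⟨i - q, ⟨by omega, by omega⟩, rfl⟩ fun he =>
        hne (by rw [← he, h.sub_period, opp_opp])
      obtain ⟨k, hk, hk'⟩ := this
      rw [Set.mem_Ioc] at hk
      refine ⟨k + q, ⟨by omega, by omega⟩, ?_⟩
      rw [h.add_period, hk', h.sub_period, reflectionPerm_opp, opp_opp, reflectionPerm_opp_left]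
  have e4 := e3.reflect (h.down j (by omega) (by omega)) (h.up j (by omega) (by omega))
  rcases h.eq_or_eq_of_isEnd j hj.le e1 e2 e4 (h.succ_ne (by omega) (by omega)) with e5 | e5
  · exfalso
    have e6 := congrArg (P.reflectionPerm (bt (j + 1))) e5
    rw [P.reflectionPerm_self] at e6
    refine h.succ_ne (j := j + 1) (by omega) (by omega) ?_
    rw [e6, h.add_period, opp]
  · exact e5

lemma reflect_succ (h : IsReflectingCycle b q bt) (j : ℤ) :
    P.reflectionPerm (bt j) (bt (j + 1)) = bt (j - 1 + q) := by
  have hq : (0 : ℤ) < q := by have := h.two_le; omega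
  have h0 := Int.emod_nonneg (j - 1) hq.ne'
  have h1 := Int.emod_lt_of_pos (j - 1) hq
  have h2 := Int.emod_add_mul_ediv (j - 1) q
  have key : ∀ k : ℤ, ∀ i, P.reflectionPerm (bt i) (bt (i + 1)) = bt (i - 1 + q) →
      P.reflectionPerm (bt (i + k * q)) (bt (i + k * q + 1)) = bt (i + k * q - 1 + q) := by
    intro k i hi
    induction k with
    | zero => simpa using hi
    | succ k ih =>
      rw [show i + ((k : ℤ) + 1) * q = i + k * q + q by ring,
        show i + (k : ℤ) * q + q + 1 = i + k * q + 1 + q by ring,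
        show i + (k : ℤ) * q + q - 1 = i + k * q - 1 + q by ring,
        h.add_period, h.add_period, h.add_period (_ + _), reflectionPerm_opp_left,
        reflectionPerm_opp, ih]
    | pred k ih =>
      rw [show i + (-(k : ℤ) - 1) * q = i + -(k : ℤ) * q - q by ring,
        show i + -(k : ℤ) * q - q + 1 = i + -(k : ℤ) * q + 1 - q by ring,
        show i + -(k : ℤ) * q - q - 1 + q = i + -(k : ℤ) * q - 1 + q - q by ring,
        h.sub_period, h.sub_period, h.sub_period (_ + _), reflectionPerm_opp_left,
        reflectionPerm_opp, ih]
  have h3 := h.reflect_succ_of_lt ((j - 1) % q).toNat (by omega)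
  rw [Int.toNat_of_nonneg h0] at h3
  have h4 := key ((j - 1) / q) ((j - 1) % q + 1) (by rw [h3]; congr 1; ring)
  rwa [show (j - 1) % q + 1 + (j - 1) / q * q = j by linarith] at h4

/-- The reflections act on the cycle of roots as in a dihedral group. -/
theorem isDihedral (h : IsReflectingCycle b q bt) : IsDihedral b q bt where
  toIsRootCycle := h.toIsRootCycle
  reflect := by
    have hq : 0 < q := by have := h.two_le; omega
    -- Two consecutive labels are carried through the induction, because `bt (i + 1)` is obtained by
    -- reflecting the negative of `bt (i - 1)` in `bt i`.
    have up : ∀ (j : ℤ) (k : ℕ),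
        P.reflectionPerm (bt j) (bt (j + k)) = bt (2 * j - (j + k) + q) ∧
        P.reflectionPerm (bt j) (bt (j + k + 1)) = bt (2 * j - (j + k + 1) + q) := by
      intro j k
      induction k with
      | zero =>
        constructor
        · rw [Nat.cast_zero, add_zero, show 2 * j - j + q = j + q by ring, h.add_period, opp]
        · rw [Nat.cast_zero, add_zero, h.reflect_succ]; congr 1; ring
      | succ k ih =>
        obtain ⟨ih1, ih2⟩ := ih
        refine ⟨by rw [Nat.cast_succ, ← add_assoc, ih2], ?_⟩
        obtain ⟨i, hi⟩ : ∃ i, i = j + k + 1 := ⟨_, rfl⟩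
        have h1 : bt (i + 1) = P.reflectionPerm (bt i) (bt (i - 1 + q)) := by
          rw [← h.reflect_succ, P.reflectionPerm_self]
        rw [Nat.cast_succ, ← add_assoc, ← hi]
        rw [← hi] at ih2
        rw [h1, ← act_refl, act_reflectionPerm, act_refl, ih2, h.add_period (i - 1), reflectionPerm_opp,
          show i - 1 = j + k by rw [hi]; ring, ih1,
          show 2 * j - (j + k) + q = 2 * j - i + q + 1 by rw [hi]; ring, reflectionPerm_opp,
          h.reflect_succ, ← h.add_period, ← h.add_two_period (2 * j - (i + 1) + q)]
        congr 1; ring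
    have down : ∀ (i j : ℤ), P.reflectionPerm (bt j) (bt (i + q)) = bt (2 * j - (i + q) + q) →
        P.reflectionPerm (bt j) (bt i) = bt (2 * j - i + q) := by
      intro i j hij
      rw [h.add_period, reflectionPerm_opp, opp_eq_iff, ← h.add_period] at hij
      rw [hij]; congr 1; ring
    have down' : ∀ (k : ℕ) (i j : ℤ),
        P.reflectionPerm (bt j) (bt (i + k * q)) = bt (2 * j - (i + k * q) + q) →
        P.reflectionPerm (bt j) (bt i) = bt (2 * j - i + q) := by
      intro k
      induction k with
      | zero => intro i j hij; simpa using hij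
      | succ k ih =>
        intro i j hij
        refine down i j (ih (i + q) j ?_)
        rwa [show i + q + (k : ℤ) * q = i + ((k + 1 : ℕ) : ℤ) * q by push_cast; ring]
    intro i j
    refine down' (j - i).toNat i j ?_
    -- Shifting i by a multiple of q, which costs only a sign, reduces to labels at least j.
    have hle : j ≤ i + (j - i).toNat * q := by
      have : j - i ≤ (j - i).toNat := Int.self_le_toNat _
      nlinarith
    obtain ⟨k, hk⟩ := Int.eq_ofNat_of_zero_le (sub_nonneg.mpr hle)
    have := (up j k).1
    rwa [show j + (k : ℤ) = i + (j - i).toNat * q by rw [← hk]; ring] at this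

end IsReflectingCycle

end AlcoveModel
end

/-! ### Offsets: the codimension two face around which the segment turns. -/

noncomputable section

namespace AlcoveModel

open RootPairing

variable {ι M N : Type*} [AddCommGroup M] [Module ℝ M] [AddCommGroup N] [Module ℝ N]
  {P : RootPairing ι ℝ M N} {n : ℕ}

open IsRootCycle

/-- The roots of `Γ` in the segment of length `q` after the first `t` ones are the positive roots
of the cycle `bt`. -/
structure IsSegment (b : P.Base) (Γ : Fin n → ι) (t q : ℕ) (bt : ℤ → ι) : Prop extends
    IsRootCycle b q bt where
  le : t + q ≤ n
  label : ∀ (j : ℕ) (hj : j < q), Γ ⟨t + j, by omega⟩ = bt (j + 1)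
  closed : ∀ x ∈ Set.range bt, ∀ y ∈ Set.range bt, P.reflectionPerm x y ∈ Set.range bt

variable [Finite ι] [P.IsRootSystem] [P.IsCrystallographic] [P.IsReduced]
  {b : P.Base} {Γ : Fin n → ι} {lam : M} {t q : ℕ} {bt : ℤ → ι}

namespace IsSegment

lemma strip_of_mem (h : IsSegment b Γ t q bt) (j : ℕ) (hj : j ≤ q) {i : ℤ} (hi : 1 ≤ i)
    (hiq : i ≤ q) : strip b Γ (t + j) (bt i) = strip b Γ t (bt i) + if i ≤ j then 1 else 0 := by
  induction j with
  | zero => simp; omega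
  | succ j ih =>
    have ih := ih (by omega)
    have hl := h.label j (by omega)
    have hp := h.pos (j + 1) (by omega) (by omega)
    by_cases hij : i = j + 1
    · subst hij
      have := strip_succ_self (b := b) (Γ := Γ) (i := ⟨t + j, by have := h.le; omega⟩) (by rwa [hl])
      rw [hl] at this
      rw [if_pos (by push_cast; omega), ← add_assoc, this, ih, if_neg (by omega)]
      ring
    · have := strip_succ_of_ne (b := b) (Γ := Γ) (i := ⟨t + j, by have := h.le; omega⟩) (α := bt i)
        (by rw [hl]; exact fun he => hij (h.inj _ _ hi hiq (by omega) (by omega) he))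
        (by
          rw [hl]; intro he
          have := h.pos i hi hiq
          rw [he, isPos_opp] at this
          exact this hp)
      rw [← add_assoc, this, ih]
      congr 1
      push_cast
      split_ifs <;> omega

lemma strip_of_notMem (h : IsSegment b Γ t q bt) (j : ℕ) (hj : j ≤ q) {x : ι}
    (hx : x ∉ Set.range bt) : strip b Γ (t + j) x = strip b Γ t x := by
  induction j with
  | zero => rfl
  | succ j ih =>
    have hl := h.label j (by omega)
    have := strip_succ_of_ne (b := b) (Γ := Γ) (i := ⟨t + j, by have := h.le; omega⟩) (α := x)
      (by rw [hl]; rintro rfl; exact hx ⟨_, rfl⟩)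
      (by rw [hl]; rintro rfl; exact hx (h.mem_range_opp ⟨_, rfl⟩))
    rw [← add_assoc, this, ih (by omega)]

end IsSegment

/-- The level of the hyperplane orthogonal to `x` that contains the face of codimension two around
which the segment after `t` steps turns. -/
def offset (b : P.Base) (Γ : Fin n → ι) (t : ℕ) (x : ι) : ℤ := strip b Γ t x - strip₀ b x

lemma offset_opp (t : ℕ) (x : ι) : offset b Γ t (opp P x) = -offset b Γ t x := by
  rw [offset, offset, strip_opp, strip₀_opp]; ring

lemma offset_of_isPos {x : ι} (hx : b.IsPos x) : offset b Γ t x = strip b Γ t x := by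
  rw [offset, strip₀, if_pos hx, sub_zero]

namespace IsSegment

lemma mem_arc_cases (h : IsSegment b Γ t q bt) (c : ℤ) {x : ι} (hx : x ∈ Set.range bt) :
    x ∈ arc bt q c ∨ opp P x ∈ arc bt q c := by
  obtain ⟨j, rfl⟩ := hx
  obtain ⟨i, h1, h2, h3 | h3⟩ := h.exists_eq c j
  · exact Or.inl ⟨i, ⟨h1, h2⟩, h3.symm⟩
  · exact Or.inr ⟨i, ⟨h1, h2⟩, by rw [h3, opp_opp]⟩

/-- After j steps of the segment, the hyperplanes with labels 1, …, j have been crossed once and the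
others not at all. So the roots of the arc j are at their offset, and their negatives one above. -/
lemma strip_of_mem_arc (h : IsSegment b Γ t q bt) (j : ℕ) (hj : j ≤ q) {x : ι}
    (hx : x ∈ arc bt q j) : strip b Γ (t + j) x = offset b Γ t x := by
  obtain ⟨i, hi, rfl⟩ := hx
  rw [Set.mem_Ioc] at hi
  by_cases hiq : i ≤ q
  · rw [h.strip_of_mem j hj (by omega) hiq, if_neg (by omega), add_zero,
      offset_of_isPos (h.pos i (by omega) hiq)]
  · have h1 := h.add_period (i - q)
    rw [sub_add_cancel] at h1
    rw [h1, offset_opp, strip_opp, h.strip_of_mem j hj (by omega) (by omega), if_pos (by omega),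
      offset_of_isPos (h.pos _ (by omega) (by omega))]
    ring

lemma strip_of_opp_mem_arc (h : IsSegment b Γ t q bt) (j : ℕ) (hj : j ≤ q) {x : ι}
    (hx : opp P x ∈ arc bt q j) : strip b Γ (t + j) x = offset b Γ t x + 1 := by
  have := h.strip_of_mem_arc j hj hx
  rw [strip_opp, offset_opp] at this
  omega

lemma mem_arc_iff (h : IsSegment b Γ t q bt) (j : ℕ) (hj : j ≤ q) {x : ι}
    (hx : x ∈ Set.range bt) : x ∈ arc bt q j ↔ strip b Γ (t + j) x = offset b Γ t x := by
  refine ⟨h.strip_of_mem_arc j hj, fun he => ?_⟩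
  rcases h.mem_arc_cases j hx with h1 | h1
  · exact h1
  · have := h.strip_of_opp_mem_arc j hj h1
    omega

lemma strip_mem_range (h : IsSegment b Γ t q bt) (j : ℕ) (hj : j ≤ q) {x : ι}
    (hx : x ∈ Set.range bt) :
    strip b Γ (t + j) x = offset b Γ t x ∨ strip b Γ (t + j) x = offset b Γ t x + 1 := by
  rcases h.mem_arc_cases j hx with h1 | h1
  · exact Or.inl (h.strip_of_mem_arc j hj h1)
  · exact Or.inr (h.strip_of_opp_mem_arc j hj h1)

lemma strip_end (h : IsSegment b Γ t q bt) {x : ι} (hx : x ∈ Set.range bt) :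
    strip b Γ (t + q) x = offset b Γ t x + 1 - strip₀ b x := by
  by_cases hp : b.IsPos x
  · obtain ⟨i, h1, h2, rfl⟩ := h.exists_eq_of_isPos hx hp
    rw [h.strip_of_mem q le_rfl h1 h2, if_pos h2, offset_of_isPos hp, strip₀, if_pos hp, sub_zero]
  · obtain ⟨i, h1, h2, h3⟩ := h.exists_eq_of_isPos (h.mem_range_opp hx) ((isPos_opp b).mpr hp)
    have h4 := h.strip_of_mem q le_rfl h1 h2
    rw [← h3, if_pos h2, strip_opp, strip_opp] at h4
    rw [offset, strip₀, if_neg hp]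
    omega

end IsSegment

lemma coroot_act_reflectionPerm (a x : ι) : P.coroot (P.reflectionPerm a x) =
    P.coroot x - (P.pairingIn ℤ a x : ℝ) • P.coroot a := by
  rw [coroot_reflectionPerm, coreflection_apply_coroot, pairing_eq_intCast]

lemma pairingIn_add {x y z : ι} (h : P.coroot x + P.coroot y = P.coroot z) (a : ι) :
    P.pairingIn ℤ a x + P.pairingIn ℤ a y = P.pairingIn ℤ a z := by
  have : P.pairing a x + P.pairing a y = P.pairing a z := by
    simp only [pairing]
    rw [← map_add, h]
  simp only [pairing_eq_intCast] at this
  exact_mod_cast this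

lemma flip_height_add {x y z : ι} (h : P.coroot x + P.coroot y = P.coroot z) :
    b.flip.height x + b.flip.height y = b.flip.height z := by
  obtain ⟨v, hv⟩ := exists_forall_coroot'_eq_height b
  have h1 : P.coroot' x v + P.coroot' y v = P.coroot' z v := by
    change P.toLinearMap v (P.coroot x) + P.toLinearMap v (P.coroot y) = P.toLinearMap v (P.coroot z)
    rw [← map_add, h]
  rw [hv, hv, hv] at h1
  exact_mod_cast h1

lemma strip₀_add {x y z : ι} (h : P.coroot x + P.coroot y = P.coroot z) :
    0 ≤ strip₀ b x + strip₀ b y - strip₀ b z ∧ strip₀ b x + strip₀ b y - strip₀ b z ≤ 1 := by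
  have h1 := flip_height_add (b := b) h
  have h2 : ∀ x : ι, b.IsPos x ↔ 0 < b.flip.height x := fun x => by
    rw [← flip_isPos, Base.isPos_iff]
  have h3 : ∀ x : ι, b.flip.height x ≠ 0 := fun x => b.flip.height_ne_zero x
  have hx := h3 x
  have hy := h3 y
  have hz := h3 z
  simp only [strip₀, h2]
  split_ifs <;> omega

namespace IsAlcovePath

/-- The inequalities hold for the fundamental alcove because heights of coroots are additive. The
field `step` carries them from alcove to alcove, since a reflection preserves additive relations
between coroots. -/
lemma strip_add (h : IsAlcovePath b lam Γ) (i : ℕ) (hi : i ≤ n) {x y z : ι}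
    (hxyz : P.coroot x + P.coroot y = P.coroot z) :
    0 ≤ strip b Γ i x + strip b Γ i y - strip b Γ i z ∧
      strip b Γ i x + strip b Γ i y - strip b Γ i z ≤ 1 := by
  induction i generalizing x y z with
  | zero => simp only [strip_zero]; exact strip₀_add hxyz
  | succ i ih =>
    have h1 : P.coroot (P.reflectionPerm (Γ ⟨i, hi⟩) x) + P.coroot (P.reflectionPerm (Γ ⟨i, hi⟩) y) =
        P.coroot (P.reflectionPerm (Γ ⟨i, hi⟩) z) := by
      rw [coroot_reflectionPerm, coroot_reflectionPerm, coroot_reflectionPerm, ← map_add, hxyz]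
    have h2 := ih (by omega) h1
    have h3 := pairingIn_add h1 (Γ ⟨i, hi⟩)
    have h4 := fun x => h.step ⟨i, hi⟩ (P.reflectionPerm (Γ ⟨i, hi⟩) x)
    simp only [P.reflectionPerm_self] at h4
    have h5 := h4 x
    have h6 := h4 y
    have h7 := h4 z
    rw [← h5, ← h6, ← h7, ← h3, mul_add] at h2
    constructor <;> linarith [h2.1, h2.2]

/-- Let o be the defect of additivity. The bounds of `strip_add` before and after the segment
contain the initial positions with opposite signs; their sum is 0 ≤ 2o + 1 ≤ 2, whence o = 0. -/
lemma offset_add {x y z : ι} (h : IsAlcovePath b lam Γ) (hs : IsSegment b Γ t q bt)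
    (hx : x ∈ Set.range bt) (hy : y ∈ Set.range bt) (hz : z ∈ Set.range bt)
    (hxyz : P.coroot x + P.coroot y = P.coroot z) :
    offset b Γ t x + offset b Γ t y = offset b Γ t z := by
  have h1 := h.strip_add t (by have := hs.le; omega) hxyz
  have h2 := h.strip_add (t + q) hs.le hxyz
  rw [hs.strip_end hx, hs.strip_end hy, hs.strip_end hz] at h2
  simp only [offset] at h2 ⊢
  omega

/-- The coroot of s_a x is reached from x^∨ by adding ±a^∨ at most three times, through coroots of
the subsystem, and the offset is additive at each addition. Geometrically, the hyperplanes with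
these offsets are permuted by the reflections in them. -/
lemma offset_reflect {a x : ι} (h : IsAlcovePath b lam Γ) (hs : IsSegment b Γ t q bt)
    (ha : a ∈ Set.range bt) (hx : x ∈ Set.range bt) :
    offset b Γ t (P.reflectionPerm a x) + offset b Γ t a * P.pairingIn ℤ a x = offset b Γ t x := by
  have main : ∀ a x : ι, a ∈ Set.range bt → x ∈ Set.range bt → P.pairingIn ℤ a x ≤ 0 →
      offset b Γ t (P.reflectionPerm a x) + offset b Γ t a * P.pairingIn ℤ a x = offset b Γ t x := by
    intro a x ha hx hle
    have hc := coroot_act_reflectionPerm (P := P) a x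
    have hmem := hs.closed a ha x hx
    by_cases e1 : a = x
    · subst e1
      rw [pairingIn_same] at hle
      omega
    by_cases e2 : a = opp P x
    · subst e2
      rw [pairingIn_opp_left, pairingIn_same, reflectionPerm_opp_left, offset_opp]
      change offset b Γ t (opp P x) + _ = _
      rw [offset_opp]; ring
    have hset := P.pairingIn_pairingIn_mem_set_of_isCrystal_of_isRed' a x
      (fun he => e1 (P.root.injective he)) (fun he => e2 (P.root.injective (by rw [he, root_opp])))
    have hy := hs.closed x hx a ha
    have hcy := coroot_act_reflectionPerm (P := P) x a
    have zero : P.pairingIn ℤ a x = 0 → offset b Γ t (P.reflectionPerm a x) +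
        offset b Γ t a * P.pairingIn ℤ a x = offset b Γ t x := fun h0 => by
      have : P.reflectionPerm a x = x := by
        apply P.coroot.injective
        rw [hc, h0]; simp
      rw [this, h0]; ring
    have one : ∀ y ∈ Set.range bt, P.pairingIn ℤ a y = -1 →
        offset b Γ t (P.reflectionPerm a y) = offset b Γ t y + offset b Γ t a := fun y hy h1 => by
      refine (h.offset_add hs hy ha (hs.closed a ha y hy) ?_).symm
      rw [coroot_act_reflectionPerm, h1]; simp
    have step : P.pairingIn ℤ x a = -1 →
        P.coroot (P.reflectionPerm x a) = P.coroot x + P.coroot a := fun h1 => by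
      rw [hcy, h1]; simp [add_comm]
    simp only [Set.mem_insert_iff, Set.mem_singleton_iff, Prod.mk.injEq] at hset
    have hyp : P.pairingIn ℤ x a = -1 → P.pairingIn ℤ a (P.reflectionPerm x a) =
        P.pairingIn ℤ a x + 2 := fun h1 => by
      rw [← pairingIn_add (step h1).symm, pairingIn_same]
    rcases hset with h0 | h0 | h0 | h0 | h0 | h0 | h0 | h0 | h0 | h0 | h0
    · exact zero h0.1
    · omega
    · rw [one x hx h0.1, h0.1]; ring
    · omega
    · omega
    · rw [one x hx h0.1, h0.1]; ring
    · have o1 := h.offset_add hs hx ha hy (step h0.2).symm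
      have h4 := hyp h0.2
      have h5 : P.coroot (P.reflectionPerm x a) + P.coroot a = P.coroot (P.reflectionPerm a x) := by
        rw [hc, step h0.2, h0.1]; push_cast; module
      have o2 := h.offset_add hs hy ha hmem h5
      rw [h0.1]; linarith
    · omega
    · omega
    · rw [one x hx h0.1, h0.1]; ring
    -- Pairing −3: the intermediate coroots x^∨ + a^∨ and x^∨ + 2a^∨ belong to s_x a and s_a s_x a.
    · have o1 := h.offset_add hs hx ha hy (step h0.2).symm
      have h4 := hyp h0.2
      have o2 := one _ hy (by rw [h4, h0.1]; rfl)
      have hm2 := hs.closed a ha _ hy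
      have h5 : P.coroot (P.reflectionPerm a (P.reflectionPerm x a)) + P.coroot a =
          P.coroot (P.reflectionPerm a x) := by
        rw [coroot_act_reflectionPerm a (P.reflectionPerm x a), h4, hc, step h0.2, h0.1]
        push_cast; module
      have o3 := h.offset_add hs hm2 ha hmem h5
      rw [h0.1]; linarith
  rcases le_total (P.pairingIn ℤ a x) 0 with hle | hle
  · exact main a x ha hx hle
  · have := main (opp P a) x (hs.mem_range_opp ha) hx (by rw [pairingIn_opp_left]; omega)
    rw [pairingIn_opp_left, reflectionPerm_opp_left, offset_opp] at this
    linarith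

end IsAlcovePath

end AlcoveModel
end

/-! ### The root cycle of a segment, and reversal of the segment. -/

noncomputable section

namespace AlcoveModel

open RootPairing IsRootCycle

variable {ι M N : Type*} [AddCommGroup M] [Module ℝ M] [AddCommGroup N] [Module ℝ N]
  {P : RootPairing ι ℝ M N} {n : ℕ}
  [Finite ι] [P.IsRootSystem] [P.IsCrystallographic] [P.IsReduced]
  {b : P.Base} {Γ : Fin n → ι} {lam : M} {t q : ℕ} {bt : ℤ → ι}

/-- The positive roots of a segment, continued periodically by their negatives. -/
def segRoot (P : RootPairing ι ℝ M N) (Γ : Fin n → ι) (t q : ℕ) (h : 0 < q ∧ t + q ≤ n) (i : ℤ) : ι :=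
  if Even ((i - 1) / q) then
    Γ ⟨t + ((i - 1) % q).toNat, by have := Int.emod_lt_of_pos (i - 1) (b := q) (by omega); omega⟩
  else opp P
    (Γ ⟨t + ((i - 1) % q).toNat, by have := Int.emod_lt_of_pos (i - 1) (b := q) (by omega); omega⟩)

lemma segRoot_add_period (h : 0 < q ∧ t + q ≤ n) (i : ℤ) :
    segRoot P Γ t q h (i + q) = opp P (segRoot P Γ t q h i) := by
  have hq : (q : ℤ) ≠ 0 := by omega
  have h1 : (i + q - 1) / q = (i - 1) / q + 1 := by
    rw [show i + q - 1 = i - 1 + 1 * q by ring, Int.add_mul_ediv_right _ _ hq]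
  have h2 : (i + q - 1) % q = (i - 1) % q := by
    rw [show i + q - 1 = i - 1 + q by ring, Int.add_emod_right]
  simp only [segRoot, h1, h2, Int.even_add_one]
  split_ifs <;> simp

lemma segRoot_of_lt (h : 0 < q ∧ t + q ≤ n) (j : ℕ) (hj : j < q) :
    segRoot P Γ t q h (j + 1) = Γ ⟨t + j, by omega⟩ := by
  have h1 : ((j : ℤ) + 1 - 1) / q = 0 := by
    rw [add_sub_cancel_right]; exact Int.ediv_eq_zero_of_lt (by omega) (by omega)
  have h2 : ((j : ℤ) + 1 - 1) % q = j := by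
    rw [add_sub_cancel_right]; exact Int.emod_eq_of_lt (by omega) (by omega)
  simp only [segRoot, h1, h2]
  simp

lemma IsDihedralSegment.two_le (hs : IsDihedralSegment P Γ t q) : 2 ≤ q := by
  by_contra! hlt
  have hsub : ((fun i => P.root (Γ i)) '' {i | InSeg t q i}).Subsingleton := by
    rintro _ ⟨i, hi, rfl⟩ _ ⟨j, hj, rfl⟩
    have : i = j := by
      unfold InSeg at hi hj
      simp only [Set.mem_ofPred_eq] at hi hj
      exact Fin.ext (by omega)
    rw [this]
  have hrk := hs.rank_two
  rcases hsub.eq_empty_or_singleton with h1 | ⟨v, h1⟩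
  · rw [h1, Submodule.span_empty, finrank_bot] at hrk
    omega
  · rw [h1] at hrk
    have := finrank_span_le_card (R := ℝ) ({v} : Set M)
    simp at this
    omega

lemma IsDihedralSegment.exists_isSegment (hs : IsDihedralSegment P Γ t q)
    (hΓ : ∀ i, b.IsPos (Γ i)) : ∃ bt, IsSegment b Γ t q bt ∧
      Module.finrank ℝ (Submodule.span ℝ (P.root '' arc bt q 0)) = 2 := by
  have h2 := hs.two_le
  have h0 : 0 < q ∧ t + q ≤ n := ⟨by omega, hs.le⟩
  set bt := segRoot P Γ t q h0 with hbt
  have hlabel : ∀ i : ℤ, 1 ≤ i → ∀ hq : i ≤ q, bt i = Γ ⟨t + (i - 1).toNat, by omega⟩ := by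
    intro i h1 hq
    obtain ⟨k, hk⟩ := Int.eq_ofNat_of_zero_le (sub_nonneg.mpr h1)
    obtain rfl : i = k + 1 := by omega
    rw [hbt, segRoot_of_lt h0 k (by omega)]
    congr 2
    omega
  have hcyc : IsRootCycle b q bt := by
    refine ⟨h2, segRoot_add_period h0, fun j h1 hq => ?_, fun i j hi hi' hj hj' hij => ?_⟩
    · rw [hlabel j h1 hq]; exact hΓ _
    · rw [hlabel i hi hi', hlabel j hj hj'] at hij
      have := hs.inj _ _ (by unfold InSeg; constructor <;> dsimp only <;> omega)
        (by unfold InSeg; constructor <;> dsimp only <;> omega) hij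
      have := congrArg Fin.val this
      dsimp only at this
      omega
  have hmem : ∀ x ∈ Set.range bt, ∃ i, InSeg t q i ∧ (x = Γ i ∨ x = opp P (Γ i)) := by
    rintro _ ⟨j, rfl⟩
    obtain ⟨i, h3, h4, h5⟩ := hcyc.exists_eq 0 j
    refine ⟨⟨t + (i - 1).toNat, by omega⟩, by unfold InSeg; constructor <;> dsimp only <;> omega, ?_⟩
    rwa [hlabel i (by omega) (by omega)] at h5
  have hseg : ∀ i : Fin n, InSeg t q i → ∃ j : ℤ, 1 ≤ j ∧ j ≤ q ∧ Γ i = bt j := by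
    intro i hi
    unfold InSeg at hi
    refine ⟨(i : ℕ) - t + 1, by omega, by omega, ?_⟩
    rw [hlabel _ (by omega) (by omega)]
    congr 1
    apply Fin.ext
    dsimp only
    omega
  refine ⟨bt, ⟨hcyc, hs.le, fun j hj => (segRoot_of_lt h0 j hj).symm, ?_⟩, ?_⟩
  · intro x hx y hy
    obtain ⟨i, hi, hxi⟩ := hmem x hx
    obtain ⟨j, hj, hyj⟩ := hmem y hy
    have hmain : P.reflectionPerm (Γ i) (Γ j) ∈ Set.range bt := by
      obtain ⟨k, hk, hk'⟩ := hs.closed i j hi hj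
      obtain ⟨l, -, -, hl⟩ := hseg k hk
      rw [← root_reflectionPerm] at hk'
      rcases hk' with hk' | hk'
      · rw [P.root.injective hk', hl]
        exact ⟨l, rfl⟩
      · rw [← root_opp] at hk'
        rw [P.root.injective hk', hl]
        exact hcyc.mem_range_opp ⟨l, rfl⟩
    rcases hxi with rfl | rfl <;> rcases hyj with rfl | rfl
    · exact hmain
    · rw [reflectionPerm_opp]; exact hcyc.mem_range_opp hmain
    · rw [reflectionPerm_opp_left]; exact hmain
    · rw [reflectionPerm_opp_left, reflectionPerm_opp]; exact hcyc.mem_range_opp hmain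
  · have : P.root '' arc bt q 0 = (fun i => P.root (Γ i)) '' {i | InSeg t q i} := by
      ext x
      constructor
      · rintro ⟨_, ⟨i, hi, rfl⟩, rfl⟩
        rw [Set.mem_Ioc] at hi
        refine ⟨⟨t + (i - 1).toNat, by omega⟩, by
          change InSeg t q _; unfold InSeg; constructor <;> dsimp only <;> omega, ?_⟩
        rw [hlabel i (by omega) (by omega)]
      · rintro ⟨i, hi, rfl⟩
        obtain ⟨j, h1, h2, h3⟩ := hseg i hi
        exact ⟨_, ⟨j, ⟨by omega, by omega⟩, rfl⟩, by dsimp only; rw [h3]⟩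
    rw [this, hs.rank_two]

/-- The arc j consists of the roots that are at their offset at time t + j. Subtracting
`offset_reflect` from `step` shows that the reflection in the current wall exchanges this condition
at times t + j and t + j + 1. -/
lemma IsSegment.isReflectingCycle (hs : IsSegment b Γ t q bt) (h : IsAlcovePath b lam Γ)
    (hrk : Module.finrank ℝ (Submodule.span ℝ (P.root '' arc bt q 0)) = 2) :
    IsReflectingCycle b q bt := by
  have harc : ∀ c, arc bt q c ⊆ Set.range bt := by
    rintro c _ ⟨i, -, rfl⟩; exact ⟨i, rfl⟩
  have key : ∀ (j : ℕ), j < q → ∀ x ∈ Set.range bt,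
      (x ∈ arc bt q (j + 1) ↔ P.reflectionPerm (bt (j + 1)) x ∈ arc bt q j) := by
    intro j hj x hx
    have ha : bt (j + 1) ∈ Set.range bt := ⟨_, rfl⟩
    have hx' := hs.closed _ ha x hx
    have h1 := h.step ⟨t + j, by have := hs.le; omega⟩ (P.reflectionPerm (bt (j + 1)) x)
    rw [hs.label j hj, P.reflectionPerm_self] at h1
    dsimp only at h1
    have h2 := hs.strip_of_mem_arc j hj.le (x := bt (j + 1)) ⟨j + 1, ⟨by omega, by omega⟩, rfl⟩
    have h3 := h.offset_reflect hs ha hx'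
    rw [P.reflectionPerm_self] at h3
    have h4 := hs.mem_arc_iff (j + 1) hj hx
    rw [Nat.cast_succ, ← add_assoc] at h4
    rw [h4, hs.mem_arc_iff j hj.le hx']
    rw [h2] at h1
    omega
  refine ⟨hs.toIsRootCycle, fun j hj hjq x hx => ?_, fun j hj hjq x hx => ?_, hrk⟩
  · obtain ⟨k, rfl⟩ := Int.eq_ofNat_of_zero_le hj
    rw [key k (by omega) _ (hs.closed _ ⟨_, rfl⟩ _ (harc _ hx)), P.reflectionPerm_self]
    exact hx
  · obtain ⟨k, rfl⟩ := Int.eq_ofNat_of_zero_le hj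
    exact (key k (by omega) _ (harc _ hx)).mp hx

section Reverse

lemma reverseSeg_of_not_inSeg {i : Fin n} (hi : ¬ InSeg t q i) : reverseSeg Γ t q i = Γ i := by
  rw [reverseSeg, dif_neg fun h => hi h.1]

lemma reverseSeg_of_lt (hle : t + q ≤ n) (j : ℕ) (hj : j < q) :
    reverseSeg Γ t q ⟨t + j, by omega⟩ = Γ ⟨t + (q - 1 - j), by omega⟩ := by
  rw [reverseSeg, dif_pos ⟨by unfold InSeg; dsimp only; omega, hle⟩]
  congr 2
  dsimp only
  omega

lemma range_reverse (bt : ℤ → ι) (q : ℕ) : Set.range (fun j => bt (q + 1 - j)) = Set.range bt := by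
  ext x
  constructor
  · rintro ⟨j, rfl⟩; exact ⟨_, rfl⟩
  · rintro ⟨j, rfl⟩; exact ⟨q + 1 - j, by simp⟩

lemma IsSegment.reverse (hs : IsSegment b Γ t q bt) :
    IsSegment b (reverseSeg Γ t q) t q (fun j => bt (q + 1 - j)) where
  two_le := hs.two_le
  add_period j := by
    rw [← hs.sub_period]; congr 1; ring
  pos j h1 h2 := hs.pos _ (by omega) (by omega)
  inj i j h1 h2 h3 h4 hij := by
    have := hs.inj _ _ (by omega) (by omega) (by omega) (by omega) hij
    omega
  le := hs.le
  label j hj := by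
    rw [reverseSeg_of_lt hs.le j hj, hs.label _ (by omega)]
    congr 1
    omega
  closed := by
    rw [range_reverse]
    exact hs.closed

lemma occ_congr {Γ' : Fin n → ι} {s : ℕ} (h : ∀ i : Fin n, (i : ℕ) < s → Γ' i = Γ i) {i : ℕ}
    (hi : i ≤ s) (x : ι) : occ Γ' i x = occ Γ i x := by
  rw [occ, occ]
  congr 1
  ext j
  simp only [Finset.mem_filter, Finset.mem_univ, true_and]
  refine and_congr_right fun hj => ?_
  rw [h j (by omega)]

lemma strip_reverseSeg_of_le {i : ℕ} (hi : i ≤ t) (x : ι) :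
    strip b (reverseSeg Γ t q) i x = strip b Γ i x := by
  have := fun x => occ_congr (Γ := Γ) (Γ' := reverseSeg Γ t q) (s := t)
    (fun j hj => reverseSeg_of_not_inSeg (by unfold InSeg; omega)) hi x
  rw [strip, strip, this, this]

lemma offset_reverseSeg (x : ι) : offset b (reverseSeg Γ t q) t x = offset b Γ t x := by
  rw [offset, offset, strip_reverseSeg_of_le le_rfl]

/-- Either order of the segment crosses the same hyperplanes once each, so the alcoves after it are
the same. -/
lemma IsSegment.strip_reverseSeg (hs : IsSegment b Γ t q bt) (hΓ : ∀ i, b.IsPos (Γ i)) {i : ℕ}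
    (hi : t + q ≤ i) (hin : i ≤ n) (x : ι) :
    strip b (reverseSeg Γ t q) i x = strip b Γ i x := by
  have hΓ' : ∀ i, b.IsPos (reverseSeg Γ t q i) := fun i => by
    rw [reverseSeg]; split_ifs <;> exact hΓ _
  induction i, hi using Nat.le_induction with
  | base =>
    by_cases hx : x ∈ Set.range bt
    · rw [hs.strip_end hx, hs.reverse.strip_end (by rwa [range_reverse]), offset_reverseSeg]
    · rw [hs.strip_of_notMem q le_rfl hx,
        hs.reverse.strip_of_notMem q le_rfl (by rwa [range_reverse]), strip_reverseSeg_of_le le_rfl]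
  | succ i hi ih =>
    have ih := ih (by omega)
    have he : reverseSeg Γ t q ⟨i, hin⟩ = Γ ⟨i, hin⟩ :=
      reverseSeg_of_not_inSeg (by unfold InSeg; dsimp only; omega)
    by_cases h1 : x = Γ ⟨i, hin⟩
    · have e1 := strip_succ_self (hΓ ⟨i, hin⟩)
      have e2 := strip_succ_self (hΓ' ⟨i, hin⟩)
      rw [he] at e2
      dsimp only at e1 e2
      rw [h1] at ih ⊢
      rw [e1, e2, ih]
    by_cases h2 : x = opp P (Γ ⟨i, hin⟩)
    · have e1 := strip_succ_opp (hΓ ⟨i, hin⟩)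
      have e2 := strip_succ_opp (hΓ' ⟨i, hin⟩)
      rw [he] at e2
      dsimp only at e1 e2
      rw [h2] at ih ⊢
      rw [e1, e2, ih]
    · have e1 := strip_succ_of_ne (b := b) h1 h2
      have e2 := strip_succ_of_ne (b := b) (Γ := reverseSeg Γ t q) (i := ⟨i, hin⟩) (α := x)
        (by rwa [he]) (by rwa [he])
      dsimp only at e1 e2
      rw [e1, e2, ih]

lemma notMem_reflect (hs : IsSegment b Γ t q bt) {a x : ι} (ha : a ∈ Set.range bt)
    (hx : x ∉ Set.range bt) : P.reflectionPerm a x ∉ Set.range bt := fun h => hx (by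
  have := hs.closed a ha _ h
  rwa [P.reflectionPerm_self] at this)

/-- The reversed segment goes round the same face in the opposite sense. For roots of the subsystem,
`step` becomes `offset_reflect`, because the wall reflection maps each arc to the next. -/
lemma IsAlcovePath.reverseSeg (h : IsAlcovePath b lam Γ) (hs : IsSegment b Γ t q bt)
    (hd : IsDihedral b q bt) : IsAlcovePath b lam (reverseSeg Γ t q) where
  pos i := by rw [AlcoveModel.reverseSeg]; split_ifs <;> exact h.pos _
  final α hα := by rw [hs.strip_reverseSeg h.pos hs.le le_rfl, h.final α hα]
  step i α := by
    by_cases hi : InSeg t q i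
    · obtain ⟨i, hin⟩ := i
      obtain ⟨j, rfl⟩ : ∃ j, i = t + j := Nat.exists_eq_add_of_le hi.1
      have hjq : j < q := by have := hi.2; dsimp only at this; omega
      have hr := hs.reverse
      rw [hr.label j hjq]
      dsimp only
      have ha : bt (q + 1 - (j + 1)) ∈ Set.range bt := ⟨_, rfl⟩
      have hr' : Set.range (fun j => bt (q + 1 - j)) = Set.range bt := range_reverse bt q
      have h2 := hr.strip_of_mem_arc j hjq.le (x := bt (q + 1 - (j + 1)))
        ⟨j + 1, ⟨by omega, by omega⟩, rfl⟩
      rw [h2, offset_reverseSeg, add_assoc t j 1]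
      by_cases hα : α ∈ Set.range bt
      · have h3 := h.offset_reflect hs ha hα
        rcases hr.mem_arc_cases j (x := α) (by rwa [hr']) with h4 | h4
        · have h5 := hr.strip_of_mem_arc j hjq.le h4
          have h6 : P.reflectionPerm (bt (q + 1 - (j + 1))) α ∈
              arc (fun j => bt (q + 1 - j)) q ((j + 1 : ℕ) : ℤ) := by
            obtain ⟨k, hk, rfl⟩ := h4
            rw [Set.mem_Ioc] at hk
            refine ⟨2 * (j + 1) - k + q, ⟨by push_cast; omega, by push_cast; omega⟩, ?_⟩
            exact (hd.reverse.reflect k (j + 1)).symm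
          rw [h5, hr.strip_of_mem_arc (j + 1) hjq h6, offset_reverseSeg, offset_reverseSeg, h3]
        · have h5 := hr.strip_of_opp_mem_arc j hjq.le h4
          have h6 : opp P (P.reflectionPerm (bt (q + 1 - (j + 1))) α) ∈
              arc (fun j => bt (q + 1 - j)) q ((j + 1 : ℕ) : ℤ) := by
            obtain ⟨k, hk, hk'⟩ := h4
            rw [← reflectionPerm_opp, ← hk']
            rw [Set.mem_Ioc] at hk
            refine ⟨2 * (j + 1) - k + q, ⟨by push_cast; omega, by push_cast; omega⟩, ?_⟩
            exact (hd.reverse.reflect k (j + 1)).symm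
          rw [h5, hr.strip_of_opp_mem_arc (j + 1) hjq h6, offset_reverseSeg, offset_reverseSeg,
            ← h3]
          ring
      · rw [hr.strip_of_notMem j hjq.le (by rwa [hr']),
          hr.strip_of_notMem (j + 1) hjq (by rw [hr']; exact notMem_reflect hs ha hα),
          strip_reverseSeg_of_le le_rfl, strip_reverseSeg_of_le le_rfl]
        -- Roots outside the subsystem do not change position within the segment, so the equation
        -- can be taken from the place of the same wall in Γ.
        have e1 := h.step ⟨t + (q - 1 - j), by have := hs.le; omega⟩ α
        have e2 := hs.label (q - 1 - j) (by omega)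
        rw [show ((q - 1 - j : ℕ) : ℤ) + 1 = q + 1 - (j + 1) by omega] at e2
        rw [e2] at e1
        dsimp only at e1
        have e3 := hs.strip_of_mem_arc (q - 1 - j) (by omega) (x := bt (q + 1 - (j + 1)))
          ⟨_, ⟨by omega, by omega⟩, rfl⟩
        rwa [e3, add_assoc, hs.strip_of_notMem _ (by omega) hα,
          hs.strip_of_notMem _ (by omega) (notMem_reflect hs ha hα)] at e1
    · rw [reverseSeg_of_not_inSeg hi]
      unfold InSeg at hi
      have := h.step i α
      by_cases hit : (i : ℕ) < t
      · simp only [strip_reverseSeg_of_le (show (i : ℕ) + 1 ≤ t from hit),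
          strip_reverseSeg_of_le hit.le]
        exact this
      · simp only [hs.strip_reverseSeg h.pos (show t + q ≤ (i : ℕ) + 1 by omega) (by omega),
          hs.strip_reverseSeg h.pos (show t + q ≤ (i : ℕ) by omega) i.2.le]
        exact this

end Reverse

end AlcoveModel
end

/-! ### Height walks inside the segment, and replacement of folds there. -/

noncomputable section

namespace AlcoveModel

open RootPairing IsRootCycle

section Walk

variable {n : ℕ} {J : Finset (Fin n)} {U D : Fin n → Prop} {h : ℕ → ℤ} {s : ℕ → Prop} {M : ℤ}
  {t q : ℕ}

/-- Between `t` and `t + q`, a walk either touches no hyperplane, or it stays in the strip between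
two adjacent hyperplanes `L` and `L + 1`, which it enters and leaves in the direction of `s`. -/
inductive IsWalk.Local (U D : Fin n → Prop) (h : ℕ → ℤ) (s : ℕ → Prop) (t q : ℕ) : Prop
  | flat (keep : ∀ i, InSeg t q i → ¬ U i ∧ ¬ D i)
  | strip (L : ℤ) (mem : ∀ j ≤ q, h (t + j) = L ∨ h (t + j) = L + 1)
      (up : ∀ i : Fin n, InSeg t q i → U i → h i = L)
      (down : ∀ i : Fin n, InSeg t q i → D i → h i = L + 1)
      (start : h t = L ↔ s t) (finish : h (t + q) = L + 1 ↔ s (t + q))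

namespace IsWalk

lemma ht_eq_of_flat (H : IsWalk J U D h s) (hn : t + q ≤ n)
    (keep : ∀ i : Fin n, InSeg t q i → ¬ U i ∧ ¬ D i) (j : ℕ) (hj : j ≤ q) : h (t + j) = h t := by
  induction j with
  | zero => rfl
  | succ j ih =>
    rw [← ih (by omega)]
    have hk := keep ⟨t + j, by omega⟩ (by unfold InSeg; dsimp only; omega)
    by_cases hJ : (⟨t + j, by omega⟩ : Fin n) ∈ J
    · exact H.fold_ht _ hJ
    · exact H.keep_ht _ hJ hk.1 hk.2

lemma pos_of_flat (H : IsWalk J U D h s) (hn : t + q ≤ n)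
    (keep : ∀ i : Fin n, InSeg t q i → ¬ U i ∧ ¬ D i) (hs : s t) (j : ℕ) (hj : j ≤ q) :
    s (t + j) := by
  induction j with
  | zero => exact hs
  | succ j ih =>
    have hk := keep ⟨t + j, by omega⟩ (by unfold InSeg; dsimp only; omega)
    exact H.keep_pos ⟨t + j, by omega⟩ (ih (by omega)) fun hh => hk.1 hh.2

lemma upper_pos_forward (H : IsWalk J U D h s) (hn : t + q ≤ n) {L : ℤ}
    (up : ∀ i : Fin n, InSeg t q i → U i → h i = L) {i j : ℕ} (hij : i ≤ j) (hj : j ≤ q)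
    (he : h (t + i) = L + 1) (hs : s (t + i)) : h (t + j) = L + 1 ∧ s (t + j) := by
  induction j, hij using Nat.le_induction with
  | base => exact ⟨he, hs⟩
  | succ j hij ih =>
    obtain ⟨h1, h2⟩ := ih (by omega)
    have hin : InSeg t q (⟨t + j, by omega⟩ : Fin n) := by unfold InSeg; dsimp only; omega
    have hU : ¬ U ⟨t + j, by omega⟩ := fun hU => by
      have := up _ hin hU; dsimp only at this; omega
    refine ⟨?_, H.keep_pos ⟨t + j, by omega⟩ h2 fun hh => hU hh.2⟩
    rw [← h1]
    by_cases hJ : (⟨t + j, by omega⟩ : Fin n) ∈ J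
    · exact H.fold_ht _ hJ
    · exact H.keep_ht _ hJ hU fun hD => H.down_neg _ hD h2

/-- At the upper height no upward wall is met, so a negative sign cannot have arisen there. An
unfolded step with negative sign can only go down. Hence this state persists backwards to the start
of the segment. -/
lemma upper_neg_backward (H : IsWalk J U D h s) (hn : t + q ≤ n) {L : ℤ}
    (up : ∀ i : Fin n, InSeg t q i → U i → h i = L)
    (down : ∀ i : Fin n, InSeg t q i → D i → h i = L + 1) (j : ℕ) (hj : j ≤ q)
    (he : h (t + j) = L + 1) (hs : ¬ s (t + j)) : h t = L + 1 ∧ ¬ s t := by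
  induction j with
  | zero => exact ⟨he, hs⟩
  | succ j ih =>
    rw [← add_assoc] at he hs
    have hin : InSeg t q (⟨t + j, by omega⟩ : Fin n) := by unfold InSeg; dsimp only; omega
    by_cases hJ : (⟨t + j, by omega⟩ : Fin n) ∈ J
    · have h3 := H.fold_ht _ hJ
      dsimp only at h3
      refine ih (by omega) (by omega) fun h4 => hs (H.keep_pos ⟨t + j, by omega⟩ h4 fun hh => ?_)
      have := up _ hin hh.2
      dsimp only at this; omega
    · have h4 := H.keep_of_notMem _ hJ
      dsimp only at h4
      rw [h4] at hs
      refine ih (by omega) ?_ hs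
      by_cases hD : D ⟨t + j, by omega⟩
      · exact down _ hin hD
      · have := H.keep_ht _ hJ (fun hU => hs (H.up_pos _ hU)) hD
        dsimp only at this; omega

/-- If the maximum is the lower height L, it is also taken at t. If it is L + 1, a positive sign
persists to the end of the segment, and a negative sign goes back to its start. -/
lemma exists_end (H : IsWalk J U D h s) (hn : t + q ≤ n) (hl : Local U D h s t q)
    (hM : ∀ i ≤ n, h i ≤ M) {i : ℕ} (hi : t ≤ i) (hi' : i ≤ t + q) (he : h i = M) :
    h t = M ∨ h (t + q) = M := by
  obtain ⟨j, rfl⟩ := Nat.exists_eq_add_of_le hi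
  rcases hl with keep | ⟨L, mem, up, down, start, finish⟩
  · rw [H.ht_eq_of_flat hn keep j (by omega)] at he
    exact Or.inl he
  · have h0 := mem 0 (by omega)
    rw [add_zero] at h0
    have hM0 := hM t (by omega)
    have h1 := mem j (by omega)
    by_cases hML : M = L
    · omega
    · have he' : h (t + j) = L + 1 := by omega
      rw [← he, he']
      by_cases hs : s (t + j)
      · exact Or.inr (H.upper_pos_forward hn up (by omega) le_rfl he' hs).1
      · exact Or.inl (H.upper_neg_backward hn up down j (by omega) he' hs).1

/-- If M = L, the height at t + q is L, and `finish` makes the sign there negative. If M = L + 1,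
the state goes back to t. -/
lemma exists_neg_end (H : IsWalk J U D h s) (hn : t + q ≤ n) (hl : Local U D h s t q)
    (hM : ∀ i ≤ n, h i ≤ M) {i : ℕ} (hi : t ≤ i) (hi' : i ≤ t + q) (he : h i = M ∧ ¬ s i) :
    (h t = M ∧ ¬ s t) ∨ (h (t + q) = M ∧ ¬ s (t + q)) := by
  obtain ⟨j, rfl⟩ := Nat.exists_eq_add_of_le hi
  obtain ⟨he, hs⟩ := he
  rcases hl with keep | ⟨L, mem, up, down, start, finish⟩
  · rw [H.ht_eq_of_flat hn keep j (by omega)] at he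
    exact Or.inl ⟨he, fun h0 => hs (H.pos_of_flat hn keep h0 j (by omega))⟩
  · have h0 := mem q le_rfl
    have hM0 := hM (t + q) hn
    have h1 := mem j (by omega)
    by_cases hML : M = L
    · refine Or.inr ⟨by omega, ?_⟩
      rw [← finish]
      omega
    · have he' : h (t + j) = L + 1 := by omega
      rw [← he, he']
      exact Or.inl (H.upper_neg_backward hn up down j (by omega) he' hs)

end IsWalk

lemma exists_le_of_exists_le {f f' : ℕ → Prop}
    (hout : ∀ i ≤ n, i ≤ t ∨ t + q ≤ i → (f i ↔ f' i))
    (hin : ∀ i, t ≤ i → i ≤ t + q → f i → f t ∨ f (t + q)) {i : ℕ} (hi : i ≤ n)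
    (ho : i ≤ t ∨ t + q ≤ i) (h : ∃ j ≤ i, f j) : ∃ j ≤ i, f' j := by
  obtain ⟨j, hj, hf⟩ := h
  by_cases hjo : j ≤ t ∨ t + q ≤ j
  · exact ⟨j, hj, (hout j (by omega) hjo).mp hf⟩
  · rcases hin j (by omega) (by omega) hf with h1 | h1
    · exact ⟨t, by omega, (hout t (by omega) (by omega)).mp h1⟩
    · exact ⟨t + q, by omega, (hout (t + q) (by omega) (by omega)).mp h1⟩

end Walk

variable {ι M N : Type*} [AddCommGroup M] [Module ℝ M] [AddCommGroup N] [Module ℝ N]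
  {P : RootPairing ι ℝ M N} {n : ℕ}
  [Finite ι] [P.IsRootSystem] [P.IsCrystallographic] [P.IsReduced]
  {b : P.Base} {Γ : Fin n → ι} {lam : M} {t q : ℕ} {bt : ℤ → ι} {p : ι} {J J' : Finset (Fin n)}

namespace IsSegment

lemma label_mem_arc (hs : IsSegment b Γ t q bt) (j : ℕ) (hj : j < q) (hn : t + j < n) :
    Γ ⟨t + j, hn⟩ ∈ arc bt q j :=
  ⟨j + 1, ⟨by omega, by omega⟩, (hs.label j hj).symm⟩

lemma label_mem_range (hs : IsSegment b Γ t q bt) {i : Fin n} (hi : InSeg t q i) :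
    Γ i ∈ Set.range bt := by
  obtain ⟨i, hin⟩ := i
  obtain ⟨j, rfl⟩ := Nat.exists_eq_add_of_le hi.1
  exact ⟨j + 1, (hs.label j (by have := hi.2; dsimp only at this; omega)).symm⟩

lemma pullback_notMem_range (hs : IsSegment b Γ t q bt)
    (h0 : (pullback P Γ p J t).1 ∉ Set.range bt) (j : ℕ) (hj : j ≤ q) :
    (pullback P Γ p J (t + j)).1 ∉ Set.range bt := by
  induction j with
  | zero => exact h0
  | succ j ih =>
    have ih := ih (by omega)
    have hn := hs.le
    have hin : InSeg t q (⟨t + j, by omega⟩ : Fin n) := by unfold InSeg; dsimp only; omega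
    rw [← add_assoc]
    by_cases hJ : (⟨t + j, by omega⟩ : Fin n) ∈ J
    · have := pullback_fst_succ_of_mem (P := P) (Γ := Γ) (p := p) hJ
      dsimp only at this
      rw [this]
      exact notMem_reflect hs (hs.label_mem_range hin) ih
    · have := pullback_succ_of_notMem (P := P) (Γ := Γ) (p := p) hJ
      dsimp only at this
      rwa [this]

/-- In a segment whose roots contain the pulled back direction, the pulled back hyperplane keeps
its distance to the face around which the segment turns. -/
lemma pullback_level (hs : IsSegment b Γ t q bt) (h : IsAlcovePath b lam Γ)
    (h0 : (pullback P Γ p J t).1 ∈ Set.range bt) (j : ℕ) (hj : j ≤ q) :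
    (pullback P Γ p J (t + j)).1 ∈ Set.range bt ∧
      offset b Γ t (pullback P Γ p J (t + j)).1 + (pullback P Γ p J (t + j)).2 =
        offset b Γ t (pullback P Γ p J t).1 + (pullback P Γ p J t).2 := by
  induction j with
  | zero => exact ⟨h0, rfl⟩
  | succ j ih =>
    obtain ⟨ih1, ih2⟩ := ih (by omega)
    have hn := hs.le
    have hin : InSeg t q (⟨t + j, by omega⟩ : Fin n) := by unfold InSeg; dsimp only; omega
    have ha := hs.label_mem_range hin
    rw [← add_assoc]
    by_cases hJ : (⟨t + j, by omega⟩ : Fin n) ∈ J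
    · have := pullback_succ_of_mem (P := P) (Γ := Γ) (p := p) hJ
      dsimp only at this
      rw [this, initFolding_eq h]
      dsimp only [reflHyp]
      refine ⟨hs.closed _ ha _ ih1, ?_⟩
      rw [← ih2, ← h.offset_reflect hs ha ih1,
        hs.strip_of_mem_arc j (by omega) (hs.label_mem_arc j hj _)]
      ring
    · have := pullback_succ_of_notMem (P := P) (Γ := Γ) (p := p) hJ
      dsimp only at this
      rw [this]
      exact ⟨ih1, ih2⟩

/-- If the pulled-back root lies in the subsystem, offset plus level is conserved; the height is
this constant L or L + 1, according to the arc. Otherwise no wall orthogonal to α_p is met. -/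
lemma isWalk_local (hs : IsSegment b Γ t q bt) (h : IsAlcovePath b lam Γ) :
    IsWalk.Local (fun i : Fin n => rootAt P Γ p J i = Γ i)
      (fun i : Fin n => rootAt P Γ p J i = opp P (Γ i)) (ht b Γ p J)
      (fun i => b.IsPos (rootAt P Γ p J i)) t q := by
  have hr : ∀ i, rootAt P Γ p J i = (pullback P Γ p J i).1 := fun i => (pullback_fst i).symm
  have hn := hs.le
  simp only [hr]
  by_cases h0 : (pullback P Γ p J t).1 ∈ Set.range bt
  · have hlev := hs.pullback_level h h0
    refine .strip (offset b Γ t (pullback P Γ p J t).1 + (pullback P Γ p J t).2) ?_ ?_ ?_ ?_ ?_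
    · intro j hj
      obtain ⟨h1, h2⟩ := hlev j hj
      rw [← h2, ht]
      rcases hs.strip_mem_range j hj h1 with h3 | h3 <;> rw [h3]
      · exact Or.inl rfl
      · right; ring
    · rintro ⟨i, hin⟩ hi hU
      obtain ⟨j, rfl⟩ := Nat.exists_eq_add_of_le hi.1
      have hjq : j < q := by have := hi.2; dsimp only at this; omega
      rw [← (hlev j hjq.le).2, ht, hs.strip_of_mem_arc j hjq.le]
      dsimp only at hU
      rw [hU]
      exact hs.label_mem_arc j hjq _
    · rintro ⟨i, hin⟩ hi hU
      obtain ⟨j, rfl⟩ := Nat.exists_eq_add_of_le hi.1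
      have hjq : j < q := by have := hi.2; dsimp only at this; omega
      rw [← (hlev j hjq.le).2, ht, hs.strip_of_opp_mem_arc j hjq.le]
      · ring
      · dsimp only at hU
        rw [hU, opp_opp]
        exact hs.label_mem_arc j hjq _
    · rw [ht, offset, strip₀]
      split_ifs with h1 <;> simp [h1]; omega
    · obtain ⟨h1, h2⟩ := hlev q le_rfl
      rw [← h2, ht, hs.strip_end h1, strip₀]
      split_ifs with h1 <;> simp [h1]; omega
  · refine .flat ?_
    rintro ⟨i, hin⟩ hi
    have ha := hs.label_mem_range hi
    obtain ⟨j, rfl⟩ := Nat.exists_eq_add_of_le hi.1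
    have hjq : j < q := by have := hi.2; dsimp only at this; omega
    have h1 := hs.pullback_notMem_range h0 j hjq.le
    refine ⟨fun hU => h1 (by dsimp only at hU; rwa [hU]), fun hU => h1 ?_⟩
    dsimp only at hU
    rw [hU]
    exact hs.mem_range_opp ha

lemma pullback_snd_end (hs : IsSegment b Γ t q bt) (h : IsAlcovePath b lam Γ)
    (hp : p ∈ b.support) (hJ : IsAdmissible b Γ J)
    (h0 : (pullback P Γ p J t).1 ∉ Set.range bt) :
    strip b Γ t (pullback P Γ p J (t + q)).1 + (pullback P Γ p J (t + q)).2 =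
      strip b Γ t (pullback P Γ p J t).1 + (pullback P Γ p J t).2 := by
  have hr : ∀ i, rootAt P Γ p J i = (pullback P Γ p J i).1 := fun i => (pullback_fst i).symm
  have h1 := (isWalk h hp hJ).ht_eq_of_flat hs.le (t := t) (q := q) ?_ q le_rfl
  · rwa [ht, ht, hs.strip_of_notMem q le_rfl (hs.pullback_notMem_range h0 q le_rfl)] at h1
  · rintro ⟨i, hin⟩ hi
    have ha := hs.label_mem_range hi
    obtain ⟨j, rfl⟩ := Nat.exists_eq_add_of_le hi.1
    have hjq : j < q := by have := hi.2; dsimp only at this; omega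
    have h1 := hs.pullback_notMem_range h0 j hjq.le
    simp only [hr]
    refine ⟨fun hU => h1 (by rwa [hU]), fun hU => h1 ?_⟩
    rw [hU]
    exact hs.mem_range_opp ha

end IsSegment

lemma weylAt_congr {Γ' : Fin n → ι} {s : ℕ} (hs : s ≤ n)
    (hΓ : ∀ i : Fin n, (i : ℕ) < s → Γ' i = Γ i)
    (hJ : ∀ i : Fin n, (i : ℕ) < s → (i ∈ J' ↔ i ∈ J)) {i : ℕ} (hi : i ≤ s) :
    weylAt P Γ' J' i = weylAt P Γ J i := by
  induction i with
  | zero => rw [weylAt_zero, weylAt_zero]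
  | succ i ih =>
    have ih := ih (by omega)
    have hm := hJ ⟨i, by omega⟩ hi
    by_cases hi' : (⟨i, by omega⟩ : Fin n) ∈ J
    · have h1 := weylAt_succ_of_mem (P := P) (Γ := Γ) hi'
      have h2 := weylAt_succ_of_mem (P := P) (Γ := Γ') (hm.mpr hi')
      dsimp only at h1 h2
      rw [h1, h2, ih, hΓ ⟨i, by omega⟩ hi]
    · have h1 := weylAt_succ_of_notMem (P := P) (Γ := Γ) hi'
      have h2 := weylAt_succ_of_notMem (P := P) (Γ := Γ') (fun h => hi' (hm.mp h))
      dsimp only at h1 h2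
      rw [h1, h2, ih]

/-- `J'` and `J` fold the paths of `reverseSeg Γ t q` and of `Γ` in the same way away from the
segment. -/
structure IsReplacement (P : RootPairing ι ℝ M N) (Γ Γ' : Fin n → ι) (t q : ℕ)
    (J J' : Finset (Fin n)) : Prop where
  mem_iff : ∀ i, ¬ InSeg t q i → (i ∈ J' ↔ i ∈ J)
  weylAt_end : weylAt P Γ' J' (t + q) = weylAt P Γ J (t + q)

namespace IsReplacement

variable {Γ' : Fin n → ι}

lemma weylAt_of_le (hR : IsReplacement P Γ Γ' t q J J')
    (hΓ' : ∀ i, ¬ InSeg t q i → Γ' i = Γ i) (hn : t + q ≤ n) {i : ℕ} (hi : i ≤ t) :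
    weylAt P Γ' J' i = weylAt P Γ J i :=
  weylAt_congr (show t ≤ n by omega) (fun i hi => hΓ' i (by unfold InSeg; omega))
    (fun i hi => hR.mem_iff i (by unfold InSeg; omega)) hi

lemma weylAt_of_ge (hR : IsReplacement P Γ Γ' t q J J')
    (hΓ' : ∀ i, ¬ InSeg t q i → Γ' i = Γ i) {i : ℕ} (hi : t + q ≤ i) (hin : i ≤ n) :
    weylAt P Γ' J' i = weylAt P Γ J i := by
  induction i, hi using Nat.le_induction with
  | base => exact hR.weylAt_end
  | succ i hi ih =>
    have ih := ih (by omega)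
    have hin : ¬ InSeg t q (⟨i, by omega⟩ : Fin n) := by unfold InSeg; dsimp only; omega
    have hm := hR.mem_iff _ hin
    by_cases hJ : (⟨i, by omega⟩ : Fin n) ∈ J
    · have h1 := weylAt_succ_of_mem (P := P) (Γ := Γ) hJ
      have h2 := weylAt_succ_of_mem (P := P) (Γ := Γ') (hm.mpr hJ)
      dsimp only at h1 h2
      rw [h1, h2, ih, hΓ' _ hin]
    · have h1 := weylAt_succ_of_notMem (P := P) (Γ := Γ) hJ
      have h2 := weylAt_succ_of_notMem (P := P) (Γ := Γ') (fun h => hJ (hm.mp h))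
      dsimp only at h1 h2
      rw [h1, h2, ih]

lemma weylAt_eq (hR : IsReplacement P Γ Γ' t q J J')
    (hΓ' : ∀ i, ¬ InSeg t q i → Γ' i = Γ i) (hn : t + q ≤ n) {i : ℕ} (hi : i ≤ n)
    (ho : i ≤ t ∨ t + q ≤ i) : weylAt P Γ' J' i = weylAt P Γ J i :=
  ho.elim (hR.weylAt_of_le hΓ' hn) fun ho => hR.weylAt_of_ge hΓ' ho hi

lemma rootAt_eq (hR : IsReplacement P Γ Γ' t q J J')
    (hΓ' : ∀ i, ¬ InSeg t q i → Γ' i = Γ i) (hn : t + q ≤ n) {i : ℕ} (hi : i ≤ n)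
    (ho : i ≤ t ∨ t + q ≤ i) : rootAt P Γ' p J' i = rootAt P Γ p J i := by
  rw [rootAt, rootAt, hR.weylAt_eq hΓ' hn hi ho]

/-- Outside the segment both paths make identical moves, so the point is the passage from t to t +
q. -/
lemma ht_eq (hR : IsReplacement P Γ (reverseSeg Γ t q) t q J J') (h : IsAlcovePath b lam Γ)
    (hs : IsSegment b Γ t q bt) (h' : IsAlcovePath b lam (reverseSeg Γ t q))
    (hp : p ∈ b.support) (hJ : IsAdmissible b Γ J) (hJ' : IsAdmissible b (reverseSeg Γ t q) J')
    {i : ℕ} (hi : i ≤ n) (ho : i ≤ t ∨ t + q ≤ i) :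
    ht b (reverseSeg Γ t q) p J' i = ht b Γ p J i := by
  have hn := hs.le
  have hΓ' : ∀ i, ¬ InSeg t q i → reverseSeg Γ t q i = Γ i := fun i => reverseSeg_of_not_inSeg
  have hW := isWalk h hp hJ
  have hW' := isWalk h' hp hJ'
  have step : ∀ i : Fin n, ¬ InSeg t q i →
      rootAt P (reverseSeg Γ t q) p J' i = rootAt P Γ p J i →
      ht b (reverseSeg Γ t q) p J' i = ht b Γ p J i →
      ht b (reverseSeg Γ t q) p J' (i + 1) = ht b Γ p J (i + 1) := by
    intro i hi e1 e2
    have hm := hR.mem_iff i hi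
    by_cases hJ : i ∈ J
    · rw [hW.fold_ht i hJ, hW'.fold_ht i (hm.mpr hJ), e2]
    · have hJ' : i ∉ J' := fun h => hJ (hm.mp h)
      by_cases hU : rootAt P Γ p J i = Γ i
      · rw [hW.up_ht i hJ hU, hW'.up_ht i hJ' (by rw [e1, hU, hΓ' i hi]), e2]
      by_cases hD : rootAt P Γ p J i = opp P (Γ i)
      · rw [hW.down_ht i hJ hD, hW'.down_ht i hJ' (by rw [e1, hD, hΓ' i hi]), e2]
      · rw [hW.keep_ht i hJ hU hD, hW'.keep_ht i hJ' (by rwa [e1, hΓ' i hi])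
          (by rwa [e1, hΓ' i hi]), e2]
  have hle : ∀ i ≤ t, ht b (reverseSeg Γ t q) p J' i = ht b Γ p J i := by
    intro i hi
    induction i with
    | zero => rw [hW.zero_ht, hW'.zero_ht]
    | succ i ih =>
      exact step ⟨i, by omega⟩ (by unfold InSeg; dsimp only; omega)
        (hR.rootAt_eq hΓ' hn (by dsimp only; omega) (by dsimp only; omega)) (ih (by omega))
  rcases ho with ho | ho
  · exact hle i ho
  induction i, ho using Nat.le_induction with
  | base =>
    have e0 := hle t le_rfl
    have e1 := hR.rootAt_eq (p := p) hΓ' hn (i := t) (by omega) (by omega)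
    have e2 := hR.rootAt_eq (p := p) hΓ' hn (i := t + q) (by omega) (by omega)
    simp only [rootAt, ← pullback_fst] at e1 e2
    rw [ht, ht, strip_reverseSeg_of_le le_rfl, e1] at e0
    rw [ht, ht, hs.strip_reverseSeg h.pos le_rfl hn, e2]
    have hr' : Set.range (fun j => bt (q + 1 - j)) = Set.range bt := range_reverse bt q
    -- The pulled-back roots agree at both ends because the Weyl group elements do. Their levels
    -- agree at t + q because a sum conserved in the segment, offset or position plus level, is the
    -- same for both paths.
    by_cases h0 : (pullback P Γ p J t).1 ∈ Set.range bt
    · have l1 := (hs.pullback_level h h0 q le_rfl).2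
      have l2 := (hs.reverse.pullback_level h' (p := p) (J := J') (by rwa [e1, hr']) q le_rfl).2
      rw [offset_reverseSeg, offset_reverseSeg, e1, e2] at l2
      linarith
    · have l1 := hs.pullback_snd_end h hp hJ h0
      have l2 := hs.reverse.pullback_snd_end h' hp hJ' (by rwa [e1, hr'])
      rw [strip_reverseSeg_of_le le_rfl, strip_reverseSeg_of_le le_rfl, e1, e2] at l2
      linarith
  | succ i hi' ih =>
    exact step ⟨i, by omega⟩ (by unfold InSeg; dsimp only; omega)
      (hR.rootAt_eq hΓ' hn (by dsimp only; omega) (by dsimp only; omega)) (ih (by omega))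

end IsReplacement

end AlcoveModel
end

/-! ### Yang–Baxter moves and their commutation with the root operators. -/

noncomputable section

namespace AlcoveModel

open RootPairing IsRootCycle

variable {ι M N : Type*} [AddCommGroup M] [Module ℝ M] [AddCommGroup N] [Module ℝ N]
  {P : RootPairing ι ℝ M N} {n : ℕ}
  [Finite ι] [P.IsRootSystem] [P.IsCrystallographic] [P.IsReduced]
  {b : P.Base} {Γ : Fin n → ι} {lam : M} {t q : ℕ} {bt : ℤ → ι} {p : ι} {J J' : Finset (Fin n)}

namespace IsSegment

lemma segSubgroup_eq (hs : IsSegment b Γ t q bt) (hd : IsDihedral b q bt) :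
    segSubgroup P Γ t q = dihedralSubgroup P bt := by
  apply le_antisymm
  · rw [segSubgroup, Subgroup.closure_le]
    rintro _ ⟨i, hi, rfl⟩
    exact Subgroup.subset_closure ⟨_, hs.label_mem_range hi, rfl⟩
  · rw [hd.dihedralSubgroup_eq, Subgroup.closure_le]
    have h2 := hs.two_le
    have hn := hs.le
    rintro _ ⟨_, rfl | rfl, rfl⟩
    · refine Subgroup.subset_closure ⟨⟨t + 0, by omega⟩, ?_, ?_⟩
      · change InSeg t q _; unfold InSeg; dsimp only; omega
      · dsimp only; rw [hs.label 0 (by omega)]; rfl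
    · refine Subgroup.subset_closure ⟨⟨t + (q - 1), by omega⟩, ?_, ?_⟩
      · change InSeg t q _; unfold InSeg; dsimp only; omega
      · dsimp only; rw [hs.label (q - 1) (by omega)]; congr 2; omega

lemma segGens_eq (hs : IsSegment b Γ t q bt) :
    segGens P Γ t q = refl P '' {bt 1, bt q} := by
  have h2 := hs.two_le
  have hn := hs.le
  have h1 := hs.label 0 (by omega)
  have h3 := hs.label (q - 1) (by omega)
  rw [show ((q - 1 : ℕ) : ℤ) + 1 = q by omega] at h3
  rw [Nat.cast_zero, zero_add] at h1
  rw [← h1, ← h3]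
  ext x
  constructor
  · rintro ⟨i, hi | hi, rfl⟩
    · exact ⟨_, Or.inl rfl, by dsimp only; congr 2; exact Fin.ext (by simpa using hi.symm)⟩
    · exact ⟨_, Or.inr rfl, by dsimp only; congr 2; exact Fin.ext (by dsimp only; omega)⟩
  · rintro ⟨_, rfl | rfl, rfl⟩
    · exact ⟨⟨t + 0, by omega⟩, Or.inl rfl, rfl⟩
    · exact ⟨⟨t + (q - 1), by omega⟩, Or.inr (by dsimp only; omega), rfl⟩

lemma barLength_eq (hs : IsSegment b Γ t q bt) (hd : IsDihedral b q bt) (u : P.weylGroup) :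
    barLength b Γ t q u =
      wordLength (refl P '' {bt 1, bt q}) ((minRep b (dihedralSubgroup P bt) u)⁻¹ * u) := by
  rw [barLength, hs.segGens_eq, hs.segSubgroup_eq hd]

variable {K : ℕ → Prop}

lemma weylAt_eq_walk (hs : IsSegment b Γ t q bt)
    (hK : ∀ i : Fin n, InSeg t q i → (K (i - t + 1) ↔ i ∈ J)) (j : ℕ) (hj : j ≤ q) :
    weylAt P Γ J (t + j) = walk P bt K (weylAt P Γ J t) j := by
  induction j with
  | zero => rfl
  | succ j ih =>
    have hn := hs.le
    have hl := hs.label j (by omega)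
    have hm := hK ⟨t + j, by omega⟩ (by unfold InSeg; dsimp only; omega)
    dsimp only at hm
    rw [Nat.add_sub_cancel_left] at hm
    rw [← add_assoc]
    by_cases hJ : (⟨t + j, by omega⟩ : Fin n) ∈ J
    · have h1 := weylAt_succ_of_mem (P := P) (Γ := Γ) hJ
      dsimp only at h1
      rw [h1, walk_succ_of_mem (hm.mpr hJ), ih (by omega), hl]
    · have h1 := weylAt_succ_of_notMem (P := P) (Γ := Γ) hJ
      dsimp only at h1
      rw [h1, walk_succ_of_notMem (fun h => hJ (hm.mp h)), ih (by omega)]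

lemma isCoverWalk_iff (hs : IsSegment b Γ t q bt)
    (hK : ∀ i : Fin n, InSeg t q i → (K (i - t + 1) ↔ i ∈ J)) :
    IsCoverWalk b q bt (weylAt P Γ J t) K ↔ ∀ i : Fin n, InSeg t q i → i ∈ J →
      length b (weylAt P Γ J (i + 1)) = length b (weylAt P Γ J i) + 1 := by
  have hw := hs.weylAt_eq_walk hK
  have hn := hs.le
  constructor
  · rintro h ⟨i, hin⟩ hi hJ
    obtain ⟨j, rfl⟩ := Nat.exists_eq_add_of_le hi.1
    have hjq : j < q := by have := hi.2; dsimp only at this; omega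
    have h1 := (hK _ hi).mpr hJ
    dsimp only at h1 ⊢
    rw [Nat.add_sub_cancel_left] at h1
    rw [add_assoc, hw _ hjq, hw _ hjq.le]
    exact h j hjq h1
  · intro h j hj hKj
    have hi : InSeg t q (⟨t + j, by omega⟩ : Fin n) := by unfold InSeg; dsimp only; omega
    have h1 := hK _ hi
    dsimp only at h1
    rw [Nat.add_sub_cancel_left] at h1
    have h2 := h _ hi (h1.mp hKj)
    dsimp only at h2
    rwa [add_assoc, hw _ hj, hw _ hj.le] at h2

/-- The part of an admissible set in a segment is determined by the elements of the Weyl group at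
its end points. -/
lemma eq_of_weylAt_eq (hs : IsSegment b Γ t q bt) (hd : IsDihedral b q bt)
    (hΓ : ∀ i, b.IsPos (Γ i)) (hJ : IsAdmissible b Γ J) (hJ' : IsAdmissible b Γ J')
    (hout : ∀ i, ¬ InSeg t q i → (i ∈ J ↔ i ∈ J'))
    (h0 : weylAt P Γ J t = weylAt P Γ J' t)
    (h1 : weylAt P Γ J (t + q) = weylAt P Γ J' (t + q)) : J = J' := by
  have hn := hs.le
  rw [isAdmissible_iff hΓ] at hJ hJ'
  obtain ⟨S, key⟩ : ∃ S : Finset (Fin n) → ℕ → Prop, ∀ J, ∀ i : Fin n, InSeg t q i →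
      (S J (i - t + 1) ↔ i ∈ J) := by
    refine ⟨fun J x => ∃ i : Fin n, InSeg t q i ∧ i ∈ J ∧ x = (i : ℕ) - t + 1,
      fun J i hi => ⟨?_, fun h => ⟨i, hi, h, rfl⟩⟩⟩
    rintro ⟨k, hk, hkJ, he⟩
    have : i = k := Fin.ext (by unfold InSeg at hi hk; omega)
    rwa [this]
  have c1 := (hs.isCoverWalk_iff (key J)).mpr fun i _ hi => hJ i hi
  have c2 := (hs.isCoverWalk_iff (key J')).mpr fun i _ hi => hJ' i hi
  rw [hs.weylAt_eq_walk (key J) q le_rfl, hs.weylAt_eq_walk (key J') q le_rfl, ← h0] at h1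
  rw [← h0] at c2
  ext i
  by_cases hi : InSeg t q i
  · rw [← key J i hi, ← key J' i hi]
    have := hi.1
    have := hi.2
    exact hd.coverWalk_unique c1 c2 h1 (by omega) (by omega)
  · exact hout i hi

end IsSegment

lemma mem_ybMove_of_not_inSeg {i : Fin n} (hi : ¬ InSeg t q i) :
    i ∈ ybMove b Γ t q J ↔ i ∈ J := by
  simp [ybMove, hi]

open scoped Classical in
lemma mem_ybMove_of_inSeg {i : Fin n} (hi : InSeg t q i) : i ∈ ybMove b Γ t q J ↔
    (i : ℕ) - t + 1 ∈ ybInvolution q (barLength b Γ t q (weylAt P Γ J t))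
      (barLength b Γ t q (weylAt P Γ J (t + q)))
      ((J.filter (InSeg t q)).image fun i : Fin n => (i : ℕ) - t + 1) := by
  simp only [ybMove, Finset.mem_union, Finset.mem_filter, hi, not_true_eq_false, and_false,
    false_or, Finset.mem_univ, true_and]
  rfl

/-- Shifting positions to labels turns the part of J in the segment into a cover walk of the
dihedral subgroup. The involution preserves its ends, so nothing changes outside. -/
lemma isReplacement_ybMove (hs : IsSegment b Γ t q bt) (hd : IsDihedral b q bt)
    (hΓ : ∀ i, b.IsPos (Γ i)) (hJ : IsAdmissible b Γ J) :
    IsReplacement P Γ (reverseSeg Γ t q) t q J (ybMove b Γ t q J) ∧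
      IsAdmissible b (reverseSeg Γ t q) (ybMove b Γ t q J) := by
  classical
  have hn := hs.le
  have hΓ' : ∀ i, ¬ InSeg t q i → reverseSeg Γ t q i = Γ i := fun i => reverseSeg_of_not_inSeg
  have hpos : ∀ i, b.IsPos (reverseSeg Γ t q i) := fun i => by
    rw [reverseSeg]; split_ifs <;> exact hΓ _
  rw [isAdmissible_iff hΓ] at hJ
  set K : Finset ℕ := (J.filter (InSeg t q)).image fun i : Fin n => (i : ℕ) - t + 1 with hKdef
  have hK : ∀ i : Fin n, InSeg t q i → ((fun x => x ∈ K) ((i : ℕ) - t + 1) ↔ i ∈ J) := by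
    intro i hi
    simp only [hKdef, Finset.mem_image, Finset.mem_filter]
    refine ⟨?_, fun h => ⟨i, ⟨h, hi⟩, rfl⟩⟩
    rintro ⟨k, ⟨hkJ, hk⟩, he⟩
    have : i = k := Fin.ext (by unfold InSeg at hi hk; omega)
    rwa [this]
  have hKq : ∀ x ∈ K, 1 ≤ x ∧ x ≤ q := by
    intro x hx
    simp only [hKdef, Finset.mem_image, Finset.mem_filter] at hx
    obtain ⟨k, ⟨-, hk⟩, rfl⟩ := hx
    unfold InSeg at hk
    omega
  have hcov := (hs.isCoverWalk_iff hK).mpr fun i _ hi => hJ i hi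
  obtain ⟨K', hK'def⟩ : ∃ K', K' = ybInvolution q (barLength b Γ t q (weylAt P Γ J t))
    (barLength b Γ t q (weylAt P Γ J (t + q))) K := ⟨_, rfl⟩
  have hK' : ∀ i : Fin n, InSeg t q i → ((fun x => x ∈ K') ((i : ℕ) - t + 1) ↔
      i ∈ ybMove b Γ t q J) := fun i hi => by rw [mem_ybMove_of_inSeg hi, hK'def]
  rw [hs.barLength_eq hd, hs.barLength_eq hd] at hK'def
  obtain ⟨h1, h2⟩ := hd.coverWalk_ybInvolution hKq hcov (hs.weylAt_eq_walk hK q le_rfl).symm hK'def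
  have h0 : weylAt P (reverseSeg Γ t q) (ybMove b Γ t q J) t = weylAt P Γ J t :=
    weylAt_congr (show t ≤ n by omega) (fun i hi => hΓ' i (by unfold InSeg; omega))
      (fun i hi => mem_ybMove_of_not_inSeg (by unfold InSeg; omega)) le_rfl
  rw [← h0] at h1 h2
  have hR : IsReplacement P Γ (reverseSeg Γ t q) t q J (ybMove b Γ t q J) :=
    ⟨fun i hi => mem_ybMove_of_not_inSeg hi,
      by rw [hs.reverse.weylAt_eq_walk hK' q le_rfl, h1]⟩
  refine ⟨hR, (isAdmissible_iff hpos).mpr fun i hi => ?_⟩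
  by_cases his : InSeg t q i
  · exact (hs.reverse.isCoverWalk_iff hK').mp h2 i his hi
  · have e1 := hR.weylAt_eq hΓ' hn i.2.le (by unfold InSeg at his; omega)
    have e2 := hR.weylAt_eq hΓ' hn (i := i + 1) i.2 (by unfold InSeg at his; omega)
    rw [e1, e2]
    exact hJ i ((hR.mem_iff i his).mp hi)

/-- Corresponding paths in a chain and in the chain with a reversed segment turn at corresponding
places. -/
structure IsTurnPair (b : P.Base) (Γ : Fin n → ι) (t q : ℕ) (p : ι) (J J' : Finset (Fin n))
    (L : ℤ) (k k' : Fin n) (m m' : ℕ) : Prop where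
  turn : IsPathTurn b Γ p J L k m
  turn' : IsPathTurn b (reverseSeg Γ t q) p J' L k' m'
  lt_iff : ∀ i ≤ n, i ≤ t ∨ t + q ≤ i → ((k : ℕ) < i ↔ (k' : ℕ) < i)
  fold_lt_iff : ∀ i ≤ n, i ≤ t ∨ t + q ≤ i → (m < i ↔ m' < i)

/-- Both maxima are attained outside the interior of the segment, where the heights of the two paths
agree. -/
lemma IsReplacement.exists_max (hR : IsReplacement P Γ (reverseSeg Γ t q) t q J J')
    (hs : IsSegment b Γ t q bt) (h : IsAlcovePath b lam Γ)
    (h' : IsAlcovePath b lam (reverseSeg Γ t q)) (hp : p ∈ b.support) (hJ : IsAdmissible b Γ J)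
    (hJ' : IsAdmissible b (reverseSeg Γ t q) J') :
    ∃ L, (∀ i ≤ n, ht b Γ p J i ≤ L) ∧ (∀ i ≤ n, ht b (reverseSeg Γ t q) p J' i ≤ L) ∧
      (∃ i ≤ n, ht b Γ p J i = L) ∧ ∃ i ≤ n, ht b (reverseSeg Γ t q) p J' i = L := by
  have hn := hs.le
  have hout := fun i hi ho => hR.ht_eq h hs h' hp hJ hJ' (i := i) hi ho
  have attain : ∀ {f : ℕ → ℤ} {L : ℤ}, (∃ i ≤ n, f i = L) →
      (∀ i, t ≤ i → i ≤ t + q → f i = L → f t = L ∨ f (t + q) = L) →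
      ∃ i ≤ n, (i ≤ t ∨ t + q ≤ i) ∧ f i = L := by
    rintro f L ⟨i, hi, he⟩ hin
    by_cases ho : i ≤ t ∨ t + q ≤ i
    · exact ⟨i, hi, ho, he⟩
    · rcases hin i (by omega) (by omega) he with h1 | h1
      · exact ⟨t, by omega, by omega, h1⟩
      · exact ⟨t + q, by omega, by omega, h1⟩
  obtain ⟨L, hL, hL'⟩ := IsWalk.exists_max n (ht b Γ p J)
  obtain ⟨L₂, hL₂, hL₂'⟩ := IsWalk.exists_max n (ht b (reverseSeg Γ t q) p J')
  obtain ⟨i, hi, ho, he⟩ := attain hL' fun i h1 h2 h3 =>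
    (isWalk h hp hJ).exists_end hn (hs.isWalk_local h) hL h1 h2 h3
  obtain ⟨i₂, hi₂, ho₂, he₂⟩ := attain hL₂' fun i h1 h2 h3 =>
    (isWalk h' hp hJ').exists_end hn (hs.reverse.isWalk_local h') hL₂ h1 h2 h3
  obtain rfl : L = L₂ := by
    have h1 := hL₂ i hi
    have h2 := hL i₂ hi₂
    rw [hout i hi ho] at h1
    rw [hout i₂ hi₂ ho₂] at he₂
    omega
  exact ⟨L, hL, hL₂, hL', hL₂'⟩

lemma IsReplacement.isTurnPair (hR : IsReplacement P Γ (reverseSeg Γ t q) t q J J')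
    (hs : IsSegment b Γ t q bt) (h : IsAlcovePath b lam Γ)
    (h' : IsAlcovePath b lam (reverseSeg Γ t q)) (hp : p ∈ b.support) (hJ : IsAdmissible b Γ J)
    (hJ' : IsAdmissible b (reverseSeg Γ t q) J') {L : ℤ} (hL : ∀ i ≤ n, ht b Γ p J i ≤ L)
    (hL' : ∀ i ≤ n, ht b (reverseSeg Γ t q) p J' i ≤ L) {k k' : Fin n} {m m' : ℕ}
    (H : IsPathTurn b Γ p J L k m) (H' : IsPathTurn b (reverseSeg Γ t q) p J' L k' m') :
    IsTurnPair b Γ t q p J J' L k k' m m' := by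
  have hn := hs.le
  have hΓ' : ∀ i, ¬ InSeg t q i → reverseSeg Γ t q i = Γ i := fun i => reverseSeg_of_not_inSeg
  have hout := fun i hi ho => hR.ht_eq h hs h' hp hJ hJ' (i := i) hi ho
  have hrt := fun i hi ho => hR.rootAt_eq (p := p) hΓ' hn (i := i) hi ho
  have W := isWalk h hp hJ
  have W' := isWalk h' hp hJ'
  have l := hs.isWalk_local (p := p) (J := J) h
  have l' := hs.reverse.isWalk_local (p := p) (J := J') h'
  refine ⟨H, H', fun i hi ho => ?_, fun i hi ho => ?_⟩
  · rw [H.lt_iff, H'.lt_iff]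
    constructor
    · exact exists_le_of_exists_le (fun i hi ho => by rw [hout i hi ho])
        (fun i h1 h2 h3 => W.exists_end hn l hL h1 h2 h3) hi ho
    · exact exists_le_of_exists_le (fun i hi ho => by rw [hout i hi ho])
        (fun i h1 h2 h3 => W'.exists_end hn l' hL' h1 h2 h3) hi ho
  · rw [H.fold_lt_iff hi, H'.fold_lt_iff hi]
    constructor
    · exact exists_le_of_exists_le (fun i hi ho => by rw [hout i hi ho, hrt i hi ho])
        (fun i h1 h2 h3 => W.exists_neg_end hn l hL h1 h2 h3) hi ho
    · exact exists_le_of_exists_le (fun i hi ho => by rw [hout i hi ho, hrt i hi ho])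
        (fun i h1 h2 h3 => W'.exists_neg_end hn l' hL' h1 h2 h3) hi ho

/-- Outside the segment k and k' coincide, as do m and m'; inside they may differ. At t + q both
elements acquire the factor s_p under the same condition. -/
lemma IsTurnPair.isReplacement {L : ℤ} {k k' : Fin n} {m m' : ℕ}
    (T : IsTurnPair b Γ t q p J J' L k k' m m') (hn : t + q ≤ n)
    (hR : IsReplacement P Γ (reverseSeg Γ t q) t q J J') :
    IsReplacement P Γ (reverseSeg Γ t q) t q (moveFold J k m) (moveFold J' k' m') := by
  refine ⟨fun i hi => ?_, ?_⟩
  · have hi' : (i : ℕ) < t ∨ t + q ≤ i := by unfold InSeg at hi; omega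
    have a1 := T.lt_iff i i.2.le (by omega)
    have a2 := T.lt_iff (i + 1) i.2 (by omega)
    have a3 := T.fold_lt_iff i i.2.le (by omega)
    have a4 := T.fold_lt_iff (i + 1) i.2 (by omega)
    rw [mem_moveFold, mem_moveFold, hR.mem_iff i hi, Fin.ext_iff, Fin.ext_iff]
    -- The equality i = k means k < i + 1 but not k < i, and both comparisons are shared by the two
    -- turns.
    have b1 : (i : ℕ) = k' ↔ (i : ℕ) = k := by omega
    have b2 : (i : ℕ) = m' ↔ (i : ℕ) = m := by omega
    rw [b1, Ne, Ne, b2]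
  · have a1 := T.lt_iff (t + q) hn (by omega)
    have a2 := T.fold_lt_iff (t + q) hn (by omega)
    rw [T.turn.weylAt_moveFold _ hn, T.turn'.weylAt_moveFold _ hn, hR.weylAt_end]
    simp only [a1, ← not_lt, a2]

/-- The set Y(J) is one admissible replacement of J, and there is at most one because an increasing
chain in the segment is determined by its end points. Commutation therefore needs no case analysis
of the involution. -/
lemma IsReplacement.eq_ybMove (hR : IsReplacement P Γ (reverseSeg Γ t q) t q J J')
    (hs : IsSegment b Γ t q bt) (hd : IsDihedral b q bt) (hΓ : ∀ i, b.IsPos (Γ i))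
    (hJ : IsAdmissible b Γ J) (hJ' : IsAdmissible b (reverseSeg Γ t q) J') :
    J' = ybMove b Γ t q J := by
  have hn := hs.le
  have hΓ' : ∀ i, ¬ InSeg t q i → reverseSeg Γ t q i = Γ i := fun i => reverseSeg_of_not_inSeg
  obtain ⟨hR', hY⟩ := isReplacement_ybMove hs hd hΓ hJ
  have hpos : ∀ i, b.IsPos (reverseSeg Γ t q i) := fun i => by
    rw [reverseSeg]; split_ifs <;> exact hΓ _
  refine hs.reverse.eq_of_weylAt_eq hd.reverse hpos hJ' hY
    (fun i hi => (hR.mem_iff i hi).trans (hR'.mem_iff i hi).symm) ?_ ?_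
  · rw [hR.weylAt_of_le hΓ' hn le_rfl, hR'.weylAt_of_le hΓ' hn le_rfl]
  · rw [hR.weylAt_end, hR'.weylAt_end]

/-- The Yang–Baxter moves commute with the root operators. -/
lemma rootF_ybMove (hs : IsSegment b Γ t q bt) (hd : IsDihedral b q bt) (h : IsAlcovePath b lam Γ)
    (hp : p ∈ b.support) (hJ : IsAdmissible b Γ J) :
    (rootF b lam p Γ J = none ∧
      rootF b lam p (reverseSeg Γ t q) (ybMove b Γ t q J) = none) ∨
    ∃ K, rootF b lam p Γ J = some K ∧ IsAdmissible b Γ K ∧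
      rootF b lam p (reverseSeg Γ t q) (ybMove b Γ t q J) = some (ybMove b Γ t q K) := by
  have h' := h.reverseSeg hs hd
  obtain ⟨hR, hY⟩ := isReplacement_ybMove hs hd h.pos hJ
  obtain ⟨L, hL, hL', hmax, hmax'⟩ := hR.exists_max hs h h' hp hJ hY
  rcases le_or_gt L 0 with hle | hpos
  · exact Or.inl ⟨rootF_eq_none h hp fun i hi => (hL i hi).trans hle,
      rootF_eq_none h' hp fun i hi => (hL' i hi).trans hle⟩
  · obtain ⟨k, m, H⟩ := (isWalk h hp hJ).exists_isTurn hL hmax hpos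
    obtain ⟨k', m', H'⟩ := (isWalk h' hp hY).exists_isTurn hL' hmax' hpos
    have T := hR.isTurnPair hs h h' hp hJ hY hL hL' H H'
    have hK := IsTurn.isAdmissible h hp hJ H
    have hK' := IsTurn.isAdmissible h' hp hY H'
    refine Or.inr ⟨_, rootF_eq_some h hp hL hpos H, hK, ?_⟩
    rw [rootF_eq_some h' hp hL' hpos H', (T.isReplacement hs.le hR).eq_ybMove hs hd h.pos hK hK']

end AlcoveModel
end

open AlcoveModel in
theorem mainTheorem4 {ι M N : Type*} [Finite ι] [AddCommGroup M] [Module ℝ M]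
    [AddCommGroup N] [Module ℝ N] (P : RootPairing ι ℝ M N) [P.IsRootSystem]
    [P.IsCrystallographic] [P.IsReduced] [P.IsIrreducible] (b : P.Base)
    (lam : M) (hlam : IsDominantWeight b lam)
    {n : ℕ} (Γ : Fin n → ι) (hΓ : IsLambdaChain b lam Γ)
    (t q : ℕ) (hseg : IsDihedralSegment P Γ t q)
    (p : ι) (hp : p ∈ b.support)
    (J : Finset (Fin n)) (hJ : IsAdmissible b Γ J) :
    IsAdmissible b (reverseSeg Γ t q) (ybMove b Γ t q J) ∧
    ((rootF b lam p Γ J).isSome ↔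
      (rootF b lam p (reverseSeg Γ t q) (ybMove b Γ t q J)).isSome) ∧
    ∀ K, rootF b lam p Γ J = some K →
      IsAdmissible b Γ K ∧
      rootF b lam p (reverseSeg Γ t q) (ybMove b Γ t q J) = some (ybMove b Γ t q K) := by
  have h := hΓ.isAlcovePath hlam
  obtain ⟨bt, hs, hrk⟩ := hseg.exists_isSegment h.pos
  have hd := (hs.isReflectingCycle h hrk).isDihedral
  refine ⟨(isReplacement_ybMove hs hd h.pos hJ).2, ?_⟩
  rcases rootF_ybMove hs hd h hp hJ with ⟨h1, h2⟩ | ⟨K, h1, hK, h2⟩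
  · simp [h1, h2]
  · refine ⟨by simp [h1, h2], fun K' hK' => ?_⟩
    obtain rfl : K = K' := Option.some.inj (h1.symm.trans hK')
    exact ⟨hK, h2⟩
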